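/- **Setting.** A vocabulary consists of constant symbols and of function and relation symbols of positive arity. Let $\mathcal R$ be a first-order structure with universe $R$ over an arbitrary (possibly infinite) vocabulary. $\mathcal R$ is *bipointed* if its vocabulary has two constant symbols $0$ and $1$ with $0^{\mathcal R}\neq 1^{\mathcal R}$. Let $R^*=\bigcup_{n\ge 0}R^n$, and let $|v|$ be the length of $v\in R^*$. A decision problem is a set $S\subseteq R^*$, and a complexity class is a set of decision problems. *Machines.* An $\mathcal R$-machine has registers $Z[0],Z[1],\dots$ holding elements of $R$, finitely many index registers $I[0],I[1],\dots$ holding natural numbers, and a program, i.e. a finite list of instructions labelled $0,\dots,\ell$. The last of these, and only the last, is $\mathsf{stop}$; the others have one of the forms $Z[j_0]:=c$; $\ Z[j_0]:=f(Z[j_1],\dots,Z[j_m])$; $\ $if $Z[j_1]=Z[j_2]$ then goto $\ell_1$ else goto $\ell_2$; $\ $if $P(Z[j_1],\dots,Z[j_m])$ then goto $\ell_1$ else goto $\ell_2$; $\ Z[I[j_0]]:=Z[I[j_1]]$; $\ I[j_0]:=I[j_0]+1$; $\ I[j_0]:=\max(I[j_0]-1,0)$; $\ $if $I[j_1]=I[j_2]$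 then goto $\ell_1$ else goto $\ell_2$, where $c,f,P$ are constant, function and relation symbols of $\mathcal R$. A machine with an oracle $Q\subseteq R^*$ may also use the instruction: if $(Z[0],\dots,Z[I[0]])\in Q$ then goto $\ell_1$ else goto $\ell_2$. On input $v=(r_1,\dots,r_n)$ the machine starts at label $0$ with $Z[i-1]=r_i$ for $1\le i\le n$, $I[0]=n$, all other registers $Z[i]$ containing $0^{\mathcal R}$ and all other index registers containing $0$. Each instruction takes one step. The machine halts when it reaches $\mathsf{stop}$ (a jump to a nonexistent label never halts), and its output is then $M(v)=(Z[0],\dots,Z[I[0]-1])$. It is polynomial-time if for some polynomial $p$ it halts on every $v\in R^*$ within $p(|v|)$ steps; for a machine with oracle $Q$ this refers to its computations with that oracle $Q$. *Tuples.* For $k\ge 1$ the input $(v,w_1,\dots,w_k)$ is the string obtained by concatenating $v,w_1,\dots,w_k$ and preceding each letter by a flag, which is $1$ if the letter is the first letter of some $w_i$, and $0$ otherwise. For $k=0$ the input is $v$ itself. *Classes.* For $k\in\mathbb N$, $\Sigma_k\mathcal R$ is the class of all $S\subseteq R^*$ for which there are a polynomial $q$ with coefficients in $\mathbb N$ and a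 polynomial-time $\mathcal R$-machine $M$ without oracle such that for all $n$ and all $v\in R^n$ $$v\in S\iff (Q_1w_1\in R^{q(n)})\cdots(Q_kw_k\in R^{q(n)})\; M(v,w_1,\dots,w_k)=1,$$ where the quantifiers $Q_i\in\{\exists,\forall\}$ alternate and $Q_1=\exists$; here $M(\cdot)=1$ means that the output is the string $(1^{\mathcal R})$ of length one. $\Pi_k\mathcal R$ is defined in the same way with $Q_1=\forall$. Put $\mathrm{NP}(\mathcal R)=\Sigma_1\mathcal R$ and $\mathrm{coNP}(\mathcal R)=\Pi_1\mathcal R$. For a complexity class $\mathcal D$, the classes $\mathrm{NP}(\mathcal R)^{\mathcal D}$ and $\mathrm{coNP}(\mathcal R)^{\mathcal D}$ are defined like $\Sigma_1\mathcal R$ and $\Pi_1\mathcal R$, except that $M$ may be a polynomial-time machine with an oracle $Q$, for some $Q\in\mathcal D$. **Theorem (Oracle Polynomial Hierarchy Characterization).** Let $\mathcal R$ be a bipointed structure. Then for all $k\in\mathbb N$, $$\Sigma_{k+1}\mathcal R=\mathrm{NP}(\mathcal R)^{\Sigma_k\mathcal R}\qquad\text{and}\qquad \Pi_{k+1}\mathcal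 R=\mathrm{coNP}(\mathcal R)^{\Sigma_k\mathcal R}.$$ -/

import Mathlib

universe u v w

namespace RMachine

/-- A structure is *bipointed* if its vocabulary has two constant symbols `0` and `1` which it
interprets as different elements of its universe. -/
structure Bipointed (L : FirstOrder.Language.{u, v}) (R : Type w) [L.Structure R] where
  zeroSym : L.Constants
  oneSym : L.Constants
  zero_ne_one : (zeroSym : R) ≠ (oneSym : R)

/-- The element of the universe denoted by the constant symbol `0`. -/
def Bipointed.zero {L : FirstOrder.Language.{u, v}} {R : Type w} [L.Structure R] (B : Bipointed L R) : R :=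
  (B.zeroSym : R)

/-- The element of the universe denoted by the constant symbol `1`. -/
def Bipointed.one {L : FirstOrder.Language.{u, v}} {R : Type w} [L.Structure R] (B : Bipointed L R) : R :=
  (B.oneSym : R)

/-- The instructions other than `stop`. Here `Z[j]` is the `j`-th `R`-register and `I[j]` the
`j`-th index register; function and relation symbols have positive arity. -/
inductive Instr (L : FirstOrder.Language.{u, v}) : Type (max u v)
  /-- `Z[j₀] := c` -/
  | const (j₀ : ℕ) (c : L.Constants)
  /-- `Z[j₀] := f (Z[j 0], …, Z[j n])` -/
  | func (j₀ : ℕ) {n : ℕ} (f : L.Functions (n + 1)) (j : Fin (n + 1) → ℕ)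
  /-- `if Z[j₁] = Z[j₂] then goto l₁ else goto l₂` -/
  | ifEq (j₁ j₂ l₁ l₂ : ℕ)
  /-- `if P (Z[j 0], …, Z[j n]) then goto l₁ else goto l₂` -/
  | ifRel {n : ℕ} (P : L.Relations (n + 1)) (j : Fin (n + 1) → ℕ) (l₁ l₂ : ℕ)
  /-- `Z[I[j₀]] := Z[I[j₁]]` -/
  | copy (j₀ j₁ : ℕ)
  /-- `I[j₀] := I[j₀] + 1` -/
  | inc (j₀ : ℕ)
  /-- `I[j₀] := I[j₀] ∸ 1` (truncated subtraction) -/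
  | dec (j₀ : ℕ)
  /-- `if I[j₁] = I[j₂] then goto l₁ else goto l₂` -/
  | ifIdxEq (j₁ j₂ l₁ l₂ : ℕ)
  /-- `if (Z[0], …, Z[I[0]]) ∈ Q then goto l₁ else goto l₂`, where `Q` is the oracle -/
  | query (l₁ l₂ : ℕ)

/-- A program `0 : instr₀; …; (ℓ - 1) : instr_(ℓ-1); ℓ : stop`. The instruction `stop` occurs
exactly once, at the end, so it is left implicit: the program is given by the list of its other
instructions, and the label of `stop` is the length of this list. Programs may contain query
instructions; those of machines without oracle must not, see `QueryFree`. -/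
abbrev Program (L : FirstOrder.Language.{u, v}) : Type (max u v) := List (Instr L)

/-- The program has no query instruction, so that it is the program of an ordinary machine. -/
def Program.QueryFree {L : FirstOrder.Language.{u, v}} (M : Program L) : Prop :=
  ∀ l₁ l₂ : ℕ, Instr.query l₁ l₂ ∉ M

/-- A configuration: the label of the current instruction, the contents of the index registers and
the contents of the `R`-registers. A program mentions only finitely many index registers, and the
other ones never change, so they may be present. -/
structure Config (R : Type w) where
  label : ℕ
  idx : ℕ → ℕ
  mem : ℕ → R

/-- The string `(Z[0], …, Z[m - 1])`. -/
def Config.string {R : Type w} (c : Config R) (m : ℕ) : List R := (List.range m).map c.mem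

open Classical in
/-- The effect of an instruction on a configuration, for the oracle `Q`. -/
noncomputable def Instr.exec {L : FirstOrder.Language.{u, v}} {R : Type w} [L.Structure R]
    (Q : Set (List R)) (c : Config R) : Instr L → Config R
  | .const j₀ a => ⟨c.label + 1, c.idx, Function.update c.mem j₀ (a : R)⟩
  | .func j₀ f j =>
      ⟨c.label + 1, c.idx,
        Function.update c.mem j₀ (FirstOrder.Language.Structure.funMap f fun i => c.mem (j i))⟩
  | .ifEq j₁ j₂ l₁ l₂ => ⟨if c.mem j₁ = c.mem j₂ then l₁ else l₂, c.idx, c.mem⟩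
  | .ifRel P j l₁ l₂ =>
      ⟨if FirstOrder.Language.Structure.RelMap P (fun i => c.mem (j i)) then l₁ else l₂, c.idx, c.mem⟩
  | .copy j₀ j₁ => ⟨c.label + 1, c.idx, Function.update c.mem (c.idx j₀) (c.mem (c.idx j₁))⟩
  | .inc j₀ => ⟨c.label + 1, Function.update c.idx j₀ (c.idx j₀ + 1), c.mem⟩
  | .dec j₀ => ⟨c.label + 1, Function.update c.idx j₀ (c.idx j₀ - 1), c.mem⟩
  | .ifIdxEq j₁ j₂ l₁ l₂ => ⟨if c.idx j₁ = c.idx j₂ then l₁ else l₂, c.idx, c.mem⟩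
  | .query l₁ l₂ => ⟨if c.string (c.idx 0 + 1) ∈ Q then l₁ else l₂, c.idx, c.mem⟩

/-- The transition function of a program, a partial function. It is undefined at stop
configurations (and at labels beyond that of `stop`, which are not labels of the program; a
computation that jumps there does not halt). -/
noncomputable def Program.next {L : FirstOrder.Language.{u, v}} {R : Type w} [L.Structure R]
    (M : Program L) (Q : Set (List R)) (c : Config R) : Option (Config R) :=
  (M[c.label]?).map fun i => i.exec Q c

/-- The initial configuration on the input `x = (r₁, …, rₙ)`: the `R`-registers contain
`r₁, …, rₙ, 0, 0, …` and the index registers `n, 0, 0, …`. -/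
def Bipointed.init {L : FirstOrder.Language.{u, v}} {R : Type w} [L.Structure R] (B : Bipointed L R)
    (x : List R) : Config R where
  label := 0
  idx := fun j => if j = 0 then x.length else 0
  mem := fun i => x.getD i B.zero

/-- The configuration after `t` steps of the computation on input `x`, if there is one. -/
noncomputable def Program.run {L : FirstOrder.Language.{u, v}} {R : Type w} [L.Structure R]
    (M : Program L) (B : Bipointed L R) (Q : Set (List R)) (x : List R) : ℕ → Option (Config R)
  | 0 => some (B.init x)
  | t + 1 => (M.run B Q x t).bind (M.next Q)

/-- On input `x` the machine with oracle `Q` halts in time exactly `t`, with output `y`. The length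
of the output is the content of `I[0]`. -/
def Program.HaltsIn {L : FirstOrder.Language.{u, v}} {R : Type w} [L.Structure R]
    (M : Program L) (B : Bipointed L R) (Q : Set (List R)) (x : List R) (t : ℕ) (y : List R) :
    Prop :=
  ∃ c : Config R, M.run B Q x t = some c ∧ c.label = M.length ∧ c.string (c.idx 0) = y

/-- The machine with oracle `Q` halts on every input, in time bounded by a polynomial in the length
of the input. -/
def Program.PolyTime {L : FirstOrder.Language.{u, v}} {R : Type w} [L.Structure R]
    (M : Program L) (B : Bipointed L R) (Q : Set (List R)) : Prop :=
  ∃ p : Polynomial ℕ, ∀ x : List R, ∃ t ≤ p.eval x.length, ∃ y, M.HaltsIn B Q x t y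

/-- `M(x) = 1` for the machine `M` with oracle `Q`. -/
def Program.Accepts {L : FirstOrder.Language.{u, v}} {R : Type w} [L.Structure R]
    (M : Program L) (B : Bipointed L R) (Q : Set (List R)) (x : List R) : Prop :=
  ∃ t, M.HaltsIn B Q x t [B.one]

/-- The word `(flag, x₁, 0, x₂, …, 0, xₙ)`, which is empty for `n = 0`. -/
def Bipointed.entry {L : FirstOrder.Language.{u, v}} {R : Type w} [L.Structure R] (B : Bipointed L R)
    (flag : R) : List R → List R
  | [] => []
  | x :: xs => flag :: x :: xs.flatMap fun y => [B.zero, y]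

/-- The string that represents the tuple `(v, w₁, …, wₖ)`: the string `v` itself for `k = 0`, and
`(0, v₁, …, 0, vₙ, 1, w₁₁, 0, w₁₂, …, 0, w₁ₘ, 1, w₂₁, 0, w₂₂, …)` for `k ≥ 1`, where each letter is
preceded by a flag that is `1` exactly at the first letters of the strings `wᵢ`. -/
def Bipointed.tuple {L : FirstOrder.Language.{u, v}} {R : Type w} [L.Structure R] (B : Bipointed L R)
    (v : List R) : List (List R) → List R
  | [] => v
  | w :: ws => B.entry B.zero v ++ (w :: ws).flatMap (B.entry B.one)

/-- The two quantifiers. -/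
inductive Quant
  | ex
  | all

/-- `(Q₁ w₁ ∈ R^m) (Q₂ w₂ ∈ R^m) … (Qₖ wₖ ∈ R^m) A (w₁, …, wₖ)` with alternating quantifiers,
where `Q₁` is given. -/
def Alternating {R : Type w} (m : ℕ) : Quant → ℕ → (List (List R) → Prop) → Prop
  | _, 0, A => A []
  | .ex, k + 1, A => ∃ w : List R, w.length = m ∧ Alternating m .all k fun ws => A (w :: ws)
  | .all, k + 1, A => ∀ w : List R, w.length = m → Alternating m .ex k fun ws => A (w :: ws)

/-- The decision problem `S` is defined by the machine `M` with oracle `Q`, with `k` alternating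
quantifiers, the first one being `q₁`, over witnesses whose length is the polynomial `p` in the
length of the input. -/
def Program.Defines {L : FirstOrder.Language.{u, v}} {R : Type w} [L.Structure R]
    (M : Program L) (B : Bipointed L R) (Q : Set (List R)) (q₁ : Quant) (k : ℕ)
    (p : Polynomial ℕ) (S : Set (List R)) : Prop :=
  ∀ x : List R,
    x ∈ S ↔ Alternating (p.eval x.length) q₁ k fun ws => M.Accepts B Q (B.tuple x ws)

/-- A level of the polynomial hierarchy over a structure: machines without oracle. (The oracle `∅`
is a dummy, since it is never queried.) -/
def Level {L : FirstOrder.Language.{u, v}} {R : Type w} [L.Structure R] (B : Bipointed L R)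
    (q₁ : Quant) (k : ℕ) : Set (Set (List R)) :=
  {S | ∃ (p : Polynomial ℕ) (M : Program L),
    M.QueryFree ∧ M.PolyTime B ∅ ∧ M.Defines B ∅ q₁ k p S}

/-- The same level relativized to a complexity class `D`: machines with an oracle from `D`. -/
def OracleLevel {L : FirstOrder.Language.{u, v}} {R : Type w} [L.Structure R] (B : Bipointed L R)
    (q₁ : Quant) (k : ℕ) (D : Set (Set (List R))) : Set (Set (List R)) :=
  {S | ∃ Q ∈ D, ∃ (p : Polynomial ℕ) (M : Program L),
    M.PolyTime B Q ∧ M.Defines B Q q₁ k p S}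

/-- The class `Σₖ R`. -/
def SigmaClass {L : FirstOrder.Language.{u, v}} {R : Type w} [L.Structure R] (B : Bipointed L R) (k : ℕ) :
    Set (Set (List R)) :=
  Level B .ex k

/-- The class `Πₖ R`. -/
def PiClass {L : FirstOrder.Language.{u, v}} {R : Type w} [L.Structure R] (B : Bipointed L R) (k : ℕ) :
    Set (Set (List R)) :=
  Level B .all k

/-- The class `NP(R)^D = (Σ₁ R)^D`. -/
def NPOracle {L : FirstOrder.Language.{u, v}} {R : Type w} [L.Structure R] (B : Bipointed L R)
    (D : Set (Set (List R))) : Set (Set (List R)) :=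
  OracleLevel B .ex 1 D

/-- The class `coNP(R)^D = (Π₁ R)^D`. -/
def CoNPOracle {L : FirstOrder.Language.{u, v}} {R : Type w} [L.Structure R] (B : Bipointed L R)
    (D : Set (Set (List R))) : Set (Set (List R)) :=
  OracleLevel B .all 1 D

end RMachine

/-! From the hierarchy to oracles (`level_subset_oracleLevel`): a problem in Σₖ₊₁ has the form ∃w
ψ(x,w) with ψ in Πₖ. The oracle machine asks a single question, whether the encoded pair (x,w) lies
in the Σₖ problem ¬ψ, and inverts the answer. For Πₖ₊₁ the remaining condition ψ is itself in Σₖ and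
the answer is kept. Two details of format need a machine of their own, given by `exists_inner`. A
query also reads the cell after the string, so that the question is the pair followed by 0. The
quantified strings in the oracle have a length that depends on the question and not on x, so that
only prefixes of them are used.

From oracles to the hierarchy (`oracleLevel_subset_level`): let M be a machine with an oracle Q in
Σₖ, and let N define Q. The first existential string contains the witness y of M, a guessed answer
for each of the T steps of M, and for each step a block for a first witness. A positive answer about
the question u is confirmed by ∃z₁∀z₂… N(u,z₁,…,zₖ), a negative one by ∀z₁∃z₂… ¬N(u,z₁,…,zₖ). In the
pattern ∃∀∃… with k + 1 quantifiers, positive answers use the first k strings and negative ones the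
last k. Each step owns a block in each string. The conjunction over the steps therefore commutes
with all the quantifiers (`Alternating.forall_iff`), which yields the equivalence
`alternating_guess_iff`. The deterministic matrix is computed by `exists_outer`. If a guess is
wrong, it rejects in the case of NP. For coNP the negation of the alternation is taken, and the
machine accepts if a guess is wrong.

Both inclusions require actual machines. These are written in a small language `Cmd` with several
tapes, named registers and bounded loops. Such programs are compiled to machine code (`Cmd.code`),
and they run in polynomial time if they are composed of phases whose loops are bounded by a register
that the phase does not write (`Cmd.Phased.reachIn`, `exists_program_of_phased`). The language is
strong enough to interpret an arbitrary fixed machine step by step (`Program.sim`). The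
constructions consist of decoding tuples, writing the input of a simulated machine and simulating a
polynomial number of its steps. -/

namespace RMachine

/-! ### Computations of a given length. -/

section Steps

variable {L : FirstOrder.Language.{u, v}} {R : Type w} [L.Structure R]

/-- `M` with oracle `Q` gets from the first to the second configuration in exactly `n` steps. -/
def Program.StepsTo (M : Program L) (Q : Set (List R)) : ℕ → Config R → Config R → Prop
  | 0, c, c' => c = c'
  | n + 1, c, c' => ∃ d, M.next Q c = some d ∧ M.StepsTo Q n d c'

/-- `M` with oracle `Q` gets from the first to the second configuration in at most `T` steps. -/
def Program.ReachIn (M : Program L) (Q : Set (List R)) (T : ℕ) (c c' : Config R) : Prop :=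
  ∃ t ≤ T, M.StepsTo Q t c c'

theorem Program.StepsTo.trans {M : Program L} {Q : Set (List R)} {m n : ℕ} {c d e : Config R}
    (h : M.StepsTo Q m c d) (h' : M.StepsTo Q n d e) : M.StepsTo Q (m + n) c e := by
  induction m generalizing c with
  | zero => cases h; simpa using h'
  | succ m ih =>
    obtain ⟨x, hx, h⟩ := h
    rw [Nat.add_right_comm]
    exact ⟨x, hx, ih h⟩

theorem Program.ReachIn.trans {M : Program L} {Q : Set (List R)} {m n : ℕ} {c d e : Config R}
    (h : M.ReachIn Q m c d) (h' : M.ReachIn Q n d e) : M.ReachIn Q (m + n) c e := by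
  obtain ⟨t, ht, h⟩ := h
  obtain ⟨t', ht', h'⟩ := h'
  exact ⟨t + t', by omega, h.trans h'⟩

theorem Program.ReachIn.mono {M : Program L} {Q : Set (List R)} {m n : ℕ} {c d : Config R}
    (h : M.ReachIn Q m c d) (hmn : m ≤ n) : M.ReachIn Q n c d := by
  obtain ⟨t, ht, h⟩ := h
  exact ⟨t, by omega, h⟩

theorem Program.ReachIn.refl (M : Program L) (Q : Set (List R)) (n : ℕ) (c : Config R) :
    M.ReachIn Q n c c := ⟨0, by omega, rfl⟩

theorem Program.reachIn_one {M : Program L} {Q : Set (List R)} {c : Config R} {i : Instr L}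
    (h : M[c.label]? = some i) : M.ReachIn Q 1 c (i.exec Q c) :=
  ⟨1, le_rfl, i.exec Q c, by simp [Program.next, h], rfl⟩

/-- `run` adds steps at the end and `StepsTo` adds them in front. The second direction needs an
induction of its own, which splits the last step off a computation. -/
theorem Program.run_eq_some_iff (M : Program L) (B : Bipointed L R) (Q : Set (List R))
    (x : List R) (t : ℕ) (c : Config R) :
    M.run B Q x t = some c ↔ M.StepsTo Q t (B.init x) c := by
  induction t generalizing c with
  | zero => simp [Program.run, Program.StepsTo]
  | succ t ih =>
    simp only [Program.run, Option.bind_eq_some_iff, ih]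
    constructor
    · rintro ⟨d, hd, h⟩
      exact hd.trans ⟨c, h, rfl⟩
    · clear ih
      generalize B.init x = e
      induction t generalizing e with
      | zero =>
        rintro ⟨d, hd, h⟩
        cases h
        exact ⟨e, rfl, hd⟩
      | succ t ih =>
        rintro ⟨d, hd, h⟩
        obtain ⟨d', h1, h2⟩ := ih d h
        exact ⟨d', ⟨d, hd, h1⟩, h2⟩

theorem Instr.exec_idx_le (Q : Set (List R)) (c : Config R) (i : Instr L) (r : ℕ) :
    (i.exec Q c).idx r ≤ c.idx r + 1 := by
  cases i <;> simp only [Instr.exec] <;> (try omega) <;>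
    simp only [Function.update_apply] <;> split_ifs with h <;> (try subst h) <;> omega

/-- Bounds on running times thus become bounds on the contents of registers, which is what allows
time bounds of consecutive phases to be composed. -/
theorem Program.StepsTo.idx_le {M : Program L} {Q : Set (List R)} {n : ℕ} {c d : Config R}
    (h : M.StepsTo Q n c d) (r : ℕ) : d.idx r ≤ c.idx r + n := by
  induction n generalizing c with
  | zero => cases h; simp
  | succ n ih =>
    obtain ⟨x, hx, h⟩ := h
    have h1 := ih h
    simp only [Program.next, Option.map_eq_some_iff] at hx
    obtain ⟨i, -, rfl⟩ := hx
    have := i.exec_idx_le Q c r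
    omega

end Steps

/-! ### Structured programs with bounded loops. -/

/-- The names of the index registers of structured programs. -/
abbrev Reg := ℕ × ℕ

/-- A state of a structured program with `K` tapes. -/
@[ext]
structure St (K : ℕ) (R : Type w) where
  idx : Reg → ℕ
  mem : Fin K × ℕ → R

/-- The elementary actions of structured programs. -/
inductive Act (L : FirstOrder.Language.{u, v}) (K : ℕ) : Type (max u v)
  | const (j : Fin K × ℕ) (c : L.Constants)
  | func (j₀ : Fin K × ℕ) {n : ℕ} (f : L.Functions (n + 1)) (j : Fin (n + 1) → Fin K × ℕ)
  | copy (a : Fin K) (r : Reg) (b : Fin K) (r' : Reg) (h : r ≠ r')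
  | inc (r : Reg)
  | dec (r : Reg)

/-- The tests of structured programs. -/
inductive Test (L : FirstOrder.Language.{u, v}) (K : ℕ) : Type (max u v)
  | eq (j j' : Fin K × ℕ)
  | rel {n : ℕ} (P : L.Relations (n + 1)) (j : Fin (n + 1) → Fin K × ℕ)
  | idxEq (r r' : Reg)

/-- Structured programs on `K` tapes. The loop `loop r b c` repeats `c` as often as the minimum of
the contents of `r` and `b` tells. -/
inductive Cmd (L : FirstOrder.Language.{u, v}) (K : ℕ) : Type (max u v)
  | act (a : Act L K)
  | skip
  | seq (c d : Cmd L K)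
  | ite (t : Test L K) (c d : Cmd L K)
  | loop (r b : Reg) (c : Cmd L K)

section Semantics

variable {L : FirstOrder.Language.{u, v}} {R : Type w} [L.Structure R] {K : ℕ}

/-- The effect of an action. -/
def Act.run (s : St K R) : Act L K → St K R
  | .const j c => ⟨s.idx, Function.update s.mem j (c : R)⟩
  | .func j₀ f j => ⟨s.idx, Function.update s.mem j₀ (FirstOrder.Language.Structure.funMap f fun i => s.mem (j i))⟩
  | .copy a r b r' _ => ⟨s.idx, Function.update s.mem (a, s.idx r) (s.mem (b, s.idx r'))⟩
  | .inc r => ⟨Function.update s.idx r (s.idx r + 1), s.mem⟩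
  | .dec r => ⟨Function.update s.idx r (s.idx r - 1), s.mem⟩

/-- The truth of a test. -/
def Test.Holds (s : St K R) : Test L K → Prop
  | .eq j j' => s.mem j = s.mem j'
  | .rel P j => FirstOrder.Language.Structure.RelMap P fun i => s.mem (j i)
  | .idxEq r r' => s.idx r = s.idx r'

open Classical in
/-- The effect of a structured program. -/
noncomputable def Cmd.eval : Cmd L K → St K R → St K R
  | .act a, s => a.run s
  | .skip, s => s
  | .seq c d, s => d.eval (c.eval s)
  | .ite t c d, s => if t.Holds s then c.eval s else d.eval s
  | .loop r b c, s => c.eval^[min (s.idx r) (s.idx b)] s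

/-- The action does not write the register `r`. -/
def Act.Keeps (r : Reg) : Act L K → Prop
  | .inc r' => r ≠ r'
  | .dec r' => r ≠ r'
  | _ => True

/-- The command does not write the register `r`. -/
def Cmd.Keeps (r : Reg) : Cmd L K → Prop
  | .act a => a.Keeps r
  | .skip => True
  | .seq c d => c.Keeps r ∧ d.Keeps r
  | .ite _ c d => c.Keeps r ∧ d.Keeps r
  | .loop _ _ c => c.Keeps r

theorem Cmd.eval_idx_of_keeps {r : Reg} {c : Cmd L K} (h : c.Keeps r) (s : St K R) :
    (c.eval s).idx r = s.idx r := by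
  induction c generalizing s with
  | act a =>
    cases a <;> simp_all [Cmd.Keeps, Act.Keeps, Cmd.eval, Act.run]
  | skip => rfl
  | seq c d ihc ihd => simp [Cmd.eval, ihd h.2, ihc h.1]
  | ite t c d ihc ihd =>
    simp only [Cmd.eval]
    split_ifs
    exacts [ihc h.1 s, ihd h.2 s]
  | loop r' b c ih =>
    simp only [Cmd.eval]
    generalize min (s.idx r') (s.idx b) = n
    induction n generalizing s with
    | zero => rfl
    | succ n ihn => rw [Function.iterate_succ_apply, ihn, ih h]

theorem Cmd.iterate_eval_idx_of_keeps {r : Reg} {c : Cmd L K} (h : c.Keeps r) (s : St K R)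
    (n : ℕ) : (c.eval^[n] s).idx r = s.idx r := by
  induction n generalizing s with
  | zero => rfl
  | succ n ih => rw [Function.iterate_succ_apply, ih, Cmd.eval_idx_of_keeps h]

/-- All loops of the command are bounded by the register `b`, which is not written, and no loop
changes the register that controls it. -/
def Cmd.LoopsOver (b : Reg) : Cmd L K → Prop
  | .act a => a.Keeps b
  | .skip => True
  | .seq c d => c.LoopsOver b ∧ d.LoopsOver b
  | .ite _ c d => c.LoopsOver b ∧ d.LoopsOver b
  -- The semantics reads `r` and `b` once, before the loop, whereas the machine code compares its
  -- counter with their current contents. Hence the body must leave both unchanged.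
  | .loop r b' c => b' = b ∧ c.LoopsOver b ∧ c.Keeps r

theorem Cmd.LoopsOver.keeps {b : Reg} {c : Cmd L K} (h : c.LoopsOver b) : c.Keeps b := by
  induction c with
  | act a => exact h
  | skip => trivial
  | seq c d ihc ihd => exact ⟨ihc h.1, ihd h.2⟩
  | ite t c d ihc ihd => exact ⟨ihc h.1, ihd h.2⟩
  | loop r b c ih => exact ih h.2.1

/-- A sequence of commands, the loops of each of which are bounded by a register that it does not
write. Such commands run in polynomial time. -/
inductive Cmd.Phased : Cmd L K → Prop
  | of {c : Cmd L K} (b : Reg) (h : c.LoopsOver b) : Phased c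
  | seq {c d : Cmd L K} (hc : Phased c) (hd : Phased d) : Phased (.seq c d)

end Semantics

/-! ### Compilation to machine code. -/

section Compile

variable {L : FirstOrder.Language.{u, v}} {K : ℕ}

/-- The machine register that holds `K` times the content of the register `r`. -/
def Reg.raw (r : Reg) : ℕ := 2 * Nat.pair r.1 r.2

/-- The machine register that holds the given cell. -/
def cellAddr (j : Fin K × ℕ) : ℕ := K * j.2 + j.1

/-- The machine code of an action. -/
def Act.code : Act L K → List (Instr L)
  | .const j c => [.const (cellAddr j) c]
  | .func j₀ f j => [.func (cellAddr j₀) f fun i => cellAddr (j i)]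
  -- The cells of the `K` tapes are interleaved and the registers are stored as multiples of `K`, so
  -- that adding `a` to a register makes it point to the tape `a`. Both offsets are in force at the
  -- same time, which is why the two registers have to be different.
  | .copy a r b r' _ =>
      List.replicate a (.inc r.raw) ++ (List.replicate b (.inc r'.raw) ++ (.copy r.raw r'.raw ::
        (List.replicate b (.dec r'.raw) ++ List.replicate a (.dec r.raw))))
  | .inc r => List.replicate K (.inc r.raw)
  | .dec r => List.replicate K (.dec r.raw)

/-- The machine code of a test, with its two targets. -/
def Test.code (l₁ l₂ : ℕ) : Test L K → Instr L
  | .eq j j' => .ifEq (cellAddr j) (cellAddr j') l₁ l₂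
  | .rel P j => .ifRel P (fun i => cellAddr (j i)) l₁ l₂
  | .idxEq r r' => .ifIdxEq r.raw r'.raw l₁ l₂

/-- The number of machine instructions of the command. -/
def Cmd.size : Cmd L K → ℕ
  | .act a => a.code.length
  | .skip => 0
  | .seq c d => c.size + d.size
  | .ite _ c d => c.size + d.size + 2
  | .loop _ _ c => c.size + K + 6

/-- The machine code of the command, placed at the address `a`, with the loop counters from number
`j` on at its disposal. -/
def Cmd.code : Cmd L K → ℕ → ℕ → List (Instr L)
  | .act x, _, _ => x.code
  | .skip, _, _ => []
  | .seq c d, a, j => c.code a j ++ d.code (a + c.size) j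
  | .ite t c d, a, j =>
      t.code (a + 1) (a + 1 + c.size + 1) :: (c.code (a + 1) j ++
        (.ifIdxEq 0 0 (a + 1 + c.size + 1 + d.size) (a + 1 + c.size + 1 + d.size) ::
          d.code (a + 1 + c.size + 1) j))
  -- The layout is: two exit tests, the body, `K` increments of the loop counter, a jump back, and
  -- finally a countdown of the counter to zero. The counter runs through multiples of `K` to be
  -- comparable with stored registers. The next counter is zero outside the body and supplies the
  -- zero for the countdown.
  | .loop r b c, a, j =>
      .ifIdxEq (2 * j + 1) r.raw (a + 2 + c.size + K + 1) (a + 1) ::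
      .ifIdxEq (2 * j + 1) b.raw (a + 2 + c.size + K + 1) (a + 2) ::
      (c.code (a + 2) (j + 1) ++ (List.replicate K (.inc (2 * j + 1)) ++
        [.ifIdxEq 0 0 a a,
         .ifIdxEq (2 * j + 1) (2 * (j + 1) + 1) (a + c.size + K + 6) (a + 2 + c.size + K + 2),
         .dec (2 * j + 1),
         .ifIdxEq 0 0 (a + 2 + c.size + K + 1) (a + 2 + c.size + K + 1)]))

theorem Cmd.length_code (c : Cmd L K) (a j : ℕ) : (c.code a j).length = c.size := by
  induction c generalizing a j with
  | act x => rfl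
  | skip => rfl
  | seq c d ihc ihd => simp [Cmd.code, Cmd.size, ihc, ihd]
  | ite t c d ihc ihd => simp [Cmd.code, Cmd.size, ihc, ihd]; omega
  | loop r b c ih => simp [Cmd.code, Cmd.size, ih]; omega

theorem Cmd.not_query_mem_code (c : Cmd L K) (a j l₁ l₂ : ℕ) :
    Instr.query l₁ l₂ ∉ c.code a j := by
  induction c generalizing a j with
  | act x => cases x <;> simp [Cmd.code, Act.code, List.mem_replicate]
  | skip => simp [Cmd.code]
  | seq c d ihc ihd => simp [Cmd.code, ihc, ihd]
  | ite t c d ihc ihd => cases t <;> simp [Cmd.code, Test.code, ihc, ihd]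
  | loop r b c ih => simp [Cmd.code, ih, List.mem_replicate]

theorem Reg.raw_injective : Function.Injective Reg.raw := by
  rintro ⟨a, b⟩ ⟨c, d⟩ h
  simp only [Reg.raw] at h
  have : Nat.pair a b = Nat.pair c d := by omega
  simpa [Nat.pair_eq_pair] using this

/-- A condition `l <+: M.drop a` expresses that the code `l` is placed in `M` at the address `a`.
Concatenated code is taken apart here. -/
theorem prefix_drop_append {α : Type*} {l l' m : List α} {a : ℕ} (h : l ++ l' <+: m.drop a) :
    l <+: m.drop a ∧ l' <+: m.drop (a + l.length) := by
  obtain ⟨t, ht⟩ := h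
  refine ⟨⟨l' ++ t, by rw [← ht]; simp⟩, ⟨t, ?_⟩⟩
  rw [← List.drop_drop, ← ht]
  simp

theorem prefix_drop_cons {α : Type*} {x : α} {l' m : List α} {a : ℕ} (h : x :: l' <+: m.drop a) :
    m[a]? = some x ∧ l' <+: m.drop (a + 1) := by
  have := prefix_drop_append (l := [x]) (l' := l') h
  refine ⟨?_, by simpa using this.2⟩
  obtain ⟨t, ht⟩ := this.1
  have : (m.drop a)[0]? = some x := by rw [← ht]; rfl
  simpa using this

end Compile

/-! ### Correctness and running time of the compiled code. -/

section Correctness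

variable {L : FirstOrder.Language.{u, v}} {R : Type w} [L.Structure R] {K : ℕ} [NeZero K]

/-- The machine configuration that represents a state, with given contents of the loop counters. -/
def conf (a : ℕ) (s : St K R) (σ : ℕ → ℕ) : Config R where
  label := a
  idx := fun n => if n % 2 = 0 then K * s.idx (Nat.unpair (n / 2)) else σ (n / 2)
  mem := fun m => s.mem (Fin.ofNat K m, m / K)

@[simp]
theorem conf_label (a : ℕ) (s : St K R) (σ : ℕ → ℕ) : (conf a s σ).label = a := rfl

@[simp]
theorem conf_idx_raw (a : ℕ) (s : St K R) (σ : ℕ → ℕ) (r : Reg) :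
    (conf a s σ).idx r.raw = K * s.idx r := by
  simp [conf, Reg.raw]

@[simp]
theorem conf_idx_odd (a : ℕ) (s : St K R) (σ : ℕ → ℕ) (j : ℕ) :
    (conf a s σ).idx (2 * j + 1) = σ j := by
  have h1 : (2 * j + 1) % 2 = 1 := by omega
  have h2 : (2 * j + 1) / 2 = j := by omega
  simp [conf, h1, h2]

theorem eq_cellAddr_iff (m : ℕ) (j : Fin K × ℕ) :
    m = cellAddr j ↔ (Fin.ofNat K m, m / K) = j := by
  obtain ⟨a, i⟩ := j
  have hK : 0 < K := Nat.pos_of_ne_zero (NeZero.ne K)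
  simp only [cellAddr, Prod.mk.injEq, Fin.ext_iff, Fin.val_ofNat]
  constructor
  · rintro rfl
    rw [Nat.mul_add_mod, Nat.mod_eq_of_lt a.2, Nat.mul_add_div hK, Nat.div_eq_of_lt a.2]
    simp
  · rintro ⟨h1, rfl⟩
    rw [← h1, Nat.div_add_mod]

@[simp]
theorem conf_mem_cellAddr (a : ℕ) (s : St K R) (σ : ℕ → ℕ) (j : Fin K × ℕ) :
    (conf a s σ).mem (cellAddr j) = s.mem j := by
  change s.mem _ = s.mem _
  rw [(eq_cellAddr_iff (cellAddr j) j).1 rfl]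

theorem conf_mem_update (a : ℕ) (s : St K R) (σ : ℕ → ℕ) (j : Fin K × ℕ) (y : R) :
    Function.update (conf a s σ).mem (cellAddr j) y =
      (conf a ⟨s.idx, Function.update s.mem j y⟩ σ).mem := by
  funext m
  simp only [Function.update_apply, eq_cellAddr_iff, conf]

theorem conf_idx_update (a : ℕ) (s : St K R) (σ : ℕ → ℕ) (r : Reg) (y : ℕ) :
    Function.update (conf a s σ).idx r.raw (K * y) =
      (conf a ⟨Function.update s.idx r y, s.mem⟩ σ).idx := by
  funext m
  simp only [Function.update_apply, conf]
  by_cases h : m % 2 = 0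
  · have : m = r.raw ↔ Nat.unpair (m / 2) = r := by
      constructor
      · rintro rfl; simp [Reg.raw]
      · rintro rfl; simp [Reg.raw]; omega
    simp only [this, h, if_true]
    split_ifs <;> rfl
  · have : m ≠ r.raw := by rintro rfl; simp [Reg.raw] at h
    simp [this, h]

theorem conf_idx_update_odd (a : ℕ) (s : St K R) (σ : ℕ → ℕ) (j : ℕ) (y : ℕ) :
    Function.update (conf a s σ).idx (2 * j + 1) y = (conf a s (Function.update σ j y)).idx := by
  funext m
  simp only [Function.update_apply, conf]
  by_cases h : m % 2 = 0
  · have : m ≠ 2 * j + 1 := by omega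
    simp [h, this]
  · have : m = 2 * j + 1 ↔ m / 2 = j := by omega
    simp [this, h]

/-- An instruction that does not jump. -/
def Instr.Straight : Instr L → Prop
  | .const .. => True
  | .func .. => True
  | .copy .. => True
  | .inc _ => True
  | .dec _ => True
  | _ => False

theorem Instr.Straight.label {i : Instr L} (h : i.Straight) (Q : Set (List R)) (c : Config R) :
    (i.exec Q c).label = c.label + 1 := by
  cases i <;> first | rfl | exact h.elim

/-- The effect of executing a list of instructions one after the other, whatever the labels. -/
noncomputable def execList (Q : Set (List R)) : List (Instr L) → Config R → Config R
  | [], c => c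
  | i :: l, c => execList Q l (i.exec Q c)

theorem execList_append (Q : Set (List R)) (l l' : List (Instr L)) (c : Config R) :
    execList Q (l ++ l') c = execList Q l' (execList Q l c) := by
  induction l generalizing c with
  | nil => rfl
  | cons i l ih => exact ih _

theorem reachIn_straight {M : Program L} {Q : Set (List R)} {l : List (Instr L)}
    (hl : ∀ i ∈ l, i.Straight) {c : Config R} (h : l <+: M.drop c.label) :
    M.ReachIn Q l.length c (execList Q l c) := by
  induction l generalizing c with
  | nil => exact .refl _ _ _ _
  | cons i l ih =>
    obtain ⟨h1, h2⟩ := prefix_drop_cons h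
    have hi := hl i (by simp)
    rw [List.length_cons, Nat.add_comm]
    refine (Program.reachIn_one h1).trans (ih (fun i hi => hl i (by simp [hi])) ?_)
    rwa [hi.label]

theorem execList_inc (Q : Set (List R)) (n r : ℕ) (c : Config R) :
    execList Q (List.replicate n (Instr.inc r : Instr L)) c =
      ⟨c.label + n, Function.update c.idx r (c.idx r + n), c.mem⟩ := by
  induction n generalizing c with
  | zero => simp [execList]
  | succ n ih =>
    simp only [List.replicate_succ, execList, ih, Instr.exec, Function.update_self,
      Function.update_idem]
    rw [Nat.add_assoc, Nat.add_comm 1, Nat.add_assoc, Nat.add_comm 1]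

theorem execList_dec (Q : Set (List R)) (n r : ℕ) (c : Config R) :
    execList Q (List.replicate n (Instr.dec r : Instr L)) c =
      ⟨c.label + n, Function.update c.idx r (c.idx r - n), c.mem⟩ := by
  induction n generalizing c with
  | zero => simp [execList]
  | succ n ih =>
    simp only [List.replicate_succ, execList, ih, Instr.exec, Function.update_self,
      Function.update_idem]
    rw [Nat.add_assoc, Nat.add_comm 1, Nat.sub_sub, Nat.add_comm 1]

theorem Act.straight_code (x : Act L K) : ∀ i ∈ x.code, i.Straight := by
  cases x <;> simp [Act.code, List.mem_replicate, Instr.Straight]; grind [Instr.Straight]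

theorem Config.mk_congr {a a' : ℕ} {i i' : ℕ → ℕ} {m m' : ℕ → R} (h : a = a') (h' : i = i')
    (h'' : m = m') : (⟨a, i, m⟩ : Config R) = ⟨a', i', m'⟩ := by subst h h' h''; rfl

theorem Act.execList_code (Q : Set (List R)) (x : Act L K) (a : ℕ) (s : St K R) (σ : ℕ → ℕ) :
    execList Q x.code (conf a s σ) = conf (a + x.code.length) (x.run s) σ := by
  cases x with
  | const j c =>
    simp only [Act.code, execList, Instr.exec, conf_mem_update]
    rfl
  | func j₀ f j =>
    simp only [Act.code, execList, Instr.exec, conf_mem_update, conf_mem_cellAddr]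
    rfl
  | inc r =>
    simp only [Act.code, execList_inc, conf_idx_raw]
    rw [show K * s.idx r + K = K * (s.idx r + 1) by ring, conf_idx_update]
    simp [Act.run, conf]
  | dec r =>
    simp only [Act.code, execList_dec, conf_idx_raw]
    rw [show K * s.idx r - K = K * (s.idx r - 1) by rw [Nat.mul_sub_one], conf_idx_update]
    simp [Act.run, conf]
  | copy p r q r' h =>
    have hr : r.raw ≠ r'.raw := fun e => h (Reg.raw_injective e)
    simp only [Act.code, execList_append, execList, execList_inc, execList_dec, Instr.exec,
      conf_idx_raw, Act.run, ne_eq, hr, hr.symm, not_false_eq_true, Function.update_of_ne,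
      Function.update_self]
    refine Config.mk_congr ?_ ?_ ?_
    · simp only [List.length_append, List.length_cons, List.length_replicate, conf_label]
      omega
    · funext m
      simp only [Function.update_apply]
      have e1 := conf_idx_raw a s σ r
      have e2 := conf_idx_raw a s σ r'
      change _ = (conf a s σ).idx m
      split_ifs <;> simp_all
    · change _ = (conf a ⟨s.idx, Function.update s.mem (p, s.idx r) (s.mem (q, s.idx r'))⟩ σ).mem
      rw [← conf_mem_update, ← conf_mem_cellAddr a s σ (q, s.idx r')]
      rfl

theorem exec_goto (Q : Set (List R)) (c : Config R) (l : ℕ) :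
    (Instr.ifIdxEq 0 0 l l : Instr L).exec Q c = ⟨l, c.idx, c.mem⟩ := by
  simp [Instr.exec]

open Classical in
theorem Test.exec_code (Q : Set (List R)) (t : Test L K) (a l₁ l₂ : ℕ) (s : St K R) (σ : ℕ → ℕ) :
    (t.code l₁ l₂).exec Q (conf a s σ) = conf (if t.Holds s then l₁ else l₂) s σ := by
  have hK : 0 < K := Nat.pos_of_ne_zero (NeZero.ne K)
  cases t <;> simp only [Test.code, Instr.exec, conf_mem_cellAddr, conf_idx_raw, Test.Holds]
  · rfl
  · rfl
  · simp only [Nat.mul_right_inj hK.ne', conf]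
    congr

/-- The countdown of a loop counter: three steps for each unit, and one step for the successful
comparison with the next counter. -/
theorem reachIn_reset {M : Program L} {Q : Set (List R)} {e j : ℕ} {s : St K R} {σ : ℕ → ℕ}
    (hσ : σ (j + 1) = 0) (l : ℕ)
    (h : [.ifIdxEq (2 * j + 1) (2 * (j + 1) + 1) l (e + 1), .dec (2 * j + 1),
      .ifIdxEq 0 0 e e] <+: M.drop e) (n : ℕ) :
    M.ReachIn Q (3 * n + 1) (conf e s (Function.update σ j n))
      (conf l s (Function.update σ j 0)) := by
  obtain ⟨h1, h⟩ := prefix_drop_cons h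
  obtain ⟨h2, h⟩ := prefix_drop_cons h
  obtain ⟨h3, -⟩ := prefix_drop_cons h
  have hne : j + 1 ≠ j := by omega
  induction n with
  | zero =>
    have := Program.reachIn_one (Q := Q) (c := conf e s (Function.update σ j 0)) h1
    simp only [Instr.exec, conf_idx_odd, Function.update_self, Function.update_of_ne hne, hσ,
      if_true] at this
    exact this
  | succ n ih =>
    have s1 := Program.reachIn_one (Q := Q) (c := conf e s (Function.update σ j (n + 1))) h1
    simp only [Instr.exec, conf_idx_odd, Function.update_self, Function.update_of_ne hne, hσ,
      Nat.add_eq_zero_iff, one_ne_zero, and_false, if_false] at s1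
    have s2 := Program.reachIn_one (Q := Q) (c := conf (e + 1) s (Function.update σ j (n + 1))) h2
    simp only [Instr.exec, conf_idx_odd, conf_idx_update_odd, Function.update_self,
      Nat.add_sub_cancel, Function.update_idem] at s2
    have s3 := Program.reachIn_one (Q := Q) (c := conf (e + 1 + 1) s (Function.update σ j n)) h3
    rw [exec_goto] at s3
    exact (((s1.trans s2).trans s3).trans ih).mono (by omega)

/-- As the bounding register `b` never changes, the running time is a polynomial in its content, and
a nested loop multiplies the polynomial of its body. The polynomial does not depend on the
surrounding program, the address or the state. The counters from `j` on are zero before and after,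
so loops that do not enclose one another may share them. -/
theorem Cmd.reachIn_of_loopsOver {b : Reg} {c : Cmd L K} (hc : c.LoopsOver b) :
    ∃ p : Polynomial ℕ, ∀ (M : Program L) (Q : Set (List R)) (a j : ℕ) (s : St K R) (σ : ℕ → ℕ),
      (∀ i ≥ j, σ i = 0) → c.code a j <+: M.drop a →
      M.ReachIn Q (p.eval (s.idx b)) (conf a s σ) (conf (a + c.size) (c.eval s) σ) := by
  induction c with
  | act x =>
    refine ⟨.C x.code.length, fun M Q a j s σ _ h => ?_⟩
    have := reachIn_straight (Q := Q) x.straight_code (c := conf a s σ) h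
    rw [x.execList_code] at this
    simpa [Cmd.size, Cmd.eval] using this
  | skip => exact ⟨0, fun M Q a j s σ _ h => .refl _ _ _ _⟩
  | seq c d ihc ihd =>
    obtain ⟨p, hp⟩ := ihc hc.1
    obtain ⟨q, hq⟩ := ihd hc.2
    refine ⟨p + q, fun M Q a j s σ hσ h => ?_⟩
    obtain ⟨h1, h2⟩ := prefix_drop_append h
    rw [Cmd.length_code] at h2
    have := hq M Q _ j (c.eval s) σ hσ h2
    rw [Cmd.eval_idx_of_keeps hc.1.keeps, Nat.add_assoc] at this
    rw [Polynomial.eval_add]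
    exact (hp M Q a j s σ hσ h1).trans this
  | ite t c d ihc ihd =>
    obtain ⟨p, hp⟩ := ihc hc.1
    obtain ⟨q, hq⟩ := ihd hc.2
    refine ⟨p + q + 2, fun M Q a j s σ hσ h => ?_⟩
    obtain ⟨h1, h⟩ := prefix_drop_cons h
    obtain ⟨h2, h⟩ := prefix_drop_append h
    rw [Cmd.length_code] at h
    obtain ⟨h3, h4⟩ := prefix_drop_cons h
    have e := Program.reachIn_one (Q := Q) (c := conf a s σ) h1
    rw [Test.exec_code] at e
    simp only [Cmd.eval, Polynomial.eval_add, Polynomial.eval_ofNat]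
    split_ifs at e ⊢ with ht
    · have e3 := Program.reachIn_one (Q := Q) (c := conf (a + 1 + c.size) (c.eval s) σ) h3
      rw [exec_goto] at e3
      rw [show a + (Cmd.ite t c d).size = a + 1 + c.size + 1 + d.size by
        simp only [Cmd.size]; omega]
      exact ((e.trans (hp M Q _ j s σ hσ h2)).trans e3).mono (by omega)
    · rw [show a + (Cmd.ite t c d).size = a + 1 + c.size + 1 + d.size by
        simp only [Cmd.size]; omega]
      exact (e.trans (hq M Q _ j s σ hσ h4)).mono (by omega)
  | loop r b' c ih =>
    obtain ⟨rfl, hc, hr⟩ := hc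
    obtain ⟨p, hp⟩ := ih hc
    -- A round costs the body, `K` increments and three jumps or tests. The countdown from `K * N`
    -- takes `3 * K * N + 1` steps, and leaving the loop takes at most two.
    refine ⟨.X * (p + .C (K + 3)) + .X * .C (3 * K) + 3, fun M Q a j s σ hσ h => ?_⟩
    have hK : 0 < K := Nat.pos_of_ne_zero (NeZero.ne K)
    obtain ⟨h1, h⟩ := prefix_drop_cons h
    obtain ⟨h2, h⟩ := prefix_drop_cons h
    obtain ⟨h3, h⟩ := prefix_drop_append h
    rw [Cmd.length_code] at h
    obtain ⟨h4, h⟩ := prefix_drop_append h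
    rw [List.length_replicate] at h
    obtain ⟨h5, h6⟩ := prefix_drop_cons h
    set N := min (s.idx r) (s.idx b') with hN
    set e := a + 2 + c.size + K + 1 with he
    have hcond : ∀ n ≤ N, n ≠ N → n < s.idx r ∧ n < s.idx b' := by omega
    have body : ∀ n < N, M.ReachIn Q (p.eval (s.idx b') + K + 3)
        (conf a (c.eval^[n] s) (Function.update σ j (K * n)))
        (conf a (c.eval^[n + 1] s) (Function.update σ j (K * (n + 1)))) := by
      intro n hn
      have i1 : (c.eval^[n] s).idx r = s.idx r := Cmd.iterate_eval_idx_of_keeps hr s n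
      have i2 : (c.eval^[n] s).idx b' = s.idx b' := Cmd.iterate_eval_idx_of_keeps hc.keeps s n
      have n1 : ¬ n = s.idx r := by omega
      have n2 : ¬ n = s.idx b' := by omega
      have s1 := Program.reachIn_one (Q := Q)
        (c := conf a (c.eval^[n] s) (Function.update σ j (K * n))) h1
      simp only [Instr.exec, conf_idx_odd, conf_idx_raw, Function.update_self, i1,
        Nat.mul_right_inj hK.ne', n1, if_false] at s1
      have s2 := Program.reachIn_one (Q := Q)
        (c := conf (a + 1) (c.eval^[n] s) (Function.update σ j (K * n))) h2
      simp only [Instr.exec, conf_idx_odd, conf_idx_raw, Function.update_self, i2,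
        Nat.mul_right_inj hK.ne', n2, if_false] at s2
      have s3 := hp M Q (a + 2) (j + 1) (c.eval^[n] s) (Function.update σ j (K * n)) (by
        intro i hi
        rw [Function.update_of_ne (by omega)]
        exact hσ i (by omega)) h3
      rw [i2, ← Function.iterate_succ_apply' c.eval] at s3
      have s4 := reachIn_straight (Q := Q)
        (c := conf (a + 2 + c.size) (c.eval^[n + 1] s) (Function.update σ j (K * n)))
        (by simp [List.mem_replicate, Instr.Straight]) h4
      rw [execList_inc, List.length_replicate] at s4
      simp only [conf_idx_odd, conf_idx_update_odd, Function.update_self, Function.update_idem]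
        at s4
      have s5 := Program.reachIn_one (Q := Q) (c := conf (a + 2 + c.size + K) (c.eval^[n + 1] s)
        (Function.update σ j (K * (n + 1)))) h5
      rw [exec_goto] at s5
      exact ((((s1.trans s2).trans s3).trans s4).trans s5).mono (by omega)
    have loops : ∀ n ≤ N, M.ReachIn Q (n * (p.eval (s.idx b') + K + 3))
        (conf a s σ) (conf a (c.eval^[n] s) (Function.update σ j (K * n))) := by
      intro n
      induction n with
      | zero =>
        intro _
        rw [Nat.mul_zero, Function.update_eq_self_iff.2 (hσ j le_rfl).symm]
        exact .refl _ _ _ _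
      | succ n ihn =>
        intro hn
        refine ((ihn (by omega)).trans (body n (by omega))).mono ?_
        rw [Nat.add_one_mul]
    have i1 : (c.eval^[N] s).idx r = s.idx r := Cmd.iterate_eval_idx_of_keeps hr s N
    have i2 : (c.eval^[N] s).idx b' = s.idx b' := Cmd.iterate_eval_idx_of_keeps hc.keeps s N
    have exit : M.ReachIn Q 2 (conf a (c.eval^[N] s) (Function.update σ j (K * N)))
        (conf e (c.eval^[N] s) (Function.update σ j (K * N))) := by
      have s1 := Program.reachIn_one (Q := Q)
        (c := conf a (c.eval^[N] s) (Function.update σ j (K * N))) h1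
      simp only [Instr.exec, conf_idx_odd, conf_idx_raw, Function.update_self, i1,
        Nat.mul_right_inj hK.ne'] at s1
      by_cases hNr : N = s.idx r
      · rw [if_pos hNr] at s1
        exact s1.mono (by omega)
      · rw [if_neg hNr] at s1
        have s2 := Program.reachIn_one (Q := Q)
          (c := conf (a + 1) (c.eval^[N] s) (Function.update σ j (K * N))) h2
        simp only [Instr.exec, conf_idx_odd, conf_idx_raw, Function.update_self, i2,
          Nat.mul_right_inj hK.ne'] at s2
        rw [if_pos (show N = s.idx b' by omega)] at s2
        exact s1.trans s2
    have reset := reachIn_reset (Q := Q) (s := c.eval^[N] s) (σ := σ) (hσ (j + 1) (by omega))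
      _ h6 (K * N)
    rw [(Function.update_eq_self_iff.2 (hσ j le_rfl).symm : Function.update σ j 0 = σ)] at reset
    have all := ((loops N le_rfl).trans exit).trans reset
    have hle : N ≤ s.idx b' := min_le_right _ _
    simp only [Cmd.eval, Cmd.size]
    rw [show a + (c.size + K + 6) = a + c.size + K + 6 by omega]
    refine all.mono ?_
    simp only [Polynomial.eval_add, Polynomial.eval_mul, Polynomial.eval_X, Polynomial.eval_C,
      Polynomial.eval_ofNat]
    have a1 := Nat.mul_le_mul_right (p.eval (s.idx b') + K + 3) hle
    have a2 := Nat.mul_le_mul_right (3 * K) hle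
    have a3 : 3 * (K * N) = N * (3 * K) := by ring
    have a4 : p.eval (s.idx b') + (K + 3) = p.eval (s.idx b') + K + 3 := by ring
    rw [a4]
    omega

theorem polynomial_eval_mono (p : Polynomial ℕ) : Monotone fun n : ℕ => p.eval n := by
  intro m n h
  simp only [Polynomial.eval_eq_sum, Polynomial.sum]
  gcongr

/-- A phase may compute the register that bounds the loops of the next one. After a phase of `p n`
steps all registers are at most `n + p n`, which is the argument of the polynomial for the next
phase. -/
theorem Cmd.Phased.reachIn {c : Cmd L K} (hc : c.Phased) :
    ∃ p : Polynomial ℕ, ∀ (M : Program L) (Q : Set (List R)) (a : ℕ) (s : St K R) (n : ℕ),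
      (∀ r, s.idx r ≤ n) → c.code a 0 <+: M.drop a →
      M.ReachIn Q (p.eval n) (conf a s 0) (conf (a + c.size) (c.eval s) 0) ∧
        ∀ r, (c.eval s).idx r ≤ n + p.eval n := by
  have key : ∀ (c : Cmd L K) (M : Program L) (Q : Set (List R)) (a : ℕ) (s : St K R) (n t : ℕ),
      (∀ r, s.idx r ≤ n) →
      M.ReachIn Q t (conf a s 0) (conf (a + c.size) (c.eval s) 0) →
      ∀ r, (c.eval s).idx r ≤ n + t := by
    rintro c M Q a s n t hs ⟨t', ht, h⟩ r
    have := h.idx_le r.raw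
    simp only [conf_idx_raw] at this
    have hK : 1 ≤ K := Nat.pos_of_ne_zero (NeZero.ne K)
    have h1 : t' ≤ K * t' := Nat.le_mul_of_pos_left _ hK
    have h2 : K * (c.eval s).idx r ≤ K * (s.idx r + t') := by rw [Nat.mul_add]; omega
    have := Nat.le_of_mul_le_mul_left h2 hK
    have := hs r
    omega
  induction hc with
  | of b h =>
    obtain ⟨p, hp⟩ := Cmd.reachIn_of_loopsOver (R := R) h
    refine ⟨p, fun M Q a s n hs hM => ?_⟩
    have := (hp M Q a 0 s 0 (by simp) hM).mono (polynomial_eval_mono p (hs b))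
    exact ⟨this, key _ M Q a s n _ hs this⟩
  | @seq c d _ _ ihc ihd =>
    obtain ⟨p, hp⟩ := ihc
    obtain ⟨q, hq⟩ := ihd
    refine ⟨p + q.comp (.X + p), fun M Q a s n hs hM => ?_⟩
    obtain ⟨h1, h2⟩ := prefix_drop_append hM
    rw [Cmd.length_code] at h2
    obtain ⟨r1, b1⟩ := hp M Q a s n hs h1
    obtain ⟨r2, b2⟩ := hq M Q _ _ _ b1 h2
    simp only [Polynomial.eval_add, Polynomial.eval_comp, Polynomial.eval_X]
    refine ⟨?_, fun r => (b2 r).trans (by omega)⟩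
    have := r1.trans r2
    rwa [Nat.add_assoc a] at this

end Correctness

/-! ### Halting configurations and acceptance. -/

section Halting

variable {L : FirstOrder.Language.{u, v}} {R : Type w} [L.Structure R]

theorem Program.next_eq_none {M : Program L} {Q : Set (List R)} {c : Config R}
    (h : c.label = M.length) : M.next Q c = none := by
  simp [Program.next, h]

theorem Program.StepsTo.halt_unique {M : Program L} {Q : Set (List R)} {m n : ℕ}
    {c d e : Config R} (h : M.StepsTo Q m c d) (h' : M.StepsTo Q n c e)
    (hd : d.label = M.length) (he : e.label = M.length) : d = e := by
  induction m generalizing c n with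
  | zero =>
    cases h
    cases n with
    | zero => exact h'
    | succ n =>
      obtain ⟨x, hx, -⟩ := h'
      simp [Program.next_eq_none hd] at hx
  | succ m ih =>
    obtain ⟨x, hx, h⟩ := h
    cases n with
    | zero =>
      cases h'
      simp [Program.next_eq_none he] at hx
    | succ n =>
      obtain ⟨y, hy, h'⟩ := h'
      obtain rfl : x = y := by simpa [hx] using hy
      exact ih h h'

theorem Config.string_eq_singleton {c : Config R} {m : ℕ} {y : R} :
    c.string m = [y] ↔ m = 1 ∧ c.mem 0 = y := by
  constructor
  · intro h
    have := congrArg List.length h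
    simp only [Config.string, List.length_map, List.length_range, List.length_singleton] at this
    subst this
    simpa [Config.string] using h
  · rintro ⟨rfl, rfl⟩
    simp [Config.string]

theorem Program.accepts_iff_of_stepsTo {M : Program L} {B : Bipointed L R} {Q : Set (List R)}
    {x : List R} {t : ℕ} {c : Config R} (h : M.StepsTo Q t (B.init x) c)
    (hc : c.label = M.length) : M.Accepts B Q x ↔ c.idx 0 = 1 ∧ c.mem 0 = B.one := by
  rw [← Config.string_eq_singleton]
  constructor
  · rintro ⟨t', d, hd, hl, hs⟩
    rw [Program.run_eq_some_iff] at hd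
    obtain rfl := hd.halt_unique h hl hc
    exact hs
  · intro hs
    exact ⟨t, c, (Program.run_eq_some_iff ..).2 h, hc, hs⟩

end Halting

/-! ### Sequences and repetitions of commands. -/

section Combinators

variable {L : FirstOrder.Language.{u, v}} {R : Type w} [L.Structure R] {K : ℕ}

/-- The commands of a list, one after the other. -/
def Cmd.seqs : List (Cmd L K) → Cmd L K
  | [] => .skip
  | c :: l => .seq c (.seqs l)

/-- `I[r] := I[r] + 1` -/
abbrev Cmd.inc (r : Reg) : Cmd L K := .act (.inc r)

/-- `I[r] := I[r] ∸ 1` -/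
abbrev Cmd.dec (r : Reg) : Cmd L K := .act (.dec r)

/-- The command `c`, repeated `n` times. -/
def Cmd.rep (n : ℕ) (c : Cmd L K) : Cmd L K := Cmd.seqs (List.replicate n c)

theorem Cmd.eval_act (a : Act L K) (s : St K R) : (Cmd.act a).eval s = a.run s := rfl

theorem Cmd.eval_skip (s : St K R) : (Cmd.skip : Cmd L K).eval s = s := rfl

theorem Cmd.eval_seq (c d : Cmd L K) (s : St K R) : (Cmd.seq c d).eval s = d.eval (c.eval s) := rfl

theorem Cmd.eval_seqs_nil (s : St K R) : (Cmd.seqs [] : Cmd L K).eval s = s := rfl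

theorem Cmd.eval_seqs_cons (c : Cmd L K) (l : List (Cmd L K)) (s : St K R) :
    (Cmd.seqs (c :: l)).eval s = (Cmd.seqs l).eval (c.eval s) := rfl

theorem Cmd.eval_loop (r b : Reg) (c : Cmd L K) (s : St K R) :
    (Cmd.loop r b c).eval s = c.eval^[min (s.idx r) (s.idx b)] s := rfl

open Classical in
theorem Cmd.eval_ite (t : Test L K) (c d : Cmd L K) (s : St K R) :
    (Cmd.ite t c d).eval s = if t.Holds s then c.eval s else d.eval s := rfl

theorem Cmd.eval_rep (n : ℕ) (c : Cmd L K) (s : St K R) :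
    (Cmd.rep n c).eval s = c.eval^[n] s := by
  induction n generalizing s with
  | zero => rfl
  | succ n ih =>
    rw [Function.iterate_succ_apply, ← ih]
    rfl

theorem Cmd.keeps_seqs {r : Reg} {l : List (Cmd L K)} :
    (Cmd.seqs l).Keeps r ↔ ∀ c ∈ l, c.Keeps r := by
  induction l with
  | nil => simp [Cmd.seqs, Cmd.Keeps]
  | cons c l ih => simp [Cmd.seqs, Cmd.Keeps, ih]

theorem Cmd.loopsOver_seqs {r : Reg} {l : List (Cmd L K)} :
    (Cmd.seqs l).LoopsOver r ↔ ∀ c ∈ l, c.LoopsOver r := by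
  induction l with
  | nil => simp [Cmd.seqs, Cmd.LoopsOver]
  | cons c l ih => simp [Cmd.seqs, Cmd.LoopsOver, ih]

theorem Cmd.keeps_rep {r : Reg} {n : ℕ} {c : Cmd L K} :
    (Cmd.rep n c).Keeps r ↔ (n ≠ 0 → c.Keeps r) := by
  simp [Cmd.rep, Cmd.keeps_seqs, List.mem_replicate]

theorem Cmd.loopsOver_rep {r : Reg} {n : ℕ} {c : Cmd L K} :
    (Cmd.rep n c).LoopsOver r ↔ (n ≠ 0 → c.LoopsOver r) := by
  simp [Cmd.rep, Cmd.loopsOver_seqs, List.mem_replicate]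

theorem Cmd.Phased.seqs {l : List (Cmd L K)} (h : ∀ c ∈ l, c.Phased) : (Cmd.seqs l).Phased := by
  induction l with
  | nil => exact .of (0, 0) trivial
  | cons c l ih =>
    exact .seq (h c (by simp)) (ih fun c hc => h c (by simp [hc]))

theorem Cmd.eval_inc_iterate (r : Reg) (n : ℕ) (s : St K R) :
    (Cmd.inc r : Cmd L K).eval^[n] s = ⟨Function.update s.idx r (s.idx r + n), s.mem⟩ := by
  induction n generalizing s with
  | zero => simp
  | succ n ih =>
    rw [Function.iterate_succ_apply, ih]
    simp only [Cmd.eval_act, Act.run, Function.update_self, Function.update_idem]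
    rw [Nat.add_assoc, Nat.add_comm 1]

theorem Cmd.eval_dec_iterate (r : Reg) (n : ℕ) (s : St K R) :
    (Cmd.dec r : Cmd L K).eval^[n] s = ⟨Function.update s.idx r (s.idx r - n), s.mem⟩ := by
  induction n generalizing s with
  | zero => simp
  | succ n ih =>
    rw [Function.iterate_succ_apply, ih]
    simp only [Cmd.eval_act, Act.run, Function.update_self, Function.update_idem]
    rw [Nat.sub_sub, Nat.add_comm 1]

end Combinators

/-! ### Distributing the input over several tapes. -/

section Spread

variable {L : FirstOrder.Language.{u, v}} {R : Type w} [L.Structure R]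

/-- Copies the cell that the register `(0, 1)` points to into the `m` cells after the one that
`(0, 3)` points to. -/
def fill (L : FirstOrder.Language.{u, v}) (m : ℕ) : Cmd L 1 :=
  .rep m (.seq (.inc (0, 3)) (.act (.copy 0 (0, 3) 0 (0, 1) (by simp))))

theorem eval_fill (m : ℕ) (s : St 1 R) (h : s.idx (0, 3) + m < s.idx (0, 1)) :
    (fill L m).eval s = ⟨Function.update s.idx (0, 3) (s.idx (0, 3) + m),
      fun j => if s.idx (0, 3) < j.2 ∧ j.2 ≤ s.idx (0, 3) + m then s.mem (0, s.idx (0, 1))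
        else s.mem j⟩ := by
  rw [fill, Cmd.eval_rep]
  induction m with
  | zero =>
    simp only [Function.iterate_zero_apply, Nat.add_zero, Function.update_eq_self]
    ext j
    · rfl
    · simp only
      rw [if_neg (by omega)]
  | succ m ih =>
    rw [Function.iterate_succ_apply', ih (by omega)]
    simp only [Cmd.eval_seq, Cmd.eval_act, Act.run]
    ext j
    · simp [Nat.add_assoc]
    · obtain ⟨a, i⟩ := j
      obtain rfl : a = 0 := Subsingleton.elim _ _
      simp [Function.update_apply]
      split_ifs <;> first | rfl | omega

/-- The body of the first loop of `spread`. -/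
def spreadStart (L : FirstOrder.Language.{u, v}) (T : ℕ) : Cmd L 1 :=
  .seqs [.inc (0, 2), .rep T (.inc (0, 3)), .rep T (.inc (0, 1))]

/-- Multiplication by the constant `T`: after as many rounds as there are letters, the pointers
stand at the end of the old and of the new positions. -/
theorem spreadStart_iterate (T t : ℕ) (s : St 1 R) :
    ((spreadStart L T).eval^[t] s).idx (0, 2) = s.idx (0, 2) + t ∧
    ((spreadStart L T).eval^[t] s).idx (0, 3) = s.idx (0, 3) + T * t ∧
    ((spreadStart L T).eval^[t] s).idx (0, 1) = s.idx (0, 1) + T * t ∧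
    ((spreadStart L T).eval^[t] s).mem = s.mem := by
  induction t with
  | zero => simp
  | succ t ih =>
    obtain ⟨h1, h2, h3, h4⟩ := ih
    rw [Function.iterate_succ_apply']
    generalize (spreadStart L T).eval^[t] s = s' at *
    simp only [spreadStart, Cmd.eval_seqs_cons, Cmd.eval_seqs_nil, Cmd.eval_rep,
      Cmd.eval_inc_iterate, Cmd.eval_act, Act.run]
    simp [h1, h2, h3, h4, Nat.mul_add, Nat.add_assoc]

/-- The body of the second loop of `spread`. -/
def spreadStep (L : FirstOrder.Language.{u, v}) (T : ℕ) : Cmd L 1 :=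
  .seqs [.dec (0, 2), .rep T (.dec (0, 3)), .act (.copy 0 (0, 3) 0 (0, 2) (by simp)),
    fill L (T - 1), .rep (T - 1) (.dec (0, 3))]

theorem eval_spreadStep {T m n : ℕ} (hT : 0 < T) (hmn : m < n) {s : St 1 R}
    (h1 : s.idx (0, 1) = T * n) (h2 : s.idx (0, 2) = m + 1) (h3 : s.idx (0, 3) = T * (m + 1)) :
    ((spreadStep L T).eval s).idx (0, 2) = m ∧ ((spreadStep L T).eval s).idx (0, 3) = T * m ∧
    ∀ i, ((spreadStep L T).eval s).mem (0, i) =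
      if T * m < i ∧ i < T * m + T then s.mem (0, T * n) else
        if i = T * m then s.mem (0, m) else s.mem (0, i) := by
  have e1 : T * m + T - T = T * m := by omega
  have e3 : T * (m + 1) ≤ T * n := Nat.mul_le_mul_left _ hmn
  have e4 : T * (m + 1) = T * m + T := by ring
  have e5 : T * n ≠ T * m := by omega
  simp only [spreadStep, Cmd.eval_seqs_cons, Cmd.eval_seqs_nil, Cmd.eval_rep,
    Cmd.eval_dec_iterate, Cmd.eval_act, Act.run]
  rw [eval_fill _ _ (by simp [h1, h3, e4]; omega)]
  simp only [Function.update_apply, h1, h2, h3, e4, Prod.mk.injEq, Nat.reduceEqDiff, and_false,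
    if_false, if_true, e5, true_and, Nat.add_sub_cancel, OfNat.one_ne_ofNat]
  intro i
  split_ifs <;> first | rfl | omega

/-- Moves the content of `Z[i]` to `Z[T * i]` for all `i` less than the length `I[0]` of the input
and clears the cells in between. -/
def spread (L : FirstOrder.Language.{u, v}) (T : ℕ) : Cmd L 1 := .seqs
  [.loop (0, 0) (0, 0) (spreadStart L T), .loop (0, 0) (0, 0) (spreadStep L T),
   -- The register `(0, 0)` cannot control a loop that decreases it. Its content is copied to `(0,
   -- 4)`, which controls the loop that clears it, and `(0, 4)` is cleared by means of `(0, 1)`,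
   -- whose content is at least as large.
   .loop (0, 0) (0, 0) (.inc (0, 4)), .loop (0, 4) (0, 4) (.dec (0, 0)),
   .loop (0, 1) (0, 1) (.dec (0, 4))]

theorem phased_spread (T : ℕ) : (spread L T).Phased := by
  refine .seqs fun c hc => ?_
  simp only [List.mem_cons, List.not_mem_nil, or_false] at hc
  rcases hc with rfl | rfl | rfl | rfl | rfl
  · refine .of (0, 0) ⟨rfl, ?_⟩
    simp [Cmd.loopsOver_seqs, Cmd.keeps_seqs, Cmd.loopsOver_rep, Cmd.keeps_rep, Cmd.Keeps,
      Act.Keeps, Cmd.LoopsOver, spreadStart]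
  · refine .of (0, 0) ⟨rfl, ?_⟩
    simp [Cmd.loopsOver_seqs, Cmd.keeps_seqs, Cmd.loopsOver_rep, Cmd.keeps_rep, Cmd.Keeps,
      Act.Keeps, Cmd.LoopsOver, fill, spreadStep]
  · exact .of (0, 0) ⟨rfl, by simp [Cmd.Keeps, Act.Keeps, Cmd.LoopsOver]⟩
  · exact .of (0, 4) ⟨rfl, by simp [Cmd.Keeps, Act.Keeps, Cmd.LoopsOver]⟩
  · exact .of (0, 1) ⟨rfl, by simp [Cmd.Keeps, Act.Keeps, Cmd.LoopsOver]⟩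

/-- The letters are moved from the last to the first. As `T * m` is not below `m`, no letter that is
still to be moved gets overwritten. The cell `T * x.length` lies behind the input and is blank, so
it serves as the source of the blanks written into the gaps. -/
theorem spreadStep_iterate {T : ℕ} (hT : 0 < T) (z : R) (x : List R) {s : St 1 R}
    (h1 : s.idx (0, 1) = T * x.length) (h2 : s.idx (0, 2) = x.length)
    (h3 : s.idx (0, 3) = T * x.length) (hm : ∀ i, s.mem (0, i) = x.getD i z) (t : ℕ)
    (ht : t ≤ x.length) :
    ((spreadStep L T).eval^[t] s).idx (0, 2) = x.length - t ∧
    ((spreadStep L T).eval^[t] s).idx (0, 3) = T * (x.length - t) ∧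
    ∀ i, ((spreadStep L T).eval^[t] s).mem (0, i) =
      if i < T * (x.length - t) then x.getD i z else
        if i % T = 0 then x.getD (i / T) z else z := by
  have e5 : x.length ≤ T * x.length := Nat.le_mul_of_pos_left _ hT
  induction t with
  | zero =>
    refine ⟨by simpa using h2, by simpa using h3, fun i => ?_⟩
    simp only [Function.iterate_zero_apply, Nat.sub_zero, hm]
    split_ifs with h4 h5
    · rfl
    · have h6 := Nat.div_add_mod i T
      rw [h5, Nat.add_zero] at h6
      have h7 : x.length ≤ i / T := Nat.le_of_mul_le_mul_left (by omega) hT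
      rw [List.getD_eq_default _ _ h7, List.getD_eq_default _ _ (by omega)]
    · rw [List.getD_eq_default _ _ (by omega)]
  | succ t ih =>
    obtain ⟨i2, i3, im⟩ := ih (by omega)
    have i1 : ((spreadStep L T).eval^[t] s).idx (0, 1) = T * x.length := by
      rw [Cmd.iterate_eval_idx_of_keeps, h1]
      simp [Cmd.keeps_seqs, Cmd.keeps_rep, Cmd.Keeps, Act.Keeps, fill, spreadStep]
    obtain ⟨m, hm'⟩ : ∃ m, x.length - t = m + 1 := ⟨x.length - t - 1, by omega⟩
    rw [Function.iterate_succ_apply']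
    rw [hm'] at i2 i3 im
    obtain ⟨j2, j3, jm⟩ := eval_spreadStep (L := L) hT (show m < x.length by omega) i1 i2 i3
    rw [show x.length - (t + 1) = m by omega]
    refine ⟨j2, j3, fun i => ?_⟩
    have e1 : T * (m + 1) = T * m + T := by ring
    have e3 : T * (m + 1) ≤ T * x.length := Nat.mul_le_mul_left _ (by omega)
    have e4 : m ≤ T * m := Nat.le_mul_of_pos_left _ hT
    have e6 : m < T * (m + 1) := by omega
    have e7 : ¬ T * x.length < T * (m + 1) := by omega
    rw [jm, im, im m, im i, if_neg e7, if_pos e6, Nat.mul_mod_right, if_pos rfl,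
      Nat.mul_div_cancel_left _ hT, List.getD_eq_default x z le_rfl]
    by_cases c1 : T * m < i ∧ i < T * m + T
    · rw [if_pos c1, if_neg (by omega), if_neg]
      intro h0
      obtain ⟨k, rfl⟩ := Nat.dvd_of_mod_eq_zero h0
      have := Nat.lt_of_mul_lt_mul_left c1.1
      have h8 : T * (m + 1) ≤ T * k := Nat.mul_le_mul_left _ this
      omega
    · rw [if_neg c1]
      by_cases c2 : i = T * m
      · subst c2
        rw [if_pos rfl, if_neg (by omega), Nat.mul_mod_right, if_pos rfl,
          Nat.mul_div_cancel_left _ hT]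
      · rw [if_neg c2]
        by_cases c3 : i < T * m
        · rw [if_pos c3, if_pos (by omega)]
        · rw [if_neg c3, if_neg (by omega)]

theorem eval_spread {T : ℕ} (hT : 0 < T) (z : R) (x : List R) (s : St 1 R)
    (hs : s.idx = Function.update (fun _ => 0) (0, 0) x.length) (hm : ∀ i, s.mem (0, i) = x.getD i z) :
    (spread L T).eval s = ⟨Function.update (fun _ => 0) (0, 1) (T * x.length),
      fun j => if j.2 % T = 0 then x.getD (j.2 / T) z else z⟩ := by
  have hx : x.length ≤ T * x.length := Nat.le_mul_of_pos_left _ hT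
  have a0 : s.idx (0, 0) = x.length := by simp [hs]
  simp only [spread, Cmd.eval_seqs_cons, Cmd.eval_seqs_nil, Cmd.eval_loop, min_self,
    Cmd.eval_inc_iterate, Cmd.eval_dec_iterate, a0]
  obtain ⟨b2, b3, b1, bm⟩ := spreadStart_iterate (L := L) T x.length s
  have bo : ∀ r : Reg, r ≠ (0, 2) → r ≠ (0, 3) → r ≠ (0, 1) →
      ((spreadStart L T).eval^[x.length] s).idx r = s.idx r := fun r h2 h3 h1 =>
    Cmd.iterate_eval_idx_of_keeps (by
      simp [Cmd.keeps_seqs, Cmd.keeps_rep, Cmd.Keeps, Act.Keeps, spreadStart, h1, h2, h3]) _ _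
  generalize (spreadStart L T).eval^[x.length] s = s₁ at *
  have b0 : s₁.idx (0, 0) = x.length := by rw [bo _ (by simp) (by simp) (by simp), a0]
  rw [b0]
  simp only [hs, ne_eq, Prod.mk.injEq, and_false, not_false_eq_true, Function.update_of_ne,
    Nat.zero_add, OfNat.ofNat_ne_zero, one_ne_zero] at b1 b2 b3
  obtain ⟨c2, c3, cm⟩ := spreadStep_iterate (L := L) hT z x b1 b2 b3 (by simpa [bm] using hm)
    x.length le_rfl
  have co : ∀ r : Reg, r ≠ (0, 2) → r ≠ (0, 3) →
      ((spreadStep L T).eval^[x.length] s₁).idx r = s₁.idx r := fun r h2 h3 =>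
    Cmd.iterate_eval_idx_of_keeps (by
      simp [Cmd.keeps_seqs, Cmd.keeps_rep, Cmd.Keeps, Act.Keeps, spreadStep, fill, h2, h3]) _ _
  generalize (spreadStep L T).eval^[x.length] s₁ = s₂ at *
  have c0 : s₂.idx (0, 0) = x.length := by rw [co _ (by simp) (by simp), b0]
  have c1 : s₂.idx (0, 1) = T * x.length := by rw [co _ (by simp) (by simp), b1]
  have c4 : s₂.idx (0, 4) = 0 := by
    rw [co _ (by simp) (by simp), bo _ (by simp) (by simp) (by simp), hs]; simp
  rw [Nat.sub_self, Nat.mul_zero] at *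
  ext r
  · by_cases r4 : r = (0, 4)
    · subst r4
      simp [c0, c1, c4]; omega
    by_cases r0 : r = (0, 0)
    · subst r0
      simp [c0, c1, c4]
    by_cases r1 : r = (0, 1)
    · subst r1
      simp [c0, c1, c4]
    by_cases r2 : r = (0, 2)
    · subst r2
      simp [c2]
    by_cases r3 : r = (0, 3)
    · subst r3
      simp [c3]
    simp [r4, r0, r1, co r r2 r3, bo r r2 r3 r1, hs]
  · obtain ⟨a, i⟩ := r
    obtain rfl : a = 0 := Subsingleton.elim _ _
    simp [cm]

end Spread

/-! ### Machines from structured programs. -/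

section Programs

variable {L : FirstOrder.Language.{u, v}} {R : Type w} [L.Structure R]

/-- The initial state of a structured program on input `x`: the input is on tape `0`, its length in
the register `(0, 1)`. -/
def Bipointed.start (B : Bipointed L R) (K : ℕ) [NeZero K] (x : List R) : St K R where
  idx := Function.update (fun _ => 0) (0, 1) x.length
  mem := fun j => if j.1 = 0 then x.getD j.2 B.zero else B.zero

theorem Bipointed.init_eq_conf (B : Bipointed L R) (x : List R) :
    B.init x = conf 0 (⟨Function.update (fun _ => 0) (0, 0) x.length,
      fun j => x.getD j.2 B.zero⟩ : St 1 R) 0 := by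
  refine Config.mk_congr rfl ?_ ?_
  · funext n
    simp only [Function.update_apply, Nat.one_mul]
    by_cases h : n = 0
    · subst h
      have : Nat.unpair 0 = (0, 0) := rfl
      simp [this]
    · by_cases h2 : n % 2 = 0
      · have : Nat.unpair (n / 2) ≠ (0, 0) := by
          intro e
          have := Nat.pair_unpair (n / 2)
          rw [e] at this
          have : n / 2 = 0 := this.symm
          omega
        simp [h, h2, this]
      · simp [h, h2]
  · funext m
    simp

/-- One and the same configuration is read with one tape and with `K` tapes: positions divisible by
`K` form the tape `0`, and a register with content `K * n` on the left is a register with content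
`n` on the right. -/
theorem conf_spread_eq (B : Bipointed L R) (K : ℕ) [NeZero K] (x : List R) (a : ℕ) :
    conf a (⟨Function.update (fun _ => 0) (0, 1) (K * x.length),
      fun j => if j.2 % K = 0 then x.getD (j.2 / K) B.zero else B.zero⟩ : St 1 R) 0 =
      conf a (B.start K x) 0 := by
  refine Config.mk_congr rfl ?_ ?_
  · funext n
    simp only [Bipointed.start, Function.update_apply, Nat.one_mul]
    split_ifs <;> simp
  · funext m
    simp only [Bipointed.start, Nat.div_one]
    have : Fin.ofNat K m = 0 ↔ m % K = 0 := by simp [Fin.ext_iff]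
    simp only [this]

/-- Structured programs can be executed by machines, in polynomial time. -/
theorem exists_program_of_phased (B : Bipointed L R) {K : ℕ} [NeZero K] {c : Cmd L K}
    (hc : c.Phased) (h0 : c.Keeps (0, 0)) :
    ∃ M : Program L, M.QueryFree ∧ M.PolyTime B ∅ ∧
      ∀ x, M.Accepts B ∅ x ↔ (c.eval (B.start K x)).mem (0, 0) = B.one := by
  have hK : 0 < K := Nat.pos_of_ne_zero (NeZero.ne K)
  obtain ⟨p, hp⟩ := (phased_spread (L := L) K).reachIn (R := R)
  obtain ⟨q, hq⟩ := hc.reachIn (R := R)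
  set n₁ := (spread L K).size with hn₁
  -- The register `(0, 0)` is stored in `I[0]`, and it is `0` after `spread` and kept by `c`. The
  -- last increment makes `I[0]` equal to `1`, so that the output is the single letter in the cell
  -- `(0, 0)`.
  set M : Program L := (spread L K).code 0 0 ++ (c.code n₁ 0 ++ [.inc 0]) with hM
  have hlen : M.length = n₁ + c.size + 1 := by
    simp [hM, Cmd.length_code, hn₁, Nat.add_assoc]
  obtain ⟨g1, g2⟩ := prefix_drop_append (a := 0) (l := (spread L K).code 0 0)
    (l' := c.code n₁ 0 ++ [.inc 0]) (m := M) (by simp [hM])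
  rw [Cmd.length_code, Nat.zero_add] at g2
  obtain ⟨g2, g3⟩ := prefix_drop_append g2
  rw [Cmd.length_code] at g3
  have run : ∀ x : List R, M.ReachIn ∅ (p.eval x.length + q.eval (K * x.length) + 1) (B.init x)
      ((Instr.inc 0 : Instr L).exec ∅ (conf (n₁ + c.size) (c.eval (B.start K x)) 0)) := by
    intro x
    have r1 := (hp M ∅ 0 ⟨Function.update (fun _ => 0) (0, 0) x.length, fun j => x.getD j.2 B.zero⟩ x.length
      (by intro r; simp only [Function.update_apply]; split_ifs <;> simp) g1).1
    rw [eval_spread hK B.zero x _ rfl (fun i => rfl), conf_spread_eq, Nat.zero_add,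
      ← Bipointed.init_eq_conf] at r1
    have r2 := (hq M ∅ n₁ (B.start K x) x.length
      (by intro r; simp only [Bipointed.start, Function.update_apply]; split_ifs <;> simp) g2).1
    have r3 := Program.reachIn_one (M := M) (Q := ∅)
      (c := conf (n₁ + c.size) (c.eval (B.start K x)) 0) (prefix_drop_cons g3).1
    refine ((r1.trans r2).trans r3).mono ?_
    have := polynomial_eval_mono q (Nat.le_mul_of_pos_left x.length hK)
    simp only at this
    omega
  refine ⟨M, ?_, ?_, fun x => ?_⟩
  · intro l₁ l₂ h
    simp [hM, Cmd.not_query_mem_code] at h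
  · refine ⟨p + q.comp (.C K * .X) + 1, fun x => ?_⟩
    obtain ⟨t, ht, h⟩ := run x
    refine ⟨t, by simpa using ht, _, _, (Program.run_eq_some_iff ..).2 h, ?_, rfl⟩
    simp [Instr.exec, hlen]
  · obtain ⟨t, -, h⟩ := run x
    rw [Program.accepts_iff_of_stepsTo h (by simp [Instr.exec, hlen])]
    have i0 := conf_idx_raw (n₁ + c.size) (c.eval (B.start K x)) 0 (0, 0)
    have m0 := conf_mem_cellAddr (n₁ + c.size) (c.eval (B.start K x)) 0 (0, 0)
    rw [Cmd.eval_idx_of_keeps h0] at i0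
    simp only [cellAddr, Nat.mul_zero, Fin.val_zero, Nat.add_zero] at m0
    have i0' : (conf (n₁ + c.size) (c.eval (B.start K x)) 0).idx 0 = 0 := by
      have e : Reg.raw (0, 0) = 0 := rfl
      rw [e] at i0
      rw [i0]
      simp [Bipointed.start]
    simp [Instr.exec, i0', m0]

end Programs

/-! ### Tapes that are not written. -/

section Frames

variable {L : FirstOrder.Language.{u, v}} {R : Type w} [L.Structure R] {K : ℕ}

/-- The action does not write the tape `a`. -/
def Act.KeepsTape (a : Fin K) : Act L K → Prop
  | .const j _ => a ≠ j.1
  | .func j _ _ => a ≠ j.1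
  | .copy a' _ _ _ _ => a ≠ a'
  | _ => True

/-- The command does not write the tape `a`. -/
def Cmd.KeepsTape (a : Fin K) : Cmd L K → Prop
  | .act x => x.KeepsTape a
  | .skip => True
  | .seq c d => c.KeepsTape a ∧ d.KeepsTape a
  | .ite _ c d => c.KeepsTape a ∧ d.KeepsTape a
  | .loop _ _ c => c.KeepsTape a

theorem Cmd.eval_mem_of_keepsTape {a : Fin K} {c : Cmd L K} (h : c.KeepsTape a) (s : St K R)
    (i : ℕ) : (c.eval s).mem (a, i) = s.mem (a, i) := by
  induction c generalizing s with
  | act x =>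
    cases x <;> simp_all [Cmd.KeepsTape, Act.KeepsTape, Cmd.eval, Act.run, Prod.ext_iff]
  | skip => rfl
  | seq c d ihc ihd => simp [Cmd.eval, ihd h.2, ihc h.1]
  | ite t c d ihc ihd =>
    simp only [Cmd.eval]
    split_ifs
    exacts [ihc h.1 s, ihd h.2 s]
  | loop r' b c ih =>
    simp only [Cmd.eval]
    generalize min (s.idx r') (s.idx b) = n
    induction n generalizing s with
    | zero => rfl
    | succ n ihn => rw [Function.iterate_succ_apply, ihn, ih h]

theorem Cmd.iterate_eval_mem_of_keepsTape {a : Fin K} {c : Cmd L K} (h : c.KeepsTape a)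
    (s : St K R) (n i : ℕ) : (c.eval^[n] s).mem (a, i) = s.mem (a, i) := by
  induction n generalizing s with
  | zero => rfl
  | succ n ih => rw [Function.iterate_succ_apply, ih, Cmd.eval_mem_of_keepsTape h]

theorem Cmd.keepsTape_seqs {a : Fin K} {l : List (Cmd L K)} :
    (Cmd.seqs l).KeepsTape a ↔ ∀ c ∈ l, c.KeepsTape a := by
  induction l with
  | nil => simp [Cmd.seqs, Cmd.KeepsTape]
  | cons c l ih => simp [Cmd.seqs, Cmd.KeepsTape, ih]

theorem Cmd.keepsTape_rep {a : Fin K} {n : ℕ} {c : Cmd L K} :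
    (Cmd.rep n c).KeepsTape a ↔ (n ≠ 0 → c.KeepsTape a) := by
  simp [Cmd.rep, Cmd.keepsTape_seqs, List.mem_replicate]

end Frames

/-! ### Machines run for a fixed number of steps, and the cells they touch. -/

section Machines

variable {L : FirstOrder.Language.{u, v}} {R : Type w} [L.Structure R]

/-- The next configuration, where stop configurations and configurations with an illegal label are
repeated. -/
noncomputable def Program.step (M : Program L) (Q : Set (List R)) (c : Config R) : Config R :=
  (M.next Q c).getD c

theorem Program.StepsTo.iterate_step {M : Program L} {Q : Set (List R)} {t : ℕ} {c d : Config R}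
    (h : M.StepsTo Q t c d) (hd : d.label = M.length) {T : ℕ} (hT : t ≤ T) :
    (M.step Q)^[T] c = d := by
  have stay : ∀ n, (M.step Q)^[n] d = d := by
    intro n
    induction n with
    | zero => rfl
    | succ n ih => simp [Program.step, Program.next_eq_none hd, ih]
  induction t generalizing c T with
  | zero => cases h; exact stay T
  | succ t ih =>
    obtain ⟨x, hx, h⟩ := h
    obtain ⟨T, rfl⟩ : ∃ T', T = T' + 1 := ⟨T - 1, by omega⟩
    have : M.step Q c = x := by simp [Program.step, hx]
    rw [Function.iterate_succ_apply, this]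
    exact ih h (by omega)

/-- The decision made by a machine can be read off from its configuration after sufficiently many
steps. -/
theorem Program.PolyTime.exists_accepts_iff {M : Program L} {B : Bipointed L R}
    {Q : Set (List R)} (h : M.PolyTime B Q) : ∃ p : Polynomial ℕ, ∀ (x : List R) (T : ℕ),
      p.eval x.length ≤ T → (M.Accepts B Q x ↔
        ((M.step Q)^[T] (B.init x)).idx 0 = 1 ∧ ((M.step Q)^[T] (B.init x)).mem 0 = B.one) := by
  obtain ⟨p, hp⟩ := h
  refine ⟨p, fun x T hT => ?_⟩
  obtain ⟨t, ht, y, c, hc, hl, -⟩ := hp x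
  rw [Program.run_eq_some_iff] at hc
  rw [hc.iterate_step hl (ht.trans hT), Program.accepts_iff_of_stepsTo hc hl]

theorem Instr.exec_eq_of_not_query {i : Instr L} (h : ∀ l₁ l₂, i ≠ .query l₁ l₂)
    (Q Q' : Set (List R)) (c : Config R) : i.exec Q c = i.exec Q' c := by
  cases i <;> first | rfl | exact absurd rfl (h _ _)

/-- `J` is a bound for all the numbers that occur in the instruction. -/
def Instr.BoundedBy (J : ℕ) : Instr L → Prop
  | .const j _ => j < J
  | .func j _ _ => j < J
  | .ifEq _ _ l₁ l₂ => l₁ < J ∧ l₂ < J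
  | .ifRel _ _ l₁ l₂ => l₁ < J ∧ l₂ < J
  | .copy _ _ => True
  | .inc j => j < J
  | .dec j => j < J
  | .ifIdxEq _ _ l₁ l₂ => l₁ < J ∧ l₂ < J
  | .query l₁ l₂ => l₁ < J ∧ l₂ < J

theorem Instr.BoundedBy.mono {J J' : ℕ} (h : J ≤ J') {i : Instr L} (hi : i.BoundedBy J) :
    i.BoundedBy J' := by
  cases i <;> simp only [Instr.BoundedBy] at * <;> omega

theorem Instr.exists_boundedBy (i : Instr L) : ∃ J, i.BoundedBy J := by
  cases i with
  | const j _ => exact ⟨j + 1, j.lt_succ_self⟩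
  | func j _ _ => exact ⟨j + 1, j.lt_succ_self⟩
  | ifEq _ _ l₁ l₂ => exact ⟨l₁ + l₂ + 1, by simp only [Instr.BoundedBy]; omega⟩
  | ifRel _ _ l₁ l₂ => exact ⟨l₁ + l₂ + 1, by simp only [Instr.BoundedBy]; omega⟩
  | copy _ _ => exact ⟨0, trivial⟩
  | inc j => exact ⟨j + 1, j.lt_succ_self⟩
  | dec j => exact ⟨j + 1, j.lt_succ_self⟩
  | ifIdxEq _ _ l₁ l₂ => exact ⟨l₁ + l₂ + 1, by simp only [Instr.BoundedBy]; omega⟩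
  | query l₁ l₂ => exact ⟨l₁ + l₂ + 1, by simp only [Instr.BoundedBy]; omega⟩

theorem Program.exists_boundedBy (M : Program L) : ∃ J, ∀ i ∈ M, i.BoundedBy J := by
  induction M with
  | nil => exact ⟨0, by simp⟩
  | cons i M ih =>
    obtain ⟨J, hJ⟩ := ih
    obtain ⟨J', hJ'⟩ := i.exists_boundedBy
    refine ⟨max J J', fun k hk => ?_⟩
    rcases List.mem_cons.1 hk with rfl | hk
    · exact hJ'.mono (le_max_right _ _)
    · exact (hJ k hk).mono (le_max_left _ _)

/-- The configuration is blank from the cell number `b` on and its registers are bounded by `b`, and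
vanish from the number `J` on. -/
def Config.Within (J : ℕ) (z : R) (b : ℕ) (c : Config R) : Prop :=
  c.label ≤ b ∧ (∀ j, c.idx j ≤ b) ∧ (∀ j, J ≤ j → c.idx j = 0) ∧ ∀ i, b < i → c.mem i = z

/-- A cell that is written either is named in the instruction, hence lies below `J`, or is pointed
to by an index register, hence is at most `b`. The bound is used to clear the tape of a simulated
machine before it is used again. -/
theorem Instr.BoundedBy.within_exec {J : ℕ} {i : Instr L} (hi : i.BoundedBy J) {z : R} {b : ℕ}
    (hJ : J ≤ b) {c : Config R} (h : c.Within J z b) (Q : Set (List R)) :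
    (i.exec Q c).Within J z (b + 1) := by
  obtain ⟨h1, h2, h3, h4⟩ := h
  have h2' : ∀ j, c.idx j ≤ b + 1 := fun j => (h2 j).trans (by omega)
  have h4' : ∀ i, b + 1 < i → c.mem i = z := fun i hi => h4 i (by omega)
  have upd : ∀ k y, k ≤ b → ∀ i, b + 1 < i → Function.update c.mem k y i = z := by
    intro k y hk i hi
    rw [Function.update_of_ne (by omega), h4' i hi]
  have iupd : ∀ k y, k < J → y ≤ b + 1 → (∀ j, Function.update c.idx k y j ≤ b + 1) ∧
      ∀ j, J ≤ j → Function.update c.idx k y j = 0 := by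
    intro k y hk hy
    constructor
    · intro j
      rw [Function.update_apply]
      split_ifs
      exacts [hy, h2' j]
    · intro j hj
      rw [Function.update_of_ne (by omega), h3 j hj]
  cases i <;> simp only [Instr.BoundedBy] at hi
  case const j a => exact ⟨by simp [Instr.exec, h1], h2', h3, upd _ _ (by omega)⟩
  case func j n f k => exact ⟨by simp [Instr.exec, h1], h2', h3, upd _ _ (by omega)⟩
  case ifEq j₁ j₂ l₁ l₂ =>
    exact ⟨by simp only [Instr.exec]; split_ifs <;> omega, h2', h3, h4'⟩
  case ifRel n P j l₁ l₂ =>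
    exact ⟨by simp only [Instr.exec]; split_ifs <;> omega, h2', h3, h4'⟩
  case copy j₀ j₁ => exact ⟨by simp [Instr.exec, h1], h2', h3, upd _ _ (h2 j₀)⟩
  case inc j =>
    have := iupd j (c.idx j + 1) hi (by have := h2 j; omega)
    exact ⟨by simp [Instr.exec, h1], this.1, this.2, h4'⟩
  case dec j =>
    have := iupd j (c.idx j - 1) hi (by have := h2 j; omega)
    exact ⟨by simp [Instr.exec, h1], this.1, this.2, h4'⟩
  case ifIdxEq j₁ j₂ l₁ l₂ =>
    exact ⟨by simp only [Instr.exec]; split_ifs <;> omega, h2', h3, h4'⟩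
  case query l₁ l₂ =>
    exact ⟨by simp only [Instr.exec]; split_ifs <;> omega, h2', h3, h4'⟩

theorem Config.Within.mono {J b b' : ℕ} {z : R} {c : Config R} (h : c.Within J z b)
    (hb : b ≤ b') : c.Within J z b' := by
  obtain ⟨h1, h2, h3, h4⟩ := h
  exact ⟨by omega, fun j => (h2 j).trans hb, h3, fun i hi => h4 i (by omega)⟩

theorem Program.within_iterate_step {M : Program L} {J : ℕ} (hM : ∀ i ∈ M, i.BoundedBy J) {z : R}
    {b : ℕ} (hJ : J ≤ b) {c : Config R} (h : c.Within J z b) (Q : ℕ → Set (List R)) (t : ℕ)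
    {f : ℕ → Config R} (h0 : f 0 = c) (hf : ∀ t, f (t + 1) = M.step (Q t) (f t)) :
    (f t).Within J z (b + t) := by
  induction t with
  | zero => rwa [h0]
  | succ t ih =>
    rw [hf, Program.step, Program.next]
    rcases hi : M[(f t).label]? with _ | i
    · exact ih.mono (by omega)
    · exact (hM i (List.mem_of_getElem? hi)).within_exec (by omega) ih _

theorem Bipointed.within_init (B : Bipointed L R) (J : ℕ) (hJ : 0 < J) (x : List R) :
    (B.init x).Within J B.zero x.length := by
  refine ⟨Nat.zero_le _, fun j => ?_, fun j hj => ?_, fun i hi => ?_⟩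
  · simp only [Bipointed.init]; split_ifs <;> omega
  · simp only [Bipointed.init]; rw [if_neg (by omega)]
  · simp only [Bipointed.init]; rw [List.getD_eq_default _ _ (by omega)]

end Machines

/-! ### Interpreting a machine by a structured program. -/

section Simulation

variable {L : FirstOrder.Language.{u, v}} {R : Type w} [L.Structure R] {K : ℕ}

/-- The configuration of a simulated machine, the tape of which is the tape `a` and the index
registers of which are those of the bank `b`. -/
def St.config (s : St K R) (a : Fin K) (b : ℕ) : Config R where
  label := s.idx (b, 0)
  idx := fun j => s.idx (b, j + 1)
  mem := fun i => s.mem (a, i)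

theorem St.config_congr {s s' : St K R} {a : Fin K} {b : ℕ}
    (h : ∀ j, s.idx (b, j) = s'.idx (b, j)) (h' : ∀ i, s.mem (a, i) = s'.mem (a, i)) :
    s.config a b = s'.config a b :=
  Config.mk_congr (h 0) (funext fun _ => h _) (funext h')

/-- Sets the label of a simulated machine to `l`, if it is `0`. -/
def jump (L : FirstOrder.Language.{u, v}) (K b l : ℕ) : Cmd L K := .rep l (.inc (b, 0))

/-- Simulates an instruction with label `l`, when the label register has been set to `0`. Queries
are handled by the command `h`. The answer is `yes` if the cells `y` and `y'` have the same content
afterwards. -/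
def Instr.sim (a : Fin K) (b : ℕ) (h : Cmd L K) (y y' : Fin K × ℕ) (l : ℕ) : Instr L → Cmd L K
  | .const j c => .seq (.act (.const (a, j) c)) (jump L K b (l + 1))
  | .func j₀ f j => .seq (.act (.func (a, j₀) f fun i => (a, j i))) (jump L K b (l + 1))
  | .ifEq j₁ j₂ l₁ l₂ => .ite (.eq (a, j₁) (a, j₂)) (jump L K b l₁) (jump L K b l₂)
  | .ifRel P j l₁ l₂ => .ite (.rel P fun i => (a, j i)) (jump L K b l₁) (jump L K b l₂)
  | .copy j₀ j₁ =>
      -- Copying a cell to itself has no effect, and the action `copy` is available for different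
      -- registers only.
      if h : j₀ = j₁ then jump L K b (l + 1) else
        .seq (.act (.copy a (b, j₀ + 1) a (b, j₁ + 1) (by simp [h]))) (jump L K b (l + 1))
  | .inc j => .seq (.inc (b, j + 1)) (jump L K b (l + 1))
  | .dec j => .seq (.dec (b, j + 1)) (jump L K b (l + 1))
  | .ifIdxEq j₁ j₂ l₁ l₂ => .ite (.idxEq (b, j₁ + 1) (b, j₂ + 1)) (jump L K b l₁) (jump L K b l₂)
  | .query l₁ l₂ => .seq h (.ite (.eq y y') (jump L K b l₁) (jump L K b l₂))

/-- Simulates the instruction in the given list, whose labels start with `l`, that is determined by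
the label register minus `l`. -/
def dispatch (a : Fin K) (b : ℕ) (h : Cmd L K) (y y' : Fin K × ℕ) : List (Instr L) → ℕ → Cmd L K
  | [], l => jump L K b l
  | i :: M, l =>
      .ite (.idxEq (b, 0) (0, 0)) (i.sim a b h y y' l)
        (.seq (.dec (b, 0)) (dispatch a b h y y' M (l + 1)))

/-- Simulates a step of a machine. -/
def Program.sim (M : Program L) (a : Fin K) (b : ℕ) (h : Cmd L K) (y y' : Fin K × ℕ) : Cmd L K :=
  dispatch a b h y y' M 0

theorem eval_jump (b l : ℕ) (s : St K R) : (jump L K b l).eval s =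
    ⟨Function.update s.idx (b, 0) (s.idx (b, 0) + l), s.mem⟩ := by
  rw [jump, Cmd.eval_rep, Cmd.eval_inc_iterate]

/-- The label register is its own search counter: it is decreased at each instruction that is passed
and so is zero when the right one is found. If the list is exhausted, the number of passed
instructions is added again, which restores the label of a halted machine. -/
theorem eval_dispatch {a : Fin K} {b : ℕ} (hb : b ≠ 0) {h : Cmd L K} {y y' : Fin K × ℕ}
    (M : List (Instr L)) (l : ℕ) (s : St K R) (hs : s.idx (0, 0) = 0) :
    (dispatch a b h y y' M l).eval s = match M[s.idx (b, 0)]? with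
      | some i => (i.sim a b h y y' (l + s.idx (b, 0))).eval
          ⟨Function.update s.idx (b, 0) 0, s.mem⟩
      | none => ⟨Function.update s.idx (b, 0) (l + s.idx (b, 0)), s.mem⟩ := by
  induction M generalizing l s with
  | nil => simp [dispatch, eval_jump, Nat.add_comm]
  | cons i M ih =>
    rw [dispatch, Cmd.eval_ite]
    simp only [Test.Holds, hs]
    rcases hp : s.idx (b, 0) with _ | p
    · have : Function.update s.idx (b, 0) 0 = s.idx :=
        Function.update_eq_self_iff.2 hp.symm
      simp [this]
    · rw [if_neg (by omega), Cmd.eval_seq, ih]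
      · simp only [Cmd.eval_act, Act.run, hp, Function.update_self, Nat.add_sub_cancel,
          List.getElem?_cons_succ, Function.update_idem]
        rw [show l + 1 + p = l + (p + 1) by ring]
      · simp [Cmd.eval_act, Act.run, hb.symm, hs]

theorem config_eval_sim {a : Fin K} {b : ℕ} {h : Cmd L K} {y y' : Fin K × ℕ} (l : ℕ) {i : Instr L}
    (hi : ∀ l₁ l₂, i ≠ .query l₁ l₂) (Q : Set (List R)) (s : St K R) (hs : s.idx (b, 0) = 0) :
    ((i.sim a b h y y' l).eval s).config a b =
      i.exec Q ⟨l, (s.config a b).idx, (s.config a b).mem⟩ := by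
  have ui : ∀ (f : Reg → ℕ) (j y : ℕ), (fun k => Function.update f (b, j + 1) y (b, k + 1)) =
      Function.update (fun k => f (b, k + 1)) j y := by
    intro f j y; funext k; simp [Function.update_apply]
  have um : ∀ (j : ℕ) (y : R), (fun k => Function.update s.mem (a, j) y (a, k)) =
      Function.update (fun k => s.mem (a, k)) j y := by
    intro j y; funext k; simp [Function.update_apply]
  cases i
  case const j c => simp [Instr.sim, Cmd.eval_seq, Cmd.eval_act, Act.run, eval_jump, St.config,
    Instr.exec, hs, um]
  case func j₀ n f j => simp [Instr.sim, Cmd.eval_seq, Cmd.eval_act, Act.run, eval_jump, St.config,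
    Instr.exec, hs, um]
  case ifEq j₁ j₂ l₁ l₂ =>
    by_cases e : s.mem (a, j₁) = s.mem (a, j₂) <;>
      simp [Instr.sim, Cmd.eval_ite, Test.Holds, Instr.exec, St.config, e, eval_jump, hs]
  case ifRel n P j l₁ l₂ =>
    by_cases e : FirstOrder.Language.Structure.RelMap P fun i => s.mem (a, j i) <;>
      simp [Instr.sim, Cmd.eval_ite, Test.Holds, Instr.exec, St.config, e, eval_jump, hs]
  case copy j₀ j₁ =>
    simp only [Instr.sim]
    split_ifs with e
    · subst e
      simp [eval_jump, St.config, Instr.exec, hs]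
    · simp [Cmd.eval_seq, Cmd.eval_act, Act.run, eval_jump, St.config, Instr.exec, hs, um]
  case inc j => simp [Instr.sim, Cmd.eval_seq, Cmd.eval_act, Act.run, eval_jump, St.config,
    Instr.exec, hs, ui]
  case dec j => simp [Instr.sim, Cmd.eval_seq, Cmd.eval_act, Act.run, eval_jump, St.config,
    Instr.exec, hs, ui]
  case ifIdxEq j₁ j₂ l₁ l₂ =>
    by_cases e : s.idx (b, j₁ + 1) = s.idx (b, j₂ + 1) <;>
      simp [Instr.sim, Cmd.eval_ite, Test.Holds, Instr.exec, St.config, e, eval_jump, hs]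
  case query l₁ l₂ => exact absurd rfl (hi l₁ l₂)

/-- Simulation of a step that is not a query. -/
theorem Program.config_eval_sim (M : Program L) {a : Fin K} {b : ℕ} (hb : b ≠ 0) (h : Cmd L K)
    (y y' : Fin K × ℕ) (Q : Set (List R)) (s : St K R) (hs : s.idx (0, 0) = 0)
    (hq : ∀ l₁ l₂, M[s.idx (b, 0)]? ≠ some (.query l₁ l₂)) :
    ((M.sim a b h y y').eval s).config a b = M.step Q (s.config a b) := by
  rw [Program.sim, eval_dispatch hb _ _ _ hs, Program.step, Program.next]
  simp only [Nat.zero_add]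
  change _ = (Option.map _ M[s.idx (b, 0)]?).getD _
  rcases hi : M[s.idx (b, 0)]? with _ | i
  · simp
  · simp only [Option.map_some, Option.getD_some]
    rw [RMachine.config_eval_sim _ (fun l₁ l₂ e => hq l₁ l₂ (by rw [hi, e])) Q _ (by simp)]
    congr 1
    exact Config.mk_congr rfl (by funext j; simp [St.config]) rfl

/-- Simulation of a step that is a query. -/
theorem Program.eval_sim_of_query (M : Program L) {a : Fin K} {b : ℕ} (hb : b ≠ 0) {h : Cmd L K}
    (hh : h.Keeps (b, 0)) (y y' : Fin K × ℕ) (s : St K R) (hs : s.idx (0, 0) = 0) {l₁ l₂ : ℕ}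
    (hq : M[s.idx (b, 0)]? = some (.query l₁ l₂)) {s' : St K R}
    (hs' : s' = h.eval ⟨Function.update s.idx (b, 0) 0, s.mem⟩) :
    (s'.mem y = s'.mem y' → (M.sim a b h y y').eval s =
      ⟨Function.update s'.idx (b, 0) l₁, s'.mem⟩) ∧
    (s'.mem y ≠ s'.mem y' → (M.sim a b h y y').eval s =
      ⟨Function.update s'.idx (b, 0) l₂, s'.mem⟩) := by
  have h0 : s'.idx (b, 0) = 0 := by rw [hs', Cmd.eval_idx_of_keeps hh]; simp
  rw [Program.sim, eval_dispatch hb _ _ _ hs]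
  simp only [hq, Instr.sim, Cmd.eval_seq, ← hs', Cmd.eval_ite, Test.Holds, eval_jump, h0,
    Nat.zero_add]
  exact ⟨fun e => if_pos e, fun e => if_neg e⟩

/-- Only the bank and the tape of the simulated machine are written, except in queries. -/
theorem Program.eval_sim_frame (M : Program L) {a : Fin K} {b : ℕ} (h : Cmd L K)
    (y y' : Fin K × ℕ) (P : Cmd L K → Prop) (hseq : ∀ c d, P c → P d → P (.seq c d))
    (hite : ∀ t c d, P c → P d → P (.ite t c d)) (hskip : P .skip)
    (hinc : ∀ j, P (.inc (b, j))) (hdec : ∀ j, P (.dec (b, j)))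
    (hconst : ∀ j c, P (.act (.const (a, j) c)))
    (hfunc : ∀ (j₀ n : ℕ) (f : L.Functions (n + 1)) j, P (.act (.func (a, j₀) f j)))
    (hcopy : ∀ r r' (h : r ≠ r'), P (.act (.copy a r a r' h))) (hh : P h) :
    P (M.sim a b h y y') := by
  have hjump : ∀ l, P (jump L K b l) := by
    intro l
    induction l with
    | zero => exact hskip
    | succ l ih => exact hseq _ _ (hinc 0) ih
  have hsim : ∀ (i : Instr L) l, P (i.sim a b h y y' l) := by
    intro i l
    cases i
    case const j c => exact hseq _ _ (hconst _ _) (hjump _)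
    case func j₀ n f j => exact hseq _ _ (hfunc _ _ _ _) (hjump _)
    case ifEq j₁ j₂ l₁ l₂ => exact hite _ _ _ (hjump _) (hjump _)
    case ifRel n P j l₁ l₂ => exact hite _ _ _ (hjump _) (hjump _)
    case copy j₀ j₁ =>
      simp only [Instr.sim]
      split_ifs
      · exact hjump _
      · exact hseq _ _ (hcopy _ _ _) (hjump _)
    case inc j => exact hseq _ _ (hinc _) (hjump _)
    case dec j => exact hseq _ _ (hdec _) (hjump _)
    case ifIdxEq j₁ j₂ l₁ l₂ => exact hite _ _ _ (hjump _) (hjump _)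
    case query l₁ l₂ => exact hseq _ _ hh (hite _ _ _ (hjump _) (hjump _))
  have hdisp : ∀ (M : List (Instr L)) l, P (dispatch a b h y y' M l) := by
    intro M
    induction M with
    | nil => exact fun l => hjump l
    | cons i M ih => exact fun l => hite _ _ _ (hsim _ _) (hseq _ _ (hdec 0) (ih _))
  exact hdisp M 0

theorem Program.keeps_sim (M : Program L) {a : Fin K} {b : ℕ} {h : Cmd L K} (y y' : Fin K × ℕ)
    {r : Reg} (hr : r.1 ≠ b) (hh : h.Keeps r) : (M.sim a b h y y').Keeps r := by
  have hr' : ∀ j, r ≠ (b, j) := fun j e => hr (by rw [e])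
  exact M.eval_sim_frame h y y' (Cmd.Keeps r) (fun _ _ => And.intro) (fun _ _ _ => And.intro)
    trivial hr' hr' (fun _ _ => trivial) (fun _ _ _ _ => trivial) (fun _ _ _ => trivial) hh

theorem Program.keepsTape_sim (M : Program L) {a : Fin K} {b : ℕ} {h : Cmd L K}
    (y y' : Fin K × ℕ) {a' : Fin K} (ha : a' ≠ a) (hh : h.KeepsTape a') :
    (M.sim a b h y y').KeepsTape a' :=
  M.eval_sim_frame h y y' (Cmd.KeepsTape a') (fun _ _ => And.intro) (fun _ _ _ => And.intro)
    trivial (fun _ => trivial) (fun _ => trivial) (fun _ _ => ha) (fun _ _ _ _ => ha)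
    (fun _ _ _ => ha) hh

theorem Program.loopsOver_sim (M : Program L) {a : Fin K} {b : ℕ} {h : Cmd L K}
    (y y' : Fin K × ℕ) {r : Reg} (hr : r.1 ≠ b) (hh : h.LoopsOver r) :
    (M.sim a b h y y').LoopsOver r := by
  have hr' : ∀ j, r ≠ (b, j) := fun j e => hr (by rw [e])
  exact M.eval_sim_frame h y y' (Cmd.LoopsOver r) (fun _ _ => And.intro) (fun _ _ _ => And.intro)
    trivial hr' hr' (fun _ _ => trivial) (fun _ _ _ _ => trivial) (fun _ _ _ => trivial) hh

/-- Simulation of several steps of a machine without oracle. -/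
theorem Program.QueryFree.config_iterate_eval_sim {M : Program L} (hM : M.QueryFree) {a : Fin K}
    {b : ℕ} (hb : b ≠ 0) (y y' : Fin K × ℕ) (Q : Set (List R)) (s : St K R)
    (hs : s.idx (0, 0) = 0) (t : ℕ) :
    ((M.sim a b .skip y y').eval^[t] s).config a b = (M.step Q)^[t] (s.config a b) := by
  induction t with
  | zero => rfl
  | succ t ih =>
    rw [Function.iterate_succ_apply', Function.iterate_succ_apply', ← ih]
    refine M.config_eval_sim hb _ _ _ _ _ ?_ fun l₁ l₂ e => hM l₁ l₂ (List.mem_of_getElem? e)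
    rw [Cmd.iterate_eval_idx_of_keeps, hs]
    exact M.keeps_sim _ _ hb.symm trivial

end Simulation

attribute [simp] Cmd.Keeps Act.Keeps Cmd.KeepsTape Act.KeepsTape Cmd.LoopsOver Cmd.keeps_seqs
  Cmd.keeps_rep Cmd.keepsTape_seqs Cmd.keepsTape_rep Cmd.loopsOver_seqs Cmd.loopsOver_rep

/-! ### Words read off a sequence. -/

/-- The `n` successive values of a sequence from the index `p` on. -/
def slice {R : Type w} (f : ℕ → R) (p n : ℕ) : List R := (List.range n).map fun i => f (p + i)

section Slices

variable {R : Type w}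

@[simp]
theorem length_slice (f : ℕ → R) (p n : ℕ) : (slice f p n).length = n := by simp [slice]

@[simp]
theorem slice_zero (f : ℕ → R) (p : ℕ) : slice f p 0 = [] := rfl

theorem slice_succ (f : ℕ → R) (p n : ℕ) : slice f p (n + 1) = slice f p n ++ [f (p + n)] := by
  simp [slice, List.range_succ]

theorem slice_congr {f g : ℕ → R} {p q n : ℕ} (h : ∀ i < n, f (p + i) = g (q + i)) :
    slice f p n = slice g q n :=
  List.map_congr_left fun i hi => h i (List.mem_range.1 hi)

theorem slice_getD (x : List R) (z : R) : slice (fun i => x.getD i z) 0 x.length = x := by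
  apply List.ext_getElem
  · simp
  · intro i h1 h2
    simp [slice, h2]

theorem slice_eq_iff {f : ℕ → R} {p : ℕ} {x : List R} (z : R) :
    slice f p x.length = x ↔ ∀ i < x.length, f (p + i) = x.getD i z := by
  constructor
  · intro h i hi
    have := congrArg (fun y => y.getD i z) h
    simpa [slice, hi] using this
  · intro h
    conv_rhs => rw [← slice_getD x z]
    exact slice_congr fun i hi => by rw [h i hi, Nat.zero_add]

end Slices

/-! ### Arithmetic of registers. -/

section Arithmetic

variable {L : FirstOrder.Language.{u, v}} {R : Type w} [L.Structure R] {K : ℕ}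

/-- The state with the register `r` increased by `n`. -/
def St.add (s : St K R) (r : Reg) (n : ℕ) : St K R :=
  ⟨Function.update s.idx r (s.idx r + n), s.mem⟩

@[simp]
theorem St.add_idx_self (s : St K R) (r : Reg) (n : ℕ) : (s.add r n).idx r = s.idx r + n := by
  simp [St.add]

theorem St.add_idx_of_ne (s : St K R) {r r' : Reg} (h : r' ≠ r) (n : ℕ) :
    (s.add r n).idx r' = s.idx r' := by
  simp [St.add, h]

@[simp]
theorem St.add_mem (s : St K R) (r : Reg) (n : ℕ) : (s.add r n).mem = s.mem := rfl

@[simp]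
theorem St.add_zero (s : St K R) (r : Reg) : s.add r 0 = s := by simp [St.add]

theorem St.add_add (s : St K R) (r : Reg) (m n : ℕ) : (s.add r m).add r n = s.add r (m + n) := by
  simp [St.add, Nat.add_assoc]

theorem eval_inc (r : Reg) (s : St K R) : (Cmd.inc r : Cmd L K).eval s = s.add r 1 := rfl

/-- Adds the register `r`, as long as it is bounded by `b`, to the register `d`. -/
def addReg (L : FirstOrder.Language.{u, v}) (K : ℕ) (d r b : Reg) : Cmd L K := .loop r b (.inc d)

theorem eval_addReg {d r b : Reg} {s : St K R} (h : s.idx r ≤ s.idx b) :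
    (addReg L K d r b).eval s = s.add d (s.idx r) := by
  rw [addReg, Cmd.eval_loop, Nat.min_eq_left h, Cmd.eval_inc_iterate]
  rfl

/-- Clears the register `d`, as long as it is bounded by `b`. -/
def clearReg (L : FirstOrder.Language.{u, v}) (K : ℕ) (d b : Reg) : Cmd L K := .loop b b (.dec d)

theorem eval_clearReg {d b : Reg} {s : St K R} (h : s.idx d ≤ s.idx b) :
    (clearReg L K d b).eval s = ⟨Function.update s.idx d 0, s.mem⟩ := by
  rw [clearReg, Cmd.eval_loop, Cmd.eval_dec_iterate, min_self, Nat.sub_eq_zero_of_le h]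

/-- Copies the register `r` to the register `d`, where both are bounded by `b`. -/
def setReg (L : FirstOrder.Language.{u, v}) (K : ℕ) (d r b : Reg) : Cmd L K :=
  .seq (clearReg L K d b) (addReg L K d r b)

theorem eval_setReg {d r b : Reg} (hr : r ≠ d) (hb : b ≠ d) {s : St K R} (h : s.idx d ≤ s.idx b)
    (h' : s.idx r ≤ s.idx b) :
    (setReg L K d r b).eval s = ⟨Function.update s.idx d (s.idx r), s.mem⟩ := by
  rw [setReg, Cmd.eval_seq, eval_clearReg h, eval_addReg (by simp [hr, hb, h'])]
  simp [St.add, hr]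

/-- Increases the register `d` by the `i`-th power of the register `r`. -/
def addPow (L : FirstOrder.Language.{u, v}) (K : ℕ) (d r b : Reg) : ℕ → Cmd L K
  | 0 => .inc d
  | i + 1 => .loop r b (addPow L K d r b i)

/-- The increment sits inside `i` nested loops, all controlled by `r`, and none of them touches `r`
or `b`. -/
theorem eval_addPow {d r b : Reg} (hr : r ≠ d) (hb : b ≠ d) (i : ℕ) {s : St K R}
    (h : s.idx r ≤ s.idx b) : (addPow L K d r b i).eval s = s.add d (s.idx r ^ i) := by
  induction i generalizing s with
  | zero => simp [addPow, eval_inc]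
  | succ i ih =>
    rw [addPow, Cmd.eval_loop, Nat.min_eq_left h]
    have key : ∀ t, (addPow L K d r b i).eval^[t] s = s.add d (t * s.idx r ^ i) := by
      intro t
      induction t with
      | zero => simp
      | succ t iht =>
        rw [Function.iterate_succ_apply', iht, ih, St.add_add, St.add_idx_of_ne _ hr]
        · rw [Nat.add_one_mul]
        · rwa [St.add_idx_of_ne _ hr, St.add_idx_of_ne _ hb]
    rw [key, pow_succ, Nat.mul_comm]

/-- Increases the register `d` by the value of the polynomial `p` at the register `r`. -/
def addPoly (L : FirstOrder.Language.{u, v}) (K : ℕ) (p : Polynomial ℕ) (d r b : Reg) : Cmd L K :=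
  .seqs ((List.range (p.natDegree + 1)).map fun i => .rep (p.coeff i) (addPow L K d r b i))

theorem eval_addPoly (p : Polynomial ℕ) {d r b : Reg} (hr : r ≠ d) (hb : b ≠ d) {s : St K R}
    (h : s.idx r ≤ s.idx b) :
    (addPoly L K p d r b).eval s = s.add d (p.eval (s.idx r)) := by
  have hrep : ∀ (i t : ℕ) (s : St K R), s.idx r ≤ s.idx b →
      (Cmd.rep t (addPow L K d r b i)).eval s = s.add d (t * s.idx r ^ i) := by
    intro i t s h
    rw [Cmd.eval_rep]
    induction t with
    | zero => simp
    | succ t iht =>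
      rw [Function.iterate_succ_apply', iht, eval_addPow hr hb, St.add_add, St.add_idx_of_ne _ hr]
      · rw [Nat.add_one_mul]
      · rwa [St.add_idx_of_ne _ hr, St.add_idx_of_ne _ hb]
  have key : ∀ (l : List ℕ) (s : St K R), s.idx r ≤ s.idx b →
      (Cmd.seqs (l.map fun i => .rep (p.coeff i) (addPow L K d r b i))).eval s =
        s.add d (l.map fun i => p.coeff i * s.idx r ^ i).sum := by
    intro l
    induction l with
    | nil => intro s _; simp [Cmd.eval_seqs_nil]
    | cons i l ih =>
      intro s h
      rw [List.map_cons, Cmd.eval_seqs_cons, hrep _ _ _ h, ih, St.add_add,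
        St.add_idx_of_ne _ hr, List.map_cons, List.sum_cons]
      rwa [St.add_idx_of_ne _ hr, St.add_idx_of_ne _ hb]
  rw [addPoly, key _ _ h, Polynomial.eval_eq_sum_range]
  rfl

@[simp]
theorem keeps_addReg {d r b r' : Reg} : (addReg L K d r b).Keeps r' ↔ r' ≠ d := by simp [addReg]

@[simp]
theorem keeps_clearReg {d b r' : Reg} : (clearReg L K d b).Keeps r' ↔ r' ≠ d := by simp [clearReg]

@[simp]
theorem keeps_setReg {d r b r' : Reg} : (setReg L K d r b).Keeps r' ↔ r' ≠ d := by simp [setReg]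

theorem keeps_addPow {d r b r' : Reg} (i : ℕ) : (addPow L K d r b i).Keeps r' ↔ r' ≠ d := by
  induction i with
  | zero => simp [addPow]
  | succ i ih => simp [addPow, ih]

theorem keeps_addPoly (p : Polynomial ℕ) {d r b r' : Reg} (h : r' ≠ d) :
    (addPoly L K p d r b).Keeps r' := by
  simp [addPoly, keeps_addPow, h]

@[simp]
theorem loopsOver_addReg {d r b b' : Reg} :
    (addReg L K d r b).LoopsOver b' ↔ b = b' ∧ b' ≠ d ∧ r ≠ d := by simp [addReg]

@[simp]
theorem loopsOver_clearReg {d b b' : Reg} :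
    (clearReg L K d b).LoopsOver b' ↔ b = b' ∧ b' ≠ d := by
  simp [clearReg]; rintro rfl; tauto

@[simp]
theorem loopsOver_setReg {d r b b' : Reg} :
    (setReg L K d r b).LoopsOver b' ↔ b = b' ∧ b' ≠ d ∧ r ≠ d := by
  simp [setReg]; tauto

theorem loopsOver_addPow {d r b : Reg} (hr : r ≠ d) (hb : b ≠ d) (i : ℕ) :
    (addPow L K d r b i).LoopsOver b := by
  induction i with
  | zero => simp [addPow, hb]
  | succ i ih => simp [addPow, ih, keeps_addPow, hr]

theorem loopsOver_addPoly (p : Polynomial ℕ) {d r b : Reg} (hr : r ≠ d) (hb : b ≠ d) :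
    (addPoly L K p d r b).LoopsOver b := by
  simp [addPoly, loopsOver_addPow hr hb]

@[simp]
theorem keepsTape_addReg {d r b : Reg} {a : Fin K} : (addReg L K d r b).KeepsTape a := by
  simp [addReg]

@[simp]
theorem keepsTape_clearReg {d b : Reg} {a : Fin K} : (clearReg L K d b).KeepsTape a := by
  simp [clearReg]

@[simp]
theorem keepsTape_setReg {d r b : Reg} {a : Fin K} : (setReg L K d r b).KeepsTape a := by
  simp [setReg]

theorem keepsTape_addPow {d r b : Reg} {a : Fin K} (i : ℕ) :
    (addPow L K d r b i).KeepsTape a := by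
  induction i with
  | zero => simp [addPow]
  | succ i ih => simp [addPow, ih]

@[simp]
theorem keepsTape_addPoly {p : Polynomial ℕ} {d r b : Reg} {a : Fin K} :
    (addPoly L K p d r b).KeepsTape a := by
  simp [addPoly, keepsTape_addPow]

end Arithmetic

/-! ### Writing the input of a simulated machine. -/

section Output

variable {L : FirstOrder.Language.{u, v}} {R : Type w} [L.Structure R]

/-- Appends the letter on the tape `t` that `p` points to to the input of the machine on the tape
`a`. -/
def push (L : FirstOrder.Language.{u, v}) (a : Fin 6) (b : ℕ) (t : Fin 6) (p : Reg)
    (h : (b, 1) ≠ p) : Cmd L 6 :=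
  .seq (.act (.copy a (b, 1) t p h)) (.inc (b, 1))

/-- The register `(b, 1)` is `I[0]` of the simulated machine, that is, the length of its input and
therefore the address of the next free cell. After every letter the machine is again in an initial
configuration. -/
theorem config_eval_push (B : Bipointed L R) {a t : Fin 6} {b : ℕ} {p : Reg} {h : (b, 1) ≠ p}
    {s : St 6 R} {x : List R} (hs : s.config a b = B.init x) :
    ((push L a b t p h).eval s).config a b = B.init (x ++ [s.mem (t, s.idx p)]) := by
  have h0 : s.idx (b, 0) = 0 := congrArg Config.label hs
  have hi : ∀ j, s.idx (b, j + 1) = if j = 0 then x.length else 0 :=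
    congrFun (congrArg Config.idx hs)
  have hm : ∀ i, s.mem (a, i) = x.getD i B.zero := congrFun (congrArg Config.mem hs)
  refine Config.mk_congr ?_ ?_ ?_
  · simp [push, Cmd.eval_seq, Cmd.eval_act, Act.run, h0]
  · funext j
    have h1 := hi 0
    by_cases hj : j = 0
    · subst hj
      simp [push, Cmd.eval_seq, Cmd.eval_act, Act.run, h1]
    · simp [push, Cmd.eval_seq, Cmd.eval_act, Act.run, hi, hj]
  · funext i
    have h1 : s.idx (b, 1) = x.length := by simpa using hi 0
    simp only [push, Cmd.eval_seq, Cmd.eval_act, Act.run, h1]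
    by_cases e : i = x.length
    · subst e
      simp [List.getD_eq_getElem?_getD]
    · simp only [Function.update_apply, Prod.mk.injEq, e, and_false, if_false, hm,
        List.getD_eq_getElem?_getD]
      rcases Nat.lt_or_ge i x.length with h2 | h2
      · rw [List.getElem?_append_left h2]
      · rw [List.getElem?_eq_none h2, List.getElem?_eq_none (by simp; omega)]

@[simp]
theorem keeps_push {a t : Fin 6} {b : ℕ} {p : Reg} {h : (b, 1) ≠ p} {r : Reg} :
    (push L a b t p h).Keeps r ↔ r ≠ (b, 1) := by
  simp [push]

@[simp]
theorem keepsTape_push {a t t' : Fin 6} {b : ℕ} {p : Reg} {h : (b, 1) ≠ p} :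
    (push L a b t p h).KeepsTape t' ↔ t' ≠ a := by
  simp [push]

@[simp]
theorem loopsOver_push {a t : Fin 6} {b : ℕ} {p : Reg} {h : (b, 1) ≠ p} {r : Reg} :
    (push L a b t p h).LoopsOver r ↔ r ≠ (b, 1) := by
  simp [push]

/-- Appends `I[l]` letters on the tape `t` to the input of the machine on the tape `a`. -/
def copyOut (L : FirstOrder.Language.{u, v}) (a : Fin 6) (b : ℕ) (t : Fin 6) (p l n : Reg)
    (h : (b, 1) ≠ p) : Cmd L 6 :=
  .loop l n (.seq (push L a b t p h) (.inc p))

@[simp]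
theorem keeps_copyOut {a t : Fin 6} {b : ℕ} {p l n : Reg} {h : (b, 1) ≠ p} {r : Reg} :
    (copyOut L a b t p l n h).Keeps r ↔ r ≠ (b, 1) ∧ r ≠ p := by
  simp [copyOut]

@[simp]
theorem keepsTape_copyOut {a t t' : Fin 6} {b : ℕ} {p l n : Reg} {h : (b, 1) ≠ p} :
    (copyOut L a b t p l n h).KeepsTape t' ↔ t' ≠ a := by
  simp [copyOut]

@[simp]
theorem loopsOver_copyOut {a t : Fin 6} {b : ℕ} {p l n : Reg} {h : (b, 1) ≠ p} {r : Reg} :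
    (copyOut L a b t p l n h).LoopsOver r ↔
      n = r ∧ (r ≠ (b, 1) ∧ r ≠ p) ∧ l ≠ (b, 1) ∧ l ≠ p := by
  simp [copyOut]

theorem eval_copyOut (B : Bipointed L R) {a t : Fin 6} {b : ℕ} {p l n : Reg} {h : (b, 1) ≠ p}
    (hb : p.1 ≠ b) (ht : t ≠ a) {s : St 6 R} {x : List R} (hs : s.config a b = B.init x)
    (hl : s.idx l ≤ s.idx n) :
    ((copyOut L a b t p l n h).eval s).config a b =
        B.init (x ++ slice (fun i => s.mem (t, i)) (s.idx p) (s.idx l)) ∧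
      ((copyOut L a b t p l n h).eval s).idx p = s.idx p + s.idx l := by
  rw [copyOut, Cmd.eval_loop, Nat.min_eq_left hl]
  generalize s.idx l = m
  induction m with
  | zero => simp [hs]
  | succ m ih =>
    rw [Function.iterate_succ_apply']
    have hm : ∀ i, ((Cmd.seq (push L a b t p h) (.inc p)).eval^[m] s).mem (t, i) = s.mem (t, i) :=
      fun i => Cmd.iterate_eval_mem_of_keepsTape (by simp [ht]) _ _ _
    generalize (Cmd.seq (push L a b t p h) (.inc p)).eval^[m] s = s' at *
    obtain ⟨h1, h2⟩ := ih
    rw [Cmd.eval_seq, eval_inc]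
    constructor
    · have : ∀ s : St 6 R, (s.add p 1).config a b = s.config a b := fun s =>
        St.config_congr (fun j => St.add_idx_of_ne _ (fun e => hb (by rw [← e])) _) fun _ => rfl
      rw [this, config_eval_push B h1, hm, h2, slice_succ, List.append_assoc]
    · rw [St.add_idx_self, Cmd.eval_idx_of_keeps (by simpa using h.symm), h2, Nat.add_assoc]

/-- The body of the loop of `emit`. -/
def emitStep (B : Bipointed L R) (a : Fin 6) (b : ℕ) (hb : b ≠ 0) (t : Fin 6) (p : Reg)
    (h : (b, 1) ≠ p) : Cmd L 6 :=
  .seqs [push L a b 4 (0, 0) (by simp [hb]), .act (.const (4, 0) B.zeroSym), push L a b t p h,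
    .inc p]

/-- Appends the entry that consists of the flag `c` and of `I[l]` letters on the tape `t` to the
input of the machine on the tape `a`. -/
def emit (B : Bipointed L R) (c : L.Constants) (a : Fin 6) (b : ℕ) (hb : b ≠ 0) (t : Fin 6)
    (p l n : Reg) (h : (b, 1) ≠ p) : Cmd L 6 :=
  .seq (.act (.const (4, 0) c)) (.loop l n (emitStep B a b hb t p h))

@[simp]
theorem keeps_emit {B : Bipointed L R} {c : L.Constants} {a t : Fin 6} {b : ℕ} {hb : b ≠ 0}
    {p l n : Reg} {h : (b, 1) ≠ p} {r : Reg} :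
    (emit B c a b hb t p l n h).Keeps r ↔ r ≠ (b, 1) ∧ r ≠ p := by
  simp [emit, emitStep]

@[simp]
theorem keepsTape_emit {B : Bipointed L R} {c : L.Constants} {a t t' : Fin 6} {b : ℕ}
    {hb : b ≠ 0} {p l n : Reg} {h : (b, 1) ≠ p} :
    (emit B c a b hb t p l n h).KeepsTape t' ↔ t' ≠ 4 ∧ t' ≠ a := by
  simp [emit, emitStep]; tauto

@[simp]
theorem loopsOver_emit {B : Bipointed L R} {c : L.Constants} {a t : Fin 6} {b : ℕ} {hb : b ≠ 0}
    {p l n : Reg} {h : (b, 1) ≠ p} {r : Reg} :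
    (emit B c a b hb t p l n h).LoopsOver r ↔
      n = r ∧ (r ≠ (b, 1) ∧ r ≠ p) ∧ l ≠ (b, 1) ∧ l ≠ p := by
  simp [emit, emitStep]

theorem entry_append_singleton (B : Bipointed L R) (f y : R) (w : List R) :
    B.entry f (w ++ [y]) = B.entry f w ++ [if w = [] then f else B.zero, y] := by
  cases w <;> simp [Bipointed.entry]

/-- The cell `(4, 0)` contains the flag to be written next. It is `c` before the first letter and
`0` from then on, so an empty word leaves no trace of `c`, as the encoding demands. -/
theorem eval_emit (B : Bipointed L R) {c : L.Constants} {a t : Fin 6} {b : ℕ} {hb : b ≠ 0}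
    {p l n : Reg} {h : (b, 1) ≠ p} (hp : p.1 ≠ b) (hp0 : p ≠ (0, 0)) (ht : t ≠ a) (ht4 : t ≠ 4)
    (ha4 : a ≠ 4) {s : St 6 R} {x : List R} (hs : s.config a b = B.init x)
    (hl : s.idx l ≤ s.idx n) (h0 : s.idx (0, 0) = 0) :
    ((emit B c a b hb t p l n h).eval s).config a b =
        B.init (x ++ B.entry (c : R) (slice (fun i => s.mem (t, i)) (s.idx p) (s.idx l))) ∧
      ((emit B c a b hb t p l n h).eval s).idx p = s.idx p + s.idx l := by
  rw [emit, Cmd.eval_seq, Cmd.eval_loop]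
  have k1 : ∀ r, ((Cmd.act (.const (4, 0) c) : Cmd L 6).eval s).idx r = s.idx r := fun r => rfl
  have k2 : ∀ i (t : Fin 6), t ≠ 4 → ((Cmd.act (.const (4, 0) c) : Cmd L 6).eval s).mem (t, i) =
    s.mem (t, i) := fun i t ht => Cmd.eval_mem_of_keepsTape (by simp [ht]) _ _
  have k3 : ((Cmd.act (.const (4, 0) c) : Cmd L 6).eval s).mem (4, 0) = (c : R) := by
    simp [Cmd.eval_act, Act.run]
  have k4 := (St.config_congr (fun j => k1 (b, j)) (fun i => k2 i a ha4)).trans hs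
  rw [k1, k1, Nat.min_eq_left hl]
  have k5 : slice (fun i => s.mem (t, i)) (s.idx p) (s.idx l) =
    slice (fun i => ((Cmd.act (.const (4, 0) c) : Cmd L 6).eval s).mem (t, i)) (s.idx p)
      (s.idx l) := slice_congr fun i _ => (k2 _ t ht4).symm
  rw [k5]
  rw [← k1] at h0
  rw [← k1 p]
  generalize s.idx l = m
  generalize (Cmd.act (.const (4, 0) c) : Cmd L 6).eval s = s₁ at *
  clear k1 k2 k5 hs hl
  have key : (((emitStep B a b hb t p h).eval^[m] s₁).config a b =
        B.init (x ++ B.entry (c : R) (slice (fun i => s₁.mem (t, i)) (s₁.idx p) m)) ∧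
      ((emitStep B a b hb t p h).eval^[m] s₁).idx p = s₁.idx p + m) ∧
      ((emitStep B a b hb t p h).eval^[m] s₁).mem (4, 0) = if m = 0 then (c : R) else B.zero := by
    induction m with
    | zero => simp [k4, k3, Bipointed.entry]
    | succ m ih =>
      rw [Function.iterate_succ_apply']
      have hm : ∀ i, ((emitStep B a b hb t p h).eval^[m] s₁).mem (t, i) = s₁.mem (t, i) :=
        fun i => Cmd.iterate_eval_mem_of_keepsTape (by simp [emitStep, ht, ht4]) _ _ _
      have h0' : ((emitStep B a b hb t p h).eval^[m] s₁).idx (0, 0) = 0 := by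
        rw [Cmd.iterate_eval_idx_of_keeps (by simp [emitStep, hb.symm, hp0.symm]), h0]
      generalize (emitStep B a b hb t p h).eval^[m] s₁ = s' at *
      obtain ⟨⟨h1, h2⟩, h3⟩ := ih
      simp only [emitStep, Cmd.eval_seqs_cons, Cmd.eval_seqs_nil]
      have c1 := config_eval_push (t := 4) (h := show (b, 1) ≠ (0, 0) by simp [hb]) B h1
      rw [h0', h3] at c1
      have f1 : ∀ i, ((push L a b 4 (0, 0) (by simp [hb])).eval s').mem (t, i) = s'.mem (t, i) :=
        fun i => Cmd.eval_mem_of_keepsTape (by simp [ht]) _ _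
      have f2 : ((push L a b 4 (0, 0) (by simp [hb])).eval s').idx p = s'.idx p :=
        Cmd.eval_idx_of_keeps (by simpa using h.symm) _
      generalize (push L a b 4 (0, 0) (by simp [hb])).eval s' = s₂ at *
      have c2 : ((Cmd.act (.const (4, 0) B.zeroSym) : Cmd L 6).eval s₂).config a b =
          s₂.config a b := St.config_congr (fun _ => rfl) fun i =>
        Cmd.eval_mem_of_keepsTape (by simp [ha4]) _ _
      rw [c1] at c2
      have f3 : ∀ i, ((Cmd.act (.const (4, 0) B.zeroSym) : Cmd L 6).eval s₂).mem (t, i) =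
        s₂.mem (t, i) := fun i => Cmd.eval_mem_of_keepsTape (by simp [ht4]) _ _
      have f4 : ((Cmd.act (.const (4, 0) B.zeroSym) : Cmd L 6).eval s₂).idx p = s₂.idx p := rfl
      have f5 : ((Cmd.act (.const (4, 0) B.zeroSym) : Cmd L 6).eval s₂).mem (4, 0) = B.zero := by
        simp [Cmd.eval_act, Act.run, Bipointed.zero]
      generalize (Cmd.act (.const (4, 0) B.zeroSym) : Cmd L 6).eval s₂ = s₃ at *
      have c3 := config_eval_push (t := t) (p := p) (h := h) B c2
      have f6 : ((push L a b t p h).eval s₃).idx p = s₃.idx p :=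
        Cmd.eval_idx_of_keeps (by simpa using h.symm) _
      have f7 : ((push L a b t p h).eval s₃).mem (4, 0) = s₃.mem (4, 0) :=
        Cmd.eval_mem_of_keepsTape (by simp [ha4.symm]) _ _
      generalize (push L a b t p h).eval s₃ = s₄ at *
      have c4 : (s₄.add p 1).config a b = s₄.config a b :=
        St.config_congr (fun j => St.add_idx_of_ne _ (fun e => hp (by rw [← e])) _) fun _ => rfl
      rw [eval_inc]
      refine ⟨⟨?_, ?_⟩, ?_⟩
      · rw [c4, c3, f3, f1, hm, f4, f2, h2, slice_succ, entry_append_singleton]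
        have : slice (fun i => s₁.mem (t, i)) (s₁.idx p) m = [] ↔ m = 0 := by
          rw [← List.length_eq_zero_iff, length_slice]
        simp [this]
      · rw [St.add_idx_self, f6, f4, f2, h2, Nat.add_assoc]
      · rw [St.add_mem, f7, f5]
        simp
  exact key.1

end Output

/-! ### Building blocks of the simulating programs. -/

section Blocks

variable {L : FirstOrder.Language.{u, v}} {R : Type w} [L.Structure R]

/-- The body of the loop of `emitAll`. -/
def emitNext (B : Bipointed L R) (a : Fin 6) (b : ℕ) (hb : b ≠ 0) : Cmd L 6 := .seqs
  [setReg L 6 (0, 3) (0, 4) (0, 2),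
   emit B B.oneSym a b hb 1 (0, 3) (0, 6) (0, 2) (by simp [hb]),
   addReg L 6 (0, 4) (0, 5) (0, 2)]

/-- Appends `k` entries to the input of the machine on the tape `a`. They have the length `I[6]`
and come from the tape `1`, where they start at intervals of `I[5]`, the first one at `I[4]`. -/
def emitAll (B : Bipointed L R) (a : Fin 6) (b : ℕ) (hb : b ≠ 0) (k : ℕ) : Cmd L 6 :=
  .rep k (emitNext B a b hb)

theorem keeps_emitAll {B : Bipointed L R} {a : Fin 6} {b : ℕ} {hb : b ≠ 0} {k : ℕ} {r : Reg}
    (h : r ≠ (b, 1)) (h3 : r ≠ (0, 3)) (h4 : r ≠ (0, 4)) : (emitAll B a b hb k).Keeps r := by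
  simp [emitAll, emitNext, h, h3, h4]

theorem keepsTape_emitAll {B : Bipointed L R} {a t : Fin 6} {b : ℕ} {hb : b ≠ 0} {k : ℕ}
    (h : t ≠ a) (h4 : t ≠ 4) : (emitAll B a b hb k).KeepsTape t := by
  simp [emitAll, emitNext, h, h4]

theorem loopsOver_emitAll {B : Bipointed L R} {a : Fin 6} {b : ℕ} {hb : b ≠ 0} {k : ℕ} :
    (emitAll B a b hb k).LoopsOver (0, 2) := by
  simp [emitAll, emitNext, hb.symm]

theorem eval_emitAll (B : Bipointed L R) {a : Fin 6} {b : ℕ} {hb : b ≠ 0} (ha1 : a ≠ 1)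
    (ha4 : a ≠ 4) {s : St 6 R} {x : List R} (hs : s.config a b = B.init x) {k n p d l : ℕ}
    (h0 : s.idx (0, 0) = 0) (hn : s.idx (0, 2) = n) (h3 : s.idx (0, 3) ≤ n)
    (h4 : s.idx (0, 4) = p) (h5 : s.idx (0, 5) = d) (h6 : s.idx (0, 6) = l)
    (hle : p + k * d + l ≤ n) (hd : d ≤ n) :
    ((emitAll B a b hb k).eval s).config a b = B.init (x ++ (List.range k).flatMap fun i =>
      B.entry B.one (slice (fun j => s.mem (1, j)) (p + i * d) l)) ∧
    ((emitAll B a b hb k).eval s).idx (0, 3) ≤ n ∧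
    ((emitAll B a b hb k).eval s).idx (0, 4) = p + k * d := by
  have hb' := hb.symm
  rw [emitAll, Cmd.eval_rep]
  induction k with
  | zero => simp [hs, h3, h4]
  | succ k ih =>
    have e1 : (k + 1) * d = k * d + d := by ring
    obtain ⟨i1, i2, i3⟩ := ih (by omega)
    rw [Function.iterate_succ_apply']
    have f0 : ((emitNext B a b hb).eval^[k] s).idx (0, 0) = 0 := by
      rw [Cmd.iterate_eval_idx_of_keeps (by simp [emitNext, hb']), h0]
    have f2 : ((emitNext B a b hb).eval^[k] s).idx (0, 2) = n := by
      rw [Cmd.iterate_eval_idx_of_keeps (by simp [emitNext, hb']), hn]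
    have f5 : ((emitNext B a b hb).eval^[k] s).idx (0, 5) = d := by
      rw [Cmd.iterate_eval_idx_of_keeps (by simp [emitNext, hb']), h5]
    have f6 : ((emitNext B a b hb).eval^[k] s).idx (0, 6) = l := by
      rw [Cmd.iterate_eval_idx_of_keeps (by simp [emitNext, hb']), h6]
    have fm : ∀ i, ((emitNext B a b hb).eval^[k] s).mem (1, i) = s.mem (1, i) := fun i =>
      Cmd.iterate_eval_mem_of_keepsTape (by simp [emitNext, ha1.symm]) _ _ _
    generalize (emitNext B a b hb).eval^[k] s = s₁ at *
    simp only [emitNext, Cmd.eval_seqs_cons, Cmd.eval_seqs_nil]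
    rw [eval_setReg (by simp) (by simp) (by rw [f2]; exact i2) (by rw [i3, f2]; omega), i3]
    set s₂ : St 6 R := ⟨Function.update s₁.idx (0, 3) (p + k * d), s₁.mem⟩ with hs₂
    have c2 : s₂.config a b = s₁.config a b :=
      St.config_congr (fun j => by simp [hs₂, hb]) fun i => rfl
    rw [i1] at c2
    obtain ⟨j1, j2⟩ := eval_emit B (c := B.oneSym) (hb := hb) (p := (0, 3)) (l := (0, 6))
      (n := (0, 2)) (h := by simp [hb]) (t := 1) hb' (by simp) ha1.symm (by simp) ha4 c2
      (by simp [hs₂, f2, f6]; omega) (by simp [hs₂, f0])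
    have g2 := Cmd.eval_idx_of_keeps (c := emit B B.oneSym a b hb 1 (0, 3) (0, 6) (0, 2)
      (by simp [hb])) (r := (0, 2)) (by simp [hb']) s₂
    have g4 := Cmd.eval_idx_of_keeps (c := emit B B.oneSym a b hb 1 (0, 3) (0, 6) (0, 2)
      (by simp [hb])) (r := (0, 4)) (by simp [hb']) s₂
    have g5 := Cmd.eval_idx_of_keeps (c := emit B B.oneSym a b hb 1 (0, 3) (0, 6) (0, 2)
      (by simp [hb])) (r := (0, 5)) (by simp [hb']) s₂
    generalize (emit B B.oneSym a b hb 1 (0, 3) (0, 6) (0, 2) (by simp [hb])).eval s₂ = s₃ at *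
    simp only [hs₂, ne_eq, Prod.mk.injEq, Nat.reduceEqDiff, and_false, not_false_eq_true,
      Function.update_of_ne, Function.update_self, f2, f5, f6, i3] at g2 g4 g5 j1 j2
    rw [eval_addReg (by rw [g2, g5]; exact hd), g5]
    refine ⟨?_, ?_, ?_⟩
    · rw [St.config_congr (s' := s₃) (fun j => St.add_idx_of_ne _ (by simp [hb]) _) fun _ => rfl,
        j1, List.range_succ, List.flatMap_append, List.append_assoc]
      congr 4
      simp only [List.flatMap_cons, List.flatMap_nil, List.append_nil]
      congr 1
      exact slice_congr fun i _ => fm _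
    · rw [St.add_idx_of_ne _ (by simp), j2]; omega
    · rw [St.add_idx_self, g4, e1, Nat.add_assoc]

/-- Clears the tape `a` and the bank `b`. -/
def clearMachine (B : Bipointed L R) (a : Fin 6) (b J : ℕ) : Cmd L 6 := .seqs
  [.seqs ((List.range (J + 1)).map fun j => clearReg L 6 (b, j) (0, 2)),
   clearReg L 6 (0, 3) (0, 2), .act (.const (4, 0) B.zeroSym),
   .loop (0, 2) (0, 2) (.seq (.act (.copy a (0, 3) 4 (0, 0) (by simp))) (.inc (0, 3))),
   clearReg L 6 (0, 3) (0, 2)]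

theorem keeps_clearMachine {B : Bipointed L R} {a : Fin 6} {b J : ℕ} {r : Reg} (h : r.1 ≠ b)
    (h3 : r ≠ (0, 3)) : (clearMachine B a b J).Keeps r := by
  have : ∀ j, r ≠ (b, j) := fun j e => h (by rw [e])
  simp [clearMachine, this, h3]

theorem keepsTape_clearMachine {B : Bipointed L R} {a t : Fin 6} {b J : ℕ} (h : t ≠ a)
    (h4 : t ≠ 4) : (clearMachine B a b J).KeepsTape t := by
  simp [clearMachine, h, h4]

theorem loopsOver_clearMachine {B : Bipointed L R} {a : Fin 6} {b J : ℕ} (hb : b ≠ 0) :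
    (clearMachine B a b J).LoopsOver (0, 2) := by
  simp [clearMachine, hb.symm]

theorem eval_clearRegs {b : ℕ} (hb : b ≠ 0) (J : ℕ) {s : St 6 R}
    (h : ∀ j < J, s.idx (b, j) ≤ s.idx (0, 2)) :
    (∀ j < J, ((Cmd.seqs ((List.range J).map fun j => clearReg L 6 (b, j) (0, 2))).eval s).idx
      (b, j) = 0) ∧
    (∀ r : Reg, (∀ j < J, r ≠ (b, j)) →
      ((Cmd.seqs ((List.range J).map fun j => clearReg L 6 (b, j) (0, 2))).eval s).idx r =
        s.idx r) ∧
    ((Cmd.seqs ((List.range J).map fun j => clearReg L 6 (b, j) (0, 2))).eval s).mem = s.mem := by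
  have append : ∀ (l : List (Cmd L 6)) (c : Cmd L 6) (s : St 6 R),
      (Cmd.seqs (l ++ [c])).eval s = c.eval ((Cmd.seqs l).eval s) := by
    intro l c
    induction l with
    | nil => intro s; rfl
    | cons d l ih => intro s; exact ih _
  induction J with
  | zero => simp [Cmd.eval_seqs_nil]
  | succ J ih =>
    obtain ⟨i1, i2, i3⟩ := ih fun j hj => h j (by omega)
    rw [List.range_succ, List.map_append, List.map_singleton, append]
    generalize (Cmd.seqs ((List.range J).map fun j => clearReg L 6 (b, j) (0, 2))).eval s = s' at *
    have e2 := i2 (0, 2) (by simp [hb.symm])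
    have eJ := i2 (b, J) (by simp; omega)
    rw [eval_clearReg (by rw [e2, eJ]; exact h J (by omega))]
    refine ⟨fun j hj => ?_, fun r hr => ?_, i3⟩
    · by_cases e : j = J
      · subst e; simp
      · simp only [ne_eq, Prod.mk.injEq, e, and_false, not_false_eq_true, Function.update_of_ne]
        exact i1 j (by omega)
    · simp only
      rw [Function.update_of_ne (hr J (by omega)), i2 r fun j hj => hr j (by omega)]

/-- By `Within`, only the label, the first `J` index registers and the cells up to the number `n`
can be non-blank. Since `(0, 2)` exceeds `n`, a loop controlled by it reaches all these cells. -/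
theorem eval_clearMachine (B : Bipointed L R) {a : Fin 6} {b J n : ℕ} (hb : b ≠ 0) (ha4 : a ≠ 4)
    {s : St 6 R} (h0 : s.idx (0, 0) = 0) (hw : (s.config a b).Within J B.zero n)
    (hn : n < s.idx (0, 2)) (h3 : s.idx (0, 3) ≤ s.idx (0, 2)) :
    ((clearMachine B a b J).eval s).config a b = B.init [] ∧
      ((clearMachine B a b J).eval s).idx (0, 3) = 0 := by
  obtain ⟨w1, w2, w3, w4⟩ := hw
  simp only [St.config] at w1 w2 w3 w4
  simp only [clearMachine, Cmd.eval_seqs_cons, Cmd.eval_seqs_nil]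
  have hle : ∀ j, s.idx (b, j) ≤ n := by
    rintro (_ | j)
    exacts [w1, w2 j]
  obtain ⟨i1, i2, i3⟩ := eval_clearRegs (L := L) hb (J + 1) (s := s)
    fun j _ => (hle j).trans hn.le
  generalize (Cmd.seqs ((List.range (J + 1)).map fun j => clearReg L 6 (b, j) (0, 2))).eval s =
    s₁ at *
  have hb' := hb.symm
  have z1 : ∀ j, s₁.idx (b, j) = 0 := by
    intro j
    by_cases hj : j < J + 1
    · exact i1 j hj
    · obtain ⟨j, rfl⟩ : ∃ j', j = j' + 1 := ⟨j - 1, by omega⟩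
      rw [i2 _ (by simp; omega), w3 j (by omega)]
  have e0 : s₁.idx (0, 0) = 0 := by rw [i2 _ (by simp [hb']), h0]
  have e2 : s₁.idx (0, 2) = s.idx (0, 2) := i2 _ (by simp [hb'])
  have e3 : s₁.idx (0, 3) = s.idx (0, 3) := i2 _ (by simp [hb'])
  rw [eval_clearReg (s := s₁) (by rw [e2, e3]; exact h3)]
  simp only [Cmd.eval_act, Act.run]
  set s₂ : St 6 R := ⟨Function.update s₁.idx (0, 3) 0,
    Function.update s₁.mem (4, 0) (B.zeroSym : R)⟩ with hs₂
  have key : ∀ t, ((Cmd.seq (.act (.copy a (0, 3) 4 (0, 0) (by simp))) (.inc (0, 3)) :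
      Cmd L 6).eval^[t] s₂).idx = Function.update s₂.idx (0, 3) t ∧
      ((Cmd.seq (.act (.copy a (0, 3) 4 (0, 0) (by simp))) (.inc (0, 3)) :
      Cmd L 6).eval^[t] s₂).mem (4, 0) = B.zero ∧
      ∀ i, ((Cmd.seq (.act (.copy a (0, 3) 4 (0, 0) (by simp))) (.inc (0, 3)) :
      Cmd L 6).eval^[t] s₂).mem (a, i) = if i < t then B.zero else s₂.mem (a, i) := by
    intro t
    induction t with
    | zero =>
      refine ⟨?_, by simp [hs₂, Bipointed.zero], by simp⟩
      simp only [Function.iterate_zero, id_eq]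
      rw [Function.update_eq_self_iff.2]
      simp [hs₂]
    | succ t ih =>
      obtain ⟨t1, t2, t3⟩ := ih
      rw [Function.iterate_succ_apply']
      generalize (Cmd.seq (.act (.copy a (0, 3) 4 (0, 0) (by simp))) (.inc (0, 3)) :
        Cmd L 6).eval^[t] s₂ = s₃ at *
      have e0' : s₂.idx (0, 0) = 0 := by simp [hs₂, e0]
      simp only [Cmd.eval_seq, Cmd.eval_act, Act.run, t1]
      refine ⟨by simp, ?_, fun i => ?_⟩
      · simp [e0', ha4.symm, t2]
      · simp only [Function.update_self, ne_eq, Prod.mk.injEq, OfNat.zero_ne_ofNat, and_false,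
          not_false_eq_true, Function.update_of_ne, e0', t2, Function.update_apply, t3, true_and]
        split_ifs <;> first | rfl | omega
  rw [Cmd.eval_loop, min_self]
  obtain ⟨k1, -, k3⟩ := key (s₂.idx (0, 2))
  generalize (Cmd.seq (.act (.copy a (0, 3) 4 (0, 0) (by simp))) (.inc (0, 3)) :
    Cmd L 6).eval^[s₂.idx (0, 2)] s₂ = s₃ at *
  have e2' : s₂.idx (0, 2) = s.idx (0, 2) := by simp [hs₂, e2]
  rw [eval_clearReg (s := s₃) (by rw [k1]; simp)]
  refine ⟨Config.mk_congr ?_ ?_ ?_, by simp⟩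
  · simp [hb, k1, hs₂, z1]
  · funext j
    simp [hb, k1, hs₂, z1]
  · funext i
    simp only [k3, e2', List.getD_nil]
    split_ifs with hi
    · rfl
    · simp only [hs₂, ne_eq, Prod.mk.injEq, ha4, false_and, not_false_eq_true,
        Function.update_of_ne, i3]
      exact w4 i (by omega)

/-- Does `c` if the machine on the tape `a` has stopped with the output `1`, and `d` otherwise. The
register `(0, 15)` has to contain `1`. -/
def testOne (B : Bipointed L R) (a : Fin 6) (b : ℕ) (c d : Cmd L 6) : Cmd L 6 :=
  .seq (.act (.const (5, 1) B.oneSym))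
    (.ite (.idxEq (b, 1) (0, 15)) (.ite (.eq (a, 0) (5, 1)) c d) d)

open Classical in
theorem eval_testOne (B : Bipointed L R) {a : Fin 6} {b : ℕ} {c d : Cmd L 6} (ha : a ≠ 5)
    {s : St 6 R} (h : s.idx (0, 15) = 1) {x : Config R} (hx : s.config a b = x) :
    (testOne B a b c d).eval s = if x.idx 0 = 1 ∧ x.mem 0 = B.one then
      c.eval ⟨s.idx, Function.update s.mem (5, 1) B.one⟩ else
      d.eval ⟨s.idx, Function.update s.mem (5, 1) B.one⟩ := by
  subst hx
  simp only [testOne, Cmd.eval_seq, Cmd.eval_act, Act.run, Cmd.eval_ite, Test.Holds, h, St.config,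
    Function.update_self, ne_eq, Prod.mk.injEq, ha, false_and, not_false_eq_true,
    Function.update_of_ne]
  change (if s.idx (b, 1) = 1 then if s.mem (a, 0) = B.one then _ else _ else _) = _
  by_cases h1 : s.idx (b, 1) = 1
  · by_cases h2 : s.mem (a, 0) = B.one
    · simp [h1, h2, Bipointed.one]
    · have h2' : ¬ s.mem (a, 0) = (B.oneSym : R) := h2
      simp [h1, h2', Bipointed.one]
  · simp [h1, Bipointed.one]

/-- Copies the letters of the input to the tape `1`, without the flags. -/
def unflag (L : FirstOrder.Language.{u, v}) : Cmd L 6 :=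
  .loop (0, 1) (0, 1) (.seqs [.inc (0, 8), .act (.copy 1 (0, 7) 0 (0, 8) (by simp)), .inc (0, 8),
    .inc (0, 7)])

/-- The loop makes as many rounds as the input has symbols, about twice the number of its letters.
The superfluous rounds read blanks behind the input and write blanks. -/
theorem eval_unflag (B : Bipointed L R) (x : List R) (i : ℕ) :
    ((unflag L).eval (B.start 6 x)).mem (1, i) = x.getD (2 * i + 1) B.zero := by
  rw [unflag, Cmd.eval_loop, min_self]
  generalize hc : (Cmd.seqs [.inc (0, 8), .act (.copy 1 (0, 7) 0 (0, 8) (by simp)), .inc (0, 8),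
    .inc (0, 7)] : Cmd L 6) = c
  have key : ∀ t, (c.eval^[t] (B.start 6 x)).idx (0, 8) = 2 * t ∧
      (c.eval^[t] (B.start 6 x)).idx (0, 7) = t ∧
      ∀ i, (c.eval^[t] (B.start 6 x)).mem (1, i) =
        if i < t then x.getD (2 * i + 1) B.zero else B.zero := by
    intro t
    induction t with
    | zero => simp [Bipointed.start]
    | succ t ih =>
      obtain ⟨t1, t2, t3⟩ := ih
      have t0 : ∀ i, (c.eval^[t] (B.start 6 x)).mem (0, i) = x.getD i B.zero := by
        intro i
        rw [Cmd.iterate_eval_mem_of_keepsTape (by simp [← hc])]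
        simp [Bipointed.start]
      rw [Function.iterate_succ_apply']
      generalize c.eval^[t] (B.start 6 x) = s at *
      simp only [← hc, Cmd.eval_seqs_cons, Cmd.eval_seqs_nil, Cmd.eval_act, Act.run]
      simp only [ne_eq, Prod.mk.injEq, Nat.reduceEqDiff, and_false,
        not_false_eq_true, Function.update_of_ne, Function.update_self, t1, t2, t0]
      refine ⟨by ring, trivial, fun i => ?_⟩
      simp only [Function.update_apply, Prod.mk.injEq, true_and, t3]
      by_cases e : i = t
      · subst e; simp
      · rw [if_neg e]
        have : i < t ↔ i < t + 1 := by omega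
        simp only [this]
  obtain ⟨-, -, k⟩ := key ((B.start 6 x).idx (0, 1))
  rw [k]
  split_ifs with h
  · rfl
  · rw [List.getD_eq_default]
    simp only [Bipointed.start, Function.update_self] at h
    omega

/-- Counts, in the register `c`, how many of the cells with the numbers `0, 2, 4, …` on the tape `t`
precede the first one that contains `1` or has the number `I[e]`. -/
def scan (B : Bipointed L R) (t : Fin 6) (p c e n : Reg) (hp : (0, 0) ≠ p) : Cmd L 6 :=
  .loop n n (.ite (.idxEq p e) .skip (.seqs [.act (.copy 5 (0, 0) t p hp),
    .act (.const (5, 1) B.oneSym),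
    .ite (.eq (5, 0) (5, 1)) .skip (.seqs [.inc p, .inc p, .inc c])]))

open Classical in
-- At the stopping position the body changes neither `p` nor `c`, so the number of rounds only has
-- to be large enough. After `j` rounds the count is `min j m`.
theorem eval_scan (B : Bipointed L R) {t : Fin 6} (ht : t ≠ 5) {p c e n : Reg}
    {hp : (0, 0) ≠ p} (hc : (0, 0) ≠ c) (hpc : p ≠ c) (hpe : e ≠ p) (hce : e ≠ c) {s : St 6 R}
    (h0 : s.idx (0, 0) = 0) (h1 : s.idx p = 0) (h2 : s.idx c = 0) {m : ℕ} (hm : m ≤ s.idx n)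
    (h3 : ∀ i < m, s.mem (t, 2 * i) ≠ B.one ∧ 2 * i ≠ s.idx e)
    (h4 : 2 * m = s.idx e ∨ s.mem (t, 2 * m) = B.one) :
    ((scan B t p c e n hp).eval s).idx c = m := by
  rw [scan, Cmd.eval_loop, min_self]
  generalize hd : (Cmd.ite (.idxEq p e) .skip (.seqs [.act (.copy 5 (0, 0) t p hp),
    .act (.const (5, 1) B.oneSym),
    .ite (.eq (5, 0) (5, 1)) .skip (.seqs [.inc p, .inc p, .inc c])]) : Cmd L 6) = d
  have key : ∀ j, (d.eval^[j] s).idx p = 2 * min j m ∧ (d.eval^[j] s).idx c = min j m := by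
    intro j
    induction j with
    | zero => simp [h1, h2]
    | succ j ih =>
      obtain ⟨i1, i2⟩ := ih
      have i3 : (d.eval^[j] s).idx e = s.idx e :=
        Cmd.iterate_eval_idx_of_keeps (by simp [← hd, hpe, hce]) _ _
      have i0 : (d.eval^[j] s).idx (0, 0) = 0 := by
        rw [Cmd.iterate_eval_idx_of_keeps (by simp [← hd, hp, hc]), h0]
      have im : ∀ i, (d.eval^[j] s).mem (t, i) = s.mem (t, i) := fun i =>
        Cmd.iterate_eval_mem_of_keepsTape (by simp [← hd, ht]) _ _ _
      rw [Function.iterate_succ_apply']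
      generalize d.eval^[j] s = s' at *
      have hval : d.eval s' = if 2 * min j m = s.idx e then s' else
          if s.mem (t, 2 * min j m) = B.one then
            ⟨s'.idx, Function.update (Function.update s'.mem (5, 0) (s.mem (t, 2 * min j m)))
              (5, 1) B.one⟩ else
            ⟨Function.update (Function.update s'.idx p (2 * min j m + 1 + 1)) c (min j m + 1),
            Function.update (Function.update s'.mem (5, 0) (s.mem (t, 2 * min j m)))
              (5, 1) B.one⟩ := by
        subst hd
        simp only [Cmd.eval_ite, Test.Holds, i1, i3, Cmd.eval_seqs_cons, Cmd.eval_seqs_nil,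
          Cmd.eval_act, Act.run, Cmd.eval_skip, i0, im]
        by_cases c1 : 2 * min j m = s.idx e
        · simp [c1]
        · by_cases c2 : s.mem (t, 2 * min j m) = B.one
          · simp [c1, c2, Bipointed.one]
          · have c3 : ¬ s.mem (t, 2 * min j m) = (B.oneSym : R) := c2
            simp [c1, c3, Bipointed.one, hpc.symm, i2]
      rw [hval]
      rcases Nat.lt_or_ge j m with hj | hj
      · have e1 : min j m = j := by omega
        have e2 : min (j + 1) m = j + 1 := by omega
        rw [e1, e2, if_neg (h3 j hj).2, if_neg (h3 j hj).1]
        simp [hpc]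
        ring
      · have e1 : min j m = m := by omega
        have e2 : min (j + 1) m = m := by omega
        rw [e1] at i1 i2
        rw [e1, e2]
        rcases h4 with h4 | h4
        · rw [if_pos h4]; exact ⟨i1, i2⟩
        · split_ifs
          exacts [⟨i1, i2⟩, ⟨i1, i2⟩]
  rw [(key _).2]
  omega

end Blocks

/-! ### The encoding of tuples. -/

section Tuples

variable {L : FirstOrder.Language.{u, v}} {R : Type w} [L.Structure R]

/-- The letters of an entry of a tuple, with their flags. -/
def flags (f z : R) : List R → List (R × R)
  | [] => []
  | y :: w => (f, y) :: w.map fun y => (z, y)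

theorem map_snd_flags (f z : R) (w : List R) : (flags f z w).map Prod.snd = w := by
  cases w <;> simp [flags, Function.comp_def]

theorem length_flags (f z : R) (w : List R) : (flags f z w).length = w.length := by
  cases w <;> simp [flags]

theorem entry_eq_flatMap (B : Bipointed L R) (f : R) (w : List R) :
    B.entry f w = (flags f B.zero w).flatMap fun p => [p.1, p.2] := by
  cases w <;> simp [Bipointed.entry, flags, List.flatMap_map]

/-- As a list of pairs, the encoding splits into the flags, at the even positions, and the letters,
at the odd positions. -/
theorem tuple_eq_flatMap (B : Bipointed L R) (x : List R) {ws : List (List R)} (h : ws ≠ []) :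
    B.tuple x ws = (flags B.zero B.zero x ++ ws.flatMap (flags B.one B.zero)).flatMap
      fun p => [p.1, p.2] := by
  cases ws with
  | nil => exact absurd rfl h
  | cons w ws =>
    simp only [Bipointed.tuple, List.flatMap_append, List.flatMap_assoc, entry_eq_flatMap,
      funext (entry_eq_flatMap B B.one)]

theorem getD_flatMap_pair (l : List (R × R)) (z : R) (i : ℕ) :
    (l.flatMap fun p => [p.1, p.2]).getD (2 * i) z = (l.map Prod.fst).getD i z ∧
    (l.flatMap fun p => [p.1, p.2]).getD (2 * i + 1) z = (l.map Prod.snd).getD i z := by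
  induction l generalizing i with
  | nil => simp
  | cons p l ih =>
    cases i with
    | zero => simp
    | succ i =>
      have := ih i
      simpa [Nat.mul_add] using this

theorem length_flatMap_pair (l : List (R × R)) :
    (l.flatMap fun p => [p.1, p.2]).length = 2 * l.length := by
  induction l with
  | nil => rfl
  | cons p l ih => simp [ih]; ring

theorem length_tuple (B : Bipointed L R) (x : List R) {ws : List (List R)} (h : ws ≠ []) :
    (B.tuple x ws).length = 2 * (x.length + ws.flatten.length) := by
  rw [tuple_eq_flatMap B x h, length_flatMap_pair, List.length_append, length_flags]
  congr 2
  simp [List.length_flatMap, List.length_flatten, length_flags]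

theorem tuple_getD_letter (B : Bipointed L R) (x : List R) {ws : List (List R)} (h : ws ≠ [])
    (i : ℕ) : (B.tuple x ws).getD (2 * i + 1) B.zero = (x ++ ws.flatten).getD i B.zero := by
  rw [tuple_eq_flatMap B x h, (getD_flatMap_pair _ _ _).2, List.map_append, map_snd_flags,
    List.map_flatMap]
  simp only [map_snd_flags]
  simp [List.flatMap_def]

theorem tuple_getD_flag (B : Bipointed L R) (x : List R) {ws : List (List R)} (h : ws ≠ [])
    {i : ℕ} (hi : i < x.length) : (B.tuple x ws).getD (2 * i) B.zero = B.zero := by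
  rw [tuple_eq_flatMap B x h, (getD_flatMap_pair _ _ _).1, List.map_append]
  rw [List.getD_append _ _ _ _ (by simpa [length_flags] using hi)]
  cases x with
  | nil => simp at hi
  | cons y x =>
    cases i
    · simp [flags]
    · simp [flags, Function.comp_def, List.getElem?_replicate]
      split_ifs <;> rfl

/-- This is how the length of the first component is recovered. If all the further components are
empty, no flag is `1`, but then the encoding ends where the first component does. -/
theorem tuple_getD_first_flag (B : Bipointed L R) (x : List R) {ws : List (List R)} (h : ws ≠ []) :
    2 * x.length = (B.tuple x ws).length ∨
      (B.tuple x ws).getD (2 * x.length) B.zero = B.one := by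
  rw [length_tuple B x h, tuple_eq_flatMap B x h, (getD_flatMap_pair _ _ _).1, List.map_append]
  rw [List.getD_append_right _ _ _ _ (by simp [length_flags])]
  simp only [List.length_map, length_flags, Nat.sub_self]
  clear h
  induction ws with
  | nil => simp
  | cons w ws ih =>
    cases w with
    | nil => simpa [flags] using ih
    | cons y w => simp [flags]

theorem flatten_getD {P : ℕ} {ws : List (List R)} (h : ∀ w ∈ ws, w.length = P) (z : R) {i j : ℕ}
    (hi : i < ws.length) (hj : j < P) :
    ws.flatten.getD (i * P + j) z = (ws.getD i []).getD j z := by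
  induction ws generalizing i with
  | nil => simp at hi
  | cons w ws ih =>
    have hw := h w (by simp)
    rw [List.flatten_cons]
    cases i with
    | zero =>
      rw [List.getD_append _ _ _ _ (by omega)]
      simp
    | succ i =>
      have e : (i + 1) * P + j = P + (i * P + j) := by ring
      rw [List.getD_append_right _ _ _ _ (by omega), e, hw, Nat.add_sub_cancel_left,
        ih (fun w hw => h w (by simp [hw])) (by simpa using hi), List.getD_cons_succ]

/-- Without flags, the components of equal length `P` follow `x` at intervals of `P`, so parts of
them can be addressed by arithmetic. -/
theorem slice_flatten {P : ℕ} {ws : List (List R)} (h : ∀ w ∈ ws, w.length = P) (z : R)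
    (x : List R) {i o l : ℕ} (hi : i < ws.length) (ho : o + l ≤ P) :
    slice (fun j => (x ++ ws.flatten).getD j z) (x.length + o + i * P) l =
      slice (fun j => (ws.getD i []).getD j z) o l := by
  refine slice_congr fun j hj => ?_
  rw [List.getD_append_right _ _ _ _ (by omega)]
  rw [show x.length + o + i * P + j - x.length = i * P + (o + j) by omega,
    flatten_getD h z hi (by omega)]

theorem map_range_getD {α β : Type*} (g : α → β) (d : α) (l : List α) :
    (List.range l.length).map (fun i => g (l.getD i d)) = l.map g := by
  apply List.ext_getElem
  · simp
  · intro i h1 h2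
    have : i < l.length := by simpa using h1
    simp [this]

end Tuples

/-! ### Alternating quantifiers. -/

section Quantifiers

variable {R : Type w}

/-- The dual quantifier. -/
def Quant.dual : Quant → Quant
  | .ex => .all
  | .all => .ex

theorem Alternating.congr {m : ℕ} {q : Quant} {k : ℕ} {A A' : List (List R) → Prop}
    (h : ∀ ws, ws.length = k → (∀ w ∈ ws, w.length = m) → (A ws ↔ A' ws)) :
    Alternating m q k A ↔ Alternating m q k A' := by
  induction k generalizing q A A' with
  | zero => cases q <;> exact h [] rfl (by simp)
  | succ k ih =>
    have h' : ∀ q (w : List R), w.length = m → (Alternating m q k (fun ws => A (w :: ws)) ↔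
        Alternating m q k fun ws => A' (w :: ws)) := fun q w hw =>
      ih fun ws hk hws => h (w :: ws) (by simp [hk]) (by simp [hw]; exact hws)
    cases q
    · exact exists_congr fun w => and_congr_right fun hw => h' _ w hw
    · exact forall_congr' fun w => imp_congr_right fun hw => h' _ w hw

theorem Alternating.not_iff {m : ℕ} {q : Quant} {k : ℕ} {A : List (List R) → Prop} :
    ¬ Alternating m q k A ↔ Alternating m q.dual k fun ws => ¬ A ws := by
  induction k generalizing q A with
  | zero => cases q <;> exact Iff.rfl
  | succ k ih =>
    cases q
    · simp only [Quant.dual, Alternating, not_exists, not_and]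
      exact forall_congr' fun w => imp_congr_right fun _ => ih
    · simp only [Quant.dual, Alternating, not_forall, exists_prop]
      exact exists_congr fun w => and_congr_right fun _ => ih

/-- The letter `d` shows that there are strings of each length, without which idle quantifiers could
not be dropped. -/
theorem Alternating.const_iff (d : R) {m : ℕ} {q : Quant} {k : ℕ} {p : Prop} :
    Alternating m q k (fun _ : List (List R) => p) ↔ p := by
  induction k generalizing q with
  | zero => cases q <;> exact Iff.rfl
  | succ k ih =>
    cases q
    · simp only [Alternating, ih]
      exact ⟨fun ⟨_, _, h⟩ => h, fun h => ⟨List.replicate m d, by simp, h⟩⟩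
    · simp only [Alternating, ih]
      exact ⟨fun h => h (List.replicate m d) (by simp), fun h _ _ => h⟩

theorem Alternating.and_const_iff (d : R) {m : ℕ} {q : Quant} {k : ℕ} {p : Prop}
    {A : List (List R) → Prop} :
    Alternating m q k (fun ws => A ws ∧ p) ↔ Alternating m q k A ∧ p := by
  by_cases hp : p
  · simp [hp]
  · simp [hp, Alternating.const_iff d]

/-- The innermost quantifier is idle. Adding it brings `k` quantifiers into the pattern of `k + 1`,
as is needed for positive answers of the oracle. -/
theorem Alternating.take_iff (d : R) {m : ℕ} {q : Quant} {k : ℕ} {A : List (List R) → Prop} :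
    Alternating m q (k + 1) (fun ws => A (ws.take k)) ↔ Alternating m q k A := by
  induction k generalizing q A with
  | zero =>
    simp only [List.take_zero]
    rw [Alternating.const_iff d]
    cases q <;> exact Iff.rfl
  | succ k ih =>
    cases q
    · exact exists_congr fun w => and_congr_right fun _ => by
        simpa only [List.take_succ_cons] using ih (A := fun ws => A (w :: ws))
    · exact forall_congr' fun w => imp_congr_right fun _ => by
        simpa only [List.take_succ_cons] using ih (A := fun ws => A (w :: ws))

/-- Alternating quantifiers over strings that consist of independent parts can be exchanged with a
universal quantifier over the parts. -/
theorem Alternating.forall_iff (d : R) {ι : Type*} {P : ℕ} {l : ι → ℕ}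
    {π : ι → List R → List R} (hπ : ∀ i w, w.length = P → (π i w).length = l i)
    (hs : ∀ z : ι → List R, (∀ i, (z i).length = l i) →
      ∃ w : List R, w.length = P ∧ ∀ i, π i w = z i) {q : Quant} {k : ℕ}
    {A : ι → List (List R) → Prop} :
    Alternating P q k (fun ws => ∀ i, A i (ws.map (π i))) ↔
      ∀ i, Alternating (l i) q k (A i) := by
  induction k generalizing q A with
  | zero => cases q <;> exact Iff.rfl
  | succ k ih =>
    have ih' : ∀ q (w : List R), Alternating P q k (fun ws => ∀ i, A i ((w :: ws).map (π i))) ↔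
        ∀ i, Alternating (l i) q k fun zs => A i (π i w :: zs) := fun q w =>
      ih (A := fun i zs => A i (π i w :: zs))
    cases q
    · simp only [Alternating, ih']
      constructor
      · rintro ⟨w, hw, h⟩ i
        exact ⟨π i w, hπ i w hw, h i⟩
      · intro h
        -- Existential case: the parts are chosen separately and then joined to one string by `hs`.
        choose z hz h using h
        obtain ⟨w, hw, hwz⟩ := hs z hz
        exact ⟨w, hw, fun i => by rw [hwz]; exact h i⟩
    · simp only [Alternating, ih']
      constructor
      · intro h i z hz
        classical
        -- Universal case: a given part `z` at the place `i` is extended to a full string by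
        -- arbitrary other parts.
        obtain ⟨w, hw, hwz⟩ := hs
          (fun j => if j = i then z else List.replicate (l j) d) fun j => by
            by_cases e : j = i
            · subst e; simp [hz]
            · simp [e]
        have := h w hw i
        rwa [hwz, if_pos rfl] at this
      · intro h w hw i
        exact h i _ (hπ i w hw)

end Quantifiers

/-! ### Guessed answers in place of an oracle. -/

section Guessing

variable {L : FirstOrder.Language.{u, v}} {R : Type w} [L.Structure R]

/-- The run of an oracle machine with the given answers to the queries. -/
noncomputable def Program.guess (M : Program L) (c : Config R) (ans : ℕ → Prop) : ℕ → Config R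
  | 0 => c
  | t + 1 => M.step {_y | ans t} (M.guess c ans t)

/-- The string that would be submitted to the oracle. -/
def Config.question (c : Config R) : List R := c.string (c.idx 0 + 1)

/-- The next instruction is a query. -/
def Program.AtQuery (M : Program L) (c : Config R) : Prop :=
  ∃ l₁ l₂, M[c.label]? = some (.query l₁ l₂)

theorem Program.step_congr {M : Program L} {Q Q' : Set (List R)} {c : Config R}
    (h : M.AtQuery c → (c.question ∈ Q ↔ c.question ∈ Q')) : M.step Q c = M.step Q' c := by
  rw [Program.step, Program.step, Program.next, Program.next]
  rcases hi : M[c.label]? with _ | i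
  · rfl
  · simp only [Option.map_some, Option.getD_some]
    by_cases hq : ∃ l₁ l₂, i = .query l₁ l₂
    · obtain ⟨l₁, l₂, rfl⟩ := hq
      have := h ⟨l₁, l₂, hi⟩
      simp only [Config.question] at this
      exact Config.mk_congr (by by_cases hQ : c.string (c.idx 0 + 1) ∈ Q <;> simp [hQ, ← this]) rfl rfl
    · push Not at hq
      exact Instr.exec_eq_of_not_query hq _ _ _

/-- Soundness: the answers are compared with the oracle along the guessed run. As long as they are
right, the guessed run is the true one, so that the next question is a true question as well. -/
theorem Program.guess_eq_iterate {M : Program L} {Q : Set (List R)} {c : Config R}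
    {ans : ℕ → Prop} {T : ℕ}
    (h : ∀ t < T, M.AtQuery (M.guess c ans t) → (ans t ↔ (M.guess c ans t).question ∈ Q)) :
    ∀ t ≤ T, M.guess c ans t = (M.step Q)^[t] c := by
  intro t
  induction t with
  | zero => intro _; rfl
  | succ t ih =>
    intro ht
    rw [Function.iterate_succ_apply', ← ih (by omega), Program.guess]
    exact M.step_congr fun hq => h t (by omega) hq

/-- Completeness: here the answers are read off from the true run. -/
theorem Program.guess_eq_iterate' {M : Program L} {Q : Set (List R)} {c : Config R}
    {ans : ℕ → Prop} {T : ℕ}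
    (h : ∀ t < T, ans t ↔ ((M.step Q)^[t] c).question ∈ Q) :
    ∀ t ≤ T, M.guess c ans t = (M.step Q)^[t] c := by
  intro t
  induction t with
  | zero => intro _; rfl
  | succ t ih =>
    intro ht
    rw [Function.iterate_succ_apply', Program.guess, ih (by omega)]
    exact M.step_congr fun _ => h t (by omega)

theorem Program.step_idx_le (M : Program L) (Q : Set (List R)) (c : Config R) (r : ℕ) :
    (M.step Q c).idx r ≤ c.idx r + 1 := by
  rw [Program.step, Program.next]
  rcases M[c.label]? with _ | i
  · simp
  · exact i.exec_idx_le Q c r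

theorem Program.guess_idx_le (M : Program L) (c : Config R) (ans : ℕ → Prop) (t r : ℕ) :
    (M.guess c ans t).idx r ≤ c.idx r + t := by
  induction t with
  | zero => exact le_rfl
  | succ t ih =>
    have := M.step_idx_le {_y | ans t} (M.guess c ans t) r
    rw [Program.guess]
    omega

theorem Config.length_question (c : Config R) : c.question.length = c.idx 0 + 1 := by
  simp [Config.question, Config.string]

/-- The format of the guessed strings is fixed here: `m` letters for the witness of the oracle
machine, `T` letters for the answers, and `T` blocks of length `S`. The word in a block may be
shorter than the block. Division by `S` with remainder finds the block and the place in it. -/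
theorem exists_witness (z : R) {m T S P : ℕ} (hP : m + T + T * S ≤ P) (x : List R)
    (hx : x.length = m) (a : ℕ → R) (y : ℕ → List R) (hy : ∀ t < T, (y t).length ≤ S) :
    ∃ W : List R, W.length = P ∧ slice (fun j => W.getD j z) 0 m = x ∧
      (∀ t < T, W.getD (m + t) z = a t) ∧
      ∀ t < T, slice (fun j => W.getD j z) (m + T + t * S) (y t).length = y t := by
  set f : ℕ → R := fun i => if i < m then x.getD i z else if i < m + T then a (i - m) else
    (y ((i - (m + T)) / S)).getD ((i - (m + T)) % S) z with hf
  have hW : ∀ i < P, ((List.range P).map f).getD i z = f i := by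
    intro i hi
    simp [hi]
  refine ⟨(List.range P).map f, by simp, ?_, ?_, ?_⟩
  · subst hx
    rw [slice_eq_iff z]
    intro i hi
    rw [Nat.zero_add, hW i (by omega), hf]
    simp [hi]
  · intro t ht
    rw [hW _ (by omega), hf]
    simp [ht]
  · intro t ht
    rw [slice_eq_iff z]
    intro i hi
    have hS := hy t ht
    have h1 : (t + 1) * S ≤ T * S := Nat.mul_le_mul_right _ ht
    have h2 : (t + 1) * S = t * S + S := by ring
    have hS0 : 0 < S := by omega
    rw [hW _ (by omega), hf]
    simp only
    rw [if_neg (by omega), if_neg (by omega),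
      show m + T + t * S + i - (m + T) = i + S * t by rw [Nat.mul_comm]; omega,
      Nat.add_mul_div_left _ _ hS0, Nat.add_mul_mod_self_left, Nat.div_eq_of_lt (by omega),
      Nat.mod_eq_of_lt (by omega), Nat.zero_add]

/-- Guessed answers of an oracle and guessed witnesses for them replace the oracle. -/
theorem alternating_guess_iff (B : Bipointed L R) (M N : Program L) {Q : Set (List R)} {k : ℕ}
    {p : Polynomial ℕ} (hQ : N.Defines B ∅ .ex k p Q) (F : Config R → Prop) (x : List R)
    {m T S P : ℕ} (hP : m + T + T * S ≤ P)
    (hS : p.eval (2 * (x.length + m) + T) ≤ S) :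
    Alternating P .ex (k + 1) (fun Ws =>
      (∀ t < T, M.AtQuery (M.guess (B.init (B.tuple x
          [slice (fun j => (Ws.getD 0 []).getD j B.zero) 0 m]))
          (fun t => (Ws.getD 0 []).getD (m + t) B.zero = B.one) t) →
        ((Ws.getD 0 []).getD (m + t) B.zero = B.one ↔
          N.Accepts B ∅ (B.tuple
            (M.guess (B.init (B.tuple x [slice (fun j => (Ws.getD 0 []).getD j B.zero) 0 m]))
              (fun t => (Ws.getD 0 []).getD (m + t) B.zero = B.one) t).question
            ((List.range k).map fun i => slice (fun j => (Ws.getD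
              (open Classical in if (Ws.getD 0 []).getD (m + t) B.zero = B.one then i else i + 1)
              []).getD j B.zero) (m + T + t * S)
              (p.eval (M.guess (B.init (B.tuple x
                [slice (fun j => (Ws.getD 0 []).getD j B.zero) 0 m]))
                (fun t => (Ws.getD 0 []).getD (m + t) B.zero = B.one) t).question.length))))) ∧
      F (M.guess (B.init (B.tuple x [slice (fun j => (Ws.getD 0 []).getD j B.zero) 0 m]))
          (fun t => (Ws.getD 0 []).getD (m + t) B.zero = B.one) T)) ↔
    ∃ y : List R, y.length = m ∧ F ((M.step Q)^[T] (B.init (B.tuple x [y]))) := by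
  classical
  rw [Alternating]
  have hlen : ∀ y : List R, y.length = m → (B.tuple x [y]).length = 2 * (x.length + m) := by
    intro y hy
    rw [length_tuple B x (by simp)]
    simp [hy]
  -- A question is longer by one than `I[0]`, which starts with the length of the pair and grows by
  -- at most one in a step. Because of `t < T` the additional letter fits into the bound `T`.
  have hquest : ∀ (y : List R) (ans : ℕ → Prop), y.length = m → ∀ t < T,
      p.eval (M.guess (B.init (B.tuple x [y])) ans t).question.length ≤ S := by
    intro y ans hy t ht
    refine (polynomial_eval_mono p ?_).trans hS
    rw [Config.length_question]
    have := M.guess_idx_le (B.init (B.tuple x [y])) ans t 0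
    have h0 : (B.init (B.tuple x [y])).idx 0 = 2 * (x.length + m) := by
      simp [Bipointed.init, hlen y hy]
    rw [h0] at this
    omega
  -- Once the first string `W` is fixed, the guessed run and all its questions are fixed. What the
  -- other `k` quantifiers say then splits into one condition for each step.
  have step : ∀ W : List R, W.length = P →
      (Alternating P .all k (fun Ws =>
      (∀ t < T, M.AtQuery (M.guess (B.init (B.tuple x
          [slice (fun j => W.getD j B.zero) 0 m]))
          (fun t => W.getD (m + t) B.zero = B.one) t) →
        (W.getD (m + t) B.zero = B.one ↔
          N.Accepts B ∅ (B.tuple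
            (M.guess (B.init (B.tuple x [slice (fun j => W.getD j B.zero) 0 m]))
              (fun t => W.getD (m + t) B.zero = B.one) t).question
            ((List.range k).map fun i => slice (fun j => ((W :: Ws).getD
              (if W.getD (m + t) B.zero = B.one then i else i + 1)
              []).getD j B.zero) (m + T + t * S)
              (p.eval (M.guess (B.init (B.tuple x
                [slice (fun j => W.getD j B.zero) 0 m]))
                (fun t => W.getD (m + t) B.zero = B.one) t).question.length))))) ∧
      F (M.guess (B.init (B.tuple x [slice (fun j => W.getD j B.zero) 0 m]))
          (fun t => W.getD (m + t) B.zero = B.one) T)) ↔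
      (∀ t < T, M.AtQuery (M.guess (B.init (B.tuple x
          [slice (fun j => W.getD j B.zero) 0 m]))
          (fun t => W.getD (m + t) B.zero = B.one) t) →
        (W.getD (m + t) B.zero = B.one → Alternating (p.eval (M.guess (B.init (B.tuple x
                [slice (fun j => W.getD j B.zero) 0 m]))
                (fun t => W.getD (m + t) B.zero = B.one) t).question.length) .all k fun zs =>
          N.Accepts B ∅ (B.tuple
            (M.guess (B.init (B.tuple x [slice (fun j => W.getD j B.zero) 0 m]))
              (fun t => W.getD (m + t) B.zero = B.one) t).question
            ((slice (fun j => W.getD j B.zero) (m + T + t * S)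
              (p.eval (M.guess (B.init (B.tuple x
                [slice (fun j => W.getD j B.zero) 0 m]))
                (fun t => W.getD (m + t) B.zero = B.one) t).question.length) :: zs).take k))) ∧
        (W.getD (m + t) B.zero ≠ B.one → (M.guess (B.init (B.tuple x
                [slice (fun j => W.getD j B.zero) 0 m]))
                (fun t => W.getD (m + t) B.zero = B.one) t).question ∉ Q)) ∧
      F (M.guess (B.init (B.tuple x [slice (fun j => W.getD j B.zero) 0 m]))
          (fun t => W.getD (m + t) B.zero = B.one) T)) := by
    intro W hW
    set y := slice (fun j => W.getD j B.zero) 0 m with hy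
    set g := M.guess (B.init (B.tuple x [y])) (fun t => W.getD (m + t) B.zero = B.one) with hg
    rw [Alternating.and_const_iff B.zero]
    refine and_congr_left fun _ => ?_
    have e1 : ∀ Ws : List (List R), Ws.length = k → ∀ t < T,
        (M.AtQuery (g t) → (W.getD (m + t) B.zero = B.one ↔
          N.Accepts B ∅ (B.tuple (g t).question ((List.range k).map fun i =>
            slice (fun j => ((W :: Ws).getD
              (if W.getD (m + t) B.zero = B.one then i else i + 1) []).getD j B.zero)
              (m + T + t * S) (p.eval (g t).question.length))))) ↔
        (M.AtQuery (g t) → (W.getD (m + t) B.zero = B.one → N.Accepts B ∅ (B.tuple (g t).question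
          ((slice (fun j => W.getD j B.zero) (m + T + t * S) (p.eval (g t).question.length) ::
            Ws.map fun w => slice (fun j => w.getD j B.zero) (m + T + t * S)
              (p.eval (g t).question.length)).take k))) ∧
          (W.getD (m + t) B.zero ≠ B.one → ¬ N.Accepts B ∅ (B.tuple (g t).question
            (Ws.map fun w => slice (fun j => w.getD j B.zero) (m + T + t * S)
              (p.eval (g t).question.length))))) := by
      intro Ws hWs t ht
      refine imp_congr_right fun _ => ?_
      -- A positive answer takes its first witness from `W` and ignores the last string. A negative
      -- answer ignores the blocks of `W` and uses all of `Ws`.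
      by_cases ha : W.getD (m + t) B.zero = B.one
      · simp only [ha, if_true, true_iff, ne_eq, not_true_eq_false, true_implies, false_implies,
          and_true]
        have : (List.range k).map (fun i => slice (fun j => ((W :: Ws).getD i []).getD j B.zero)
            (m + T + t * S) (p.eval (g t).question.length)) =
          (slice (fun j => W.getD j B.zero) (m + T + t * S) (p.eval (g t).question.length) ::
            Ws.map fun w => slice (fun j => w.getD j B.zero) (m + T + t * S)
              (p.eval (g t).question.length)).take k := by
          have := map_range_getD (fun w : List R => slice (fun j => w.getD j B.zero) (m + T + t * S)
            (p.eval (g t).question.length)) [] (W :: Ws)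
          rw [List.map_cons] at this
          rw [← this, ← List.map_take, List.take_range]
          congr 2
          simp [hWs]
        rw [this]
      · simp only [ha, if_false, false_iff, ne_eq, not_false_eq_true, true_implies, false_implies,
          true_and, List.getD_cons_succ]
        have := map_range_getD (fun w : List R => slice (fun j => w.getD j B.zero) (m + T + t * S)
            (p.eval (g t).question.length)) [] Ws
        rw [← this, hWs]
    have hπ : ∀ (t : Fin T) (w : List R), w.length = P → (slice (fun j => w.getD j B.zero)
        (m + T + t * S) (p.eval (g t).question.length)).length = p.eval (g t).question.length :=
      fun t w _ => length_slice _ _ _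
    have hs : ∀ z : Fin T → List R, (∀ t, (z t).length = p.eval (g t).question.length) →
        ∃ w : List R, w.length = P ∧ ∀ t : Fin T, slice (fun j => w.getD j B.zero)
          (m + T + t * S) (p.eval (g t).question.length) = z t := by
      intro z hz
      obtain ⟨w, hw, -, -, hw'⟩ := exists_witness B.zero hP (List.replicate m B.zero) (by simp)
        (fun _ => B.zero) (fun t => if h : t < T then z ⟨t, h⟩ else []) (by
          intro t ht
          rw [dif_pos ht, hz]
          exact hquest y _ (by rw [hy]; exact length_slice _ _ _) t ht)
      refine ⟨w, hw, fun t => ?_⟩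
      have := hw' t t.2
      rw [dif_pos t.2, hz] at this
      exact this
    refine (Alternating.congr (A' := fun Ws => ∀ t : Fin T, M.AtQuery (g t) →
      (W.getD (m + t) B.zero = B.one → N.Accepts B ∅ (B.tuple (g t).question
          ((slice (fun j => W.getD j B.zero) (m + T + t * S) (p.eval (g t).question.length) ::
            Ws.map fun w => slice (fun j => w.getD j B.zero) (m + T + t * S)
              (p.eval (g t).question.length)).take k))) ∧
        (W.getD (m + t) B.zero ≠ B.one → ¬ N.Accepts B ∅ (B.tuple (g t).question
          (Ws.map fun w => slice (fun j => w.getD j B.zero) (m + T + t * S)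
            (p.eval (g t).question.length))))) fun Ws hWs _ => ?_).trans
      ((Alternating.forall_iff B.zero (ι := Fin T) (A := fun t zs => M.AtQuery (g t) →
        (W.getD (m + t) B.zero = B.one → N.Accepts B ∅ (B.tuple (g t).question
          ((slice (fun j => W.getD j B.zero) (m + T + t * S) (p.eval (g t).question.length) ::
            zs).take k))) ∧
          (W.getD (m + t) B.zero ≠ B.one → ¬ N.Accepts B ∅ (B.tuple (g t).question zs)))
        hπ hs).trans ?_)
    · rw [Fin.forall_iff]
      exact forall_congr' fun t => forall_congr' fun ht => e1 Ws hWs t ht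
    · rw [Fin.forall_iff]
      refine forall_congr' fun t => forall_congr' fun ht => ?_
      by_cases hq : M.AtQuery (g t)
      · by_cases ha : W.getD (m + t) B.zero = B.one
        · simp only [hq, ha, ne_eq, not_true_eq_false, true_implies, false_implies, and_true]
        · simp only [hq, ha, ne_eq, not_false_eq_true, true_implies, false_implies, true_and]
          -- Not belonging to `Q` is an alternation that starts with a universal quantifier, exactly
          -- the pattern that remains after `W`.
          rw [hQ, Alternating.not_iff]
          rfl
      · simp only [hq, false_implies]
        exact Alternating.const_iff B.zero
  constructor
  · rintro ⟨W, hW, h⟩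
    obtain ⟨h, hF⟩ := (step W hW).1 h
    refine ⟨slice (fun j => W.getD j B.zero) 0 m, length_slice _ _ _, ?_⟩
    rw [← M.guess_eq_iterate (fun t ht hq => ?_) T le_rfl]
    · exact hF
    · obtain ⟨h1, h2⟩ := h t ht hq
      refine ⟨fun ha => ?_, fun hm => by_contra fun ha => h2 ha hm⟩
      -- With an idle last quantifier added, a first existential quantifier can be split off even
      -- for `k = 0`.
      rw [hQ, ← Alternating.take_iff B.zero]
      exact ⟨_, by simp, h1 ha⟩
  · rintro ⟨y, hy, hF⟩
    set c := fun t => (M.step Q)^[t] (B.init (B.tuple x [y])) with hc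
    -- Every configuration has a would-be question, also where no query takes place, so answers and
    -- witnesses can be defined for all `t`. If the answer is negative, the witness is an arbitrary
    -- string of the right length.
    have hz : ∀ t, ∃ z : List R, z.length = p.eval (c t).question.length ∧
        ((c t).question ∈ Q → Alternating (p.eval (c t).question.length) .all k fun zs =>
          N.Accepts B ∅ (B.tuple (c t).question ((z :: zs).take k))) := by
      intro t
      by_cases hm : (c t).question ∈ Q
      · have := hm
        rw [hQ, ← Alternating.take_iff B.zero] at this
        obtain ⟨z, hz, h⟩ := this
        exact ⟨z, hz, fun _ => h⟩
      · exact ⟨List.replicate (p.eval (c t).question.length) B.zero, by simp, fun h => absurd h hm⟩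
    choose z hz hzQ using hz
    have hguess : ∀ t ≤ T, M.guess (B.init (B.tuple x [y])) (fun t => (c t).question ∈ Q) t = c t :=
      M.guess_eq_iterate' fun t _ => Iff.rfl
    obtain ⟨W, hW, hW0, hW1, hW2⟩ := exists_witness B.zero hP y hy
      (fun t => if (c t).question ∈ Q then B.one else B.zero) z (by
        intro t ht
        rw [hz, ← hguess t ht.le]
        exact hquest y _ hy t ht)
    have ha : ∀ t < T, (W.getD (m + t) B.zero = B.one ↔ (c t).question ∈ Q) := by
      intro t ht
      rw [hW1 t ht]
      split_ifs with h
      · simp [h]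
      · simp only [h, iff_false]
        exact B.zero_ne_one
    have hg : ∀ t ≤ T, M.guess (B.init (B.tuple x [y]))
        (fun t => W.getD (m + t) B.zero = B.one) t = c t := M.guess_eq_iterate' ha
    refine ⟨W, hW, (step W hW).2 ?_⟩
    rw [hW0, hg T le_rfl]
    refine ⟨fun t ht hq => ?_, hF⟩
    rw [hg t ht.le] at *
    rw [ha t ht, ← hz, hW2 t ht]
    refine ⟨fun hm => ?_, fun hm => ?_⟩
    · rw [hz]; exact hzQ t hm
    · rwa [ne_eq, ha t ht] at hm

end Guessing

/-! ### Decoding the input of the constructed machines. -/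

section Prologue

variable {L : FirstOrder.Language.{u, v}} {R : Type w} [L.Structure R]

@[simp]
theorem keeps_unflag {r : Reg} : (unflag L).Keeps r ↔ r ≠ (0, 8) ∧ r ≠ (0, 7) := by
  simp [unflag]

@[simp]
theorem keepsTape_unflag {t : Fin 6} : (unflag L).KeepsTape t ↔ t ≠ 1 := by simp [unflag]

theorem loopsOver_unflag : (unflag L).LoopsOver (0, 1) := by simp [unflag]

@[simp]
theorem keeps_scan {B : Bipointed L R} {t : Fin 6} {p c e n : Reg} {hp : (0, 0) ≠ p} {r : Reg} :
    (scan B t p c e n hp).Keeps r ↔ r ≠ p ∧ r ≠ c := by simp [scan]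

@[simp]
theorem keepsTape_scan {B : Bipointed L R} {t : Fin 6} {p c e n : Reg} {hp : (0, 0) ≠ p}
    {t' : Fin 6} : (scan B t p c e n hp).KeepsTape t' ↔ t' ≠ 5 := by simp [scan]

@[simp]
theorem loopsOver_scan {B : Bipointed L R} {t : Fin 6} {p c e n : Reg} {hp : (0, 0) ≠ p} {r : Reg} :
    (scan B t p c e n hp).LoopsOver r ↔ n = r ∧ n ≠ p ∧ n ≠ c := by
  simp [scan]
  rintro rfl
  tauto

@[simp]
theorem keeps_testOne {B : Bipointed L R} {a : Fin 6} {b : ℕ} {c d : Cmd L 6} {r : Reg} :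
    (testOne B a b c d).Keeps r ↔ c.Keeps r ∧ d.Keeps r := by
  simp [testOne]

@[simp]
theorem keepsTape_testOne {B : Bipointed L R} {a : Fin 6} {b : ℕ} {c d : Cmd L 6} {t : Fin 6} :
    (testOne B a b c d).KeepsTape t ↔ t ≠ 5 ∧ c.KeepsTape t ∧ d.KeepsTape t := by
  simp [testOne]

@[simp]
theorem loopsOver_testOne {B : Bipointed L R} {a : Fin 6} {b : ℕ} {c d : Cmd L 6} {r : Reg} :
    (testOne B a b c d).LoopsOver r ↔ c.LoopsOver r ∧ d.LoopsOver r := by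
  simp [testOne]

/-- Copies the letters of a tuple to the tape `1` and counts those of its first component. -/
def prologue (B : Bipointed L R) : Cmd L 6 :=
  .seq (unflag L) (scan B 0 (0, 9) (0, 10) (0, 1) (0, 1) (by simp))

theorem loopsOver_prologue {B : Bipointed L R} : (prologue B).LoopsOver (0, 1) := by
  simp [prologue, loopsOver_unflag]

@[simp]
theorem keeps_prologue {B : Bipointed L R} {r : Reg} :
    (prologue B).Keeps r ↔ r ≠ (0, 8) ∧ r ≠ (0, 7) ∧ r ≠ (0, 9) ∧ r ≠ (0, 10) := by
  simp [prologue, and_assoc]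

theorem eval_prologue (B : Bipointed L R) (x : List R) {ws : List (List R)} (h : ws ≠ []) :
    ((prologue B).eval (B.start 6 (B.tuple x ws))).idx (0, 10) = x.length ∧
    (∀ r, r ≠ (0, 1) → r ≠ (0, 7) → r ≠ (0, 8) → r ≠ (0, 9) → r ≠ (0, 10) →
      ((prologue B).eval (B.start 6 (B.tuple x ws))).idx r = 0) ∧
    (∀ i, ((prologue B).eval (B.start 6 (B.tuple x ws))).mem (1, i) =
      (x ++ ws.flatten).getD i B.zero) ∧
    ∀ (t : Fin 6) i, t ≠ 0 → t ≠ 1 → t ≠ 5 →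
      ((prologue B).eval (B.start 6 (B.tuple x ws))).mem (t, i) = B.zero := by
  have hlen := length_tuple B x h
  have k : ∀ r, r ≠ (0, 7) → r ≠ (0, 8) →
      ((unflag L).eval (B.start 6 (B.tuple x ws))).idx r = (B.start 6 (B.tuple x ws)).idx r :=
    fun r h7 h8 => Cmd.eval_idx_of_keeps (keeps_unflag.2 ⟨h8, h7⟩) _
  have m : ∀ (t : Fin 6) i, t ≠ 1 → ((unflag L).eval (B.start 6 (B.tuple x ws))).mem (t, i) =
      (B.start 6 (B.tuple x ws)).mem (t, i) :=
    fun t i ht => Cmd.eval_mem_of_keepsTape (keepsTape_unflag.2 ht) _ _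
  refine ⟨?_, fun r h1 h7 h8 h9 h10 => ?_, fun i => ?_, fun t i h0 h1 h5 => ?_⟩
  · rw [prologue, Cmd.eval_seq]
    refine eval_scan B (by simp) (by simp) (by simp) (by simp) (by simp) ?_ ?_ ?_ ?_ ?_ ?_
    · rw [k _ (by simp) (by simp)]; simp [Bipointed.start]
    · rw [k _ (by simp) (by simp)]; simp [Bipointed.start]
    · rw [k _ (by simp) (by simp)]; simp [Bipointed.start]
    · rw [k _ (by simp) (by simp)]
      simp [Bipointed.start, hlen]; omega
    · intro i hi
      rw [k _ (by simp) (by simp), m _ _ (by simp)]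
      constructor
      · simp only [Bipointed.start, if_true]
        rw [tuple_getD_flag B x h hi]
        exact B.zero_ne_one
      · simp [Bipointed.start, hlen]; omega
    · rw [k _ (by simp) (by simp), m _ _ (by simp)]
      simpa [Bipointed.start] using tuple_getD_first_flag B x h
  · rw [Cmd.eval_idx_of_keeps (keeps_prologue.2 ⟨h8, h7, h9, h10⟩)]
    simp [Bipointed.start, h1]
  · rw [prologue, Cmd.eval_seq, Cmd.eval_mem_of_keepsTape (by simp), eval_unflag,
      tuple_getD_letter B x h]
  · rw [prologue, Cmd.eval_seq, Cmd.eval_mem_of_keepsTape (by simp [h5]), m t i h1]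
    simp [Bipointed.start, h0]

end Prologue

/-! ### The machine that defines the oracle. -/

section Inner

variable {L : FirstOrder.Language.{u, v}} {R : Type w} [L.Structure R]

/-- Computes the lengths that `innerMain` needs. -/
def innerSizes (B : Bipointed L R) (N q : Polynomial ℕ) : Cmd L 6 := .seqs
  [addReg L 6 (0, 11) (0, 10) (0, 10), .dec (0, 11),
   scan B 1 (0, 12) (0, 13) (0, 11) (0, 10) (by simp),
   addPoly L 6 N (0, 2) (0, 10) (0, 10), addPoly L 6 q (0, 5) (0, 10) (0, 10),
   addReg L 6 (0, 4) (0, 10) (0, 10), .inc (0, 15)]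

/-- Rebuilds the tuple of a string and of prefixes of further strings, and runs the machine `M` on
it. -/
def innerMain (B : Bipointed L R) (M : Program L) (k : ℕ) (c d : L.Constants) : Cmd L 6 := .seqs
  [copyOut L 3 3 1 (0, 14) (0, 11) (0, 2) (by simp), emitAll B 3 3 (by simp) k,
   .loop (0, 2) (0, 2) (M.sim 3 3 .skip (5, 0) (5, 1)),
   testOne B 3 3 (.act (.const (0, 0) c)) (.act (.const (0, 0) d))]

/-- Runs the machine `M` on a tuple that has been given in parts. -/
def inner (B : Bipointed L R) (M : Program L) (N q : Polynomial ℕ) (k : ℕ) (c d : L.Constants) :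
    Cmd L 6 := .seqs
  [prologue B, innerSizes B N q, addPoly L 6 q (0, 6) (0, 13) (0, 13), innerMain B M k c d]

theorem phased_inner (B : Bipointed L R) (M : Program L) (N q : Polynomial ℕ) (k : ℕ)
    (c d : L.Constants) : (inner B M N q k c d).Phased := by
  refine .seqs fun x hx => ?_
  simp only [List.mem_cons, List.not_mem_nil, or_false] at hx
  rcases hx with rfl | rfl | rfl | rfl
  · exact .of (0, 1) loopsOver_prologue
  · refine .of (0, 10) ?_
    simp [innerSizes, loopsOver_addPoly]
  · exact .of (0, 13) (loopsOver_addPoly _ (by simp) (by simp))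
  · refine .of (0, 2) ?_
    have h1 := M.loopsOver_sim (a := (3 : Fin 6)) (b := 3) (h := .skip) (r := (0, 2)) (5, 0) (5, 1)
      (by simp) trivial
    have h2 := M.keeps_sim (a := (3 : Fin 6)) (b := 3) (h := .skip) (r := (0, 2)) (5, 0) (5, 1)
      (by simp) trivial
    simp [innerMain, loopsOver_emitAll, h1, h2]

theorem keeps_inner (B : Bipointed L R) (M : Program L) (N q : Polynomial ℕ) (k : ℕ)
    (c d : L.Constants) : (inner B M N q k c d).Keeps (0, 0) := by
  have h2 := M.keeps_sim (a := (3 : Fin 6)) (b := 3) (h := .skip) (r := (0, 0)) (5, 0) (5, 1)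
      (by simp) trivial
  simp [inner, innerSizes, innerMain, keeps_addPoly, keeps_emitAll, h2]

/-- The question is a pair that is itself a component of a tuple. The prologue has removed the outer
flags only, so the flags of the pair stand in the even cells of the tape `1`, and a second `scan`
finds the length `n` of its first component. The number `a - 1` leaves out the last letter of the
question. -/
theorem eval_innerSizes (B : Bipointed L R) (N q : Polynomial ℕ) {s : St 6 R} {n a : ℕ}
    (ha : s.idx (0, 10) = a) (hn : n < a)
    (h0 : ∀ r ∈ ([(0, 0), (0, 2), (0, 4), (0, 5), (0, 11), (0, 12), (0, 13), (0, 15)] : List Reg),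
      s.idx r = 0)
    (h3 : ∀ i < n, s.mem (1, 2 * i) ≠ B.one ∧ 2 * i ≠ a - 1)
    (h4 : 2 * n = a - 1 ∨ s.mem (1, 2 * n) = B.one) :
    ((innerSizes B N q).eval s).idx (0, 2) = N.eval a ∧
    ((innerSizes B N q).eval s).idx (0, 4) = a ∧
    ((innerSizes B N q).eval s).idx (0, 5) = q.eval a ∧
    ((innerSizes B N q).eval s).idx (0, 11) = a - 1 ∧
    ((innerSizes B N q).eval s).idx (0, 13) = n ∧
    ((innerSizes B N q).eval s).idx (0, 15) = 1 := by
  simp only [List.mem_cons, List.not_mem_nil, or_false, forall_eq_or_imp, forall_eq] at h0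
  obtain ⟨z0, z2, z4, z5, z11, z12, z13, z15⟩ := h0
  simp only [innerSizes, Cmd.eval_seqs_cons, Cmd.eval_seqs_nil]
  rw [eval_addReg (s := s) le_rfl, ha]
  set s₁ := (Cmd.dec (0, 11) : Cmd L 6).eval (s.add (0, 11) a) with hs₁
  have e1 : ∀ r, s₁.idx r = if r = (0, 11) then a - 1 else s.idx r := by
    intro r
    simp only [hs₁, Cmd.eval_act, Act.run, St.add, Function.update_apply, z11, if_true]
    split_ifs <;> simp
  have m1 : s₁.mem = s.mem := rfl
  have hsc := eval_scan B (t := 1) (by simp) (p := (0, 12)) (c := (0, 13)) (e := (0, 11))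
    (n := (0, 10)) (hp := by simp) (by simp) (by simp) (by simp) (by simp) (s := s₁) (m := n)
    (by simp [e1, z0]) (by simp [e1, z12]) (by simp [e1, z13]) (by simp [e1, ha]; omega)
    (by simpa [e1, m1] using h3) (by simpa [e1, m1] using h4)
  have hk : ∀ r, r ≠ (0, 12) → r ≠ (0, 13) →
      ((scan B 1 (0, 12) (0, 13) (0, 11) (0, 10) (by simp)).eval s₁).idx r =
        if r = (0, 11) then a - 1 else s.idx r := by
    intro r h12 h13
    rw [Cmd.eval_idx_of_keeps (keeps_scan.2 ⟨h12, h13⟩), e1]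
  generalize (scan B 1 (0, 12) (0, 13) (0, 11) (0, 10) (by simp)).eval s₁ = s₂ at *
  have f10 : s₂.idx (0, 10) = a := by rw [hk _ (by simp) (by simp)]; simp [ha]
  rw [eval_addPoly _ (by simp) (by simp) le_rfl, eval_addPoly _ (by simp) (by simp) le_rfl,
    eval_addReg le_rfl, eval_inc]
  simp [St.add, f10, hk, hsc, z2, z4, z5, z15]

theorem eval_innerMain (B : Bipointed L R) {M : Program L} (hM : M.QueryFree) (k : ℕ)
    (c d : L.Constants) {s : St 6 R} {n a P l : ℕ} (hs : s.config 3 3 = B.init [])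
    (h0 : s.idx (0, 0) = 0) (h2 : s.idx (0, 2) = n) (h3 : s.idx (0, 3) = 0)
    (h4 : s.idx (0, 4) = a) (h5 : s.idx (0, 5) = P) (h6 : s.idx (0, 6) = l)
    (h11 : s.idx (0, 11) = a - 1) (h14 : s.idx (0, 14) = 0) (h15 : s.idx (0, 15) = 1)
    (hn : a + k * P + l + P ≤ n) {C : Config R}
    (hC : C = (M.step ∅)^[n] (B.init (slice (fun i => s.mem (1, i)) 0 (a - 1) ++
      (List.range k).flatMap fun i =>
        B.entry B.one (slice (fun i => s.mem (1, i)) (a + i * P) l)))) :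
    (C.idx 0 = 1 ∧ C.mem 0 = B.one → ((innerMain B M k c d).eval s).mem (0, 0) = (c : R)) ∧
    (¬ (C.idx 0 = 1 ∧ C.mem 0 = B.one) → ((innerMain B M k c d).eval s).mem (0, 0) = (d : R)) := by
  simp only [innerMain, Cmd.eval_seqs_cons, Cmd.eval_seqs_nil]
  have a1 := eval_copyOut B (a := 3) (t := 1) (p := (0, 14)) (l := (0, 11)) (n := (0, 2))
    (h := by simp) (by simp) (by simp) hs (by omega)
  have k1 : ∀ r : Reg, r ≠ (3, 1) ∧ r ≠ (0, 14) → ((copyOut L 3 3 1 (0, 14) (0, 11) (0, 2)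
      (by simp)).eval s).idx r = s.idx r := fun r hr =>
    Cmd.eval_idx_of_keeps (keeps_copyOut.2 hr) _
  have m1 : ∀ i, ((copyOut L 3 3 1 (0, 14) (0, 11) (0, 2) (by simp)).eval s).mem (1, i) =
    s.mem (1, i) := fun i => Cmd.eval_mem_of_keepsTape (by simp) _ _
  generalize (copyOut L 3 3 1 (0, 14) (0, 11) (0, 2) (by simp)).eval s = s₁ at *
  have a2 := eval_emitAll B (a := 3) (b := 3) (hb := by simp) (by simp) (by simp) a1.1 (k := k)
    (n := n) (p := a) (d := P) (l := l) (by rw [k1 _ (by simp), h0]) (by rw [k1 _ (by simp), h2])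
    (by rw [k1 _ (by simp), h3]; omega) (by rw [k1 _ (by simp), h4])
    (by rw [k1 _ (by simp), h5]) (by rw [k1 _ (by simp), h6]) (by omega) (by omega)
  have k2 : ∀ r : Reg, r ≠ (3, 1) → r ≠ (0, 3) → r ≠ (0, 4) →
      ((emitAll B 3 3 (by simp) k).eval s₁).idx r = s₁.idx r := fun r h h' h'' =>
    Cmd.eval_idx_of_keeps (keeps_emitAll h h' h'') _
  generalize (emitAll B 3 3 (by simp) k).eval s₁ = s₂ at *
  have b0 : s₂.idx (0, 0) = 0 := by
    rw [k2 _ (by simp) (by simp) (by simp), k1 _ (by simp), h0]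
  have b2 : s₂.idx (0, 2) = n := by
    rw [k2 _ (by simp) (by simp) (by simp), k1 _ (by simp), h2]
  have b15 : s₂.idx (0, 15) = 1 := by
    rw [k2 _ (by simp) (by simp) (by simp), k1 _ (by simp), h15]
  rw [Cmd.eval_loop, min_self, b2]
  have a3 := hM.config_iterate_eval_sim (a := (3 : Fin 6)) (b := 3) (by simp) (5, 0) (5, 1) ∅ s₂
    b0 n
  have k3 := Cmd.iterate_eval_idx_of_keeps (M.keeps_sim (a := (3 : Fin 6)) (b := 3) (h := .skip)
    (r := (0, 15)) (5, 0) (5, 1) (by simp) trivial) s₂ n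
  generalize (M.sim (3 : Fin 6) 3 .skip (5, 0) (5, 1)).eval^[n] s₂ = s₃ at *
  have hC' : s₃.config 3 3 = C := by
    rw [a3, a2.1, hC]
    simp only [m1, h14, h11, List.nil_append]
  rw [eval_testOne B (by simp) (k3.trans b15) hC']
  constructor
  · intro h
    rw [if_pos h]
    simp [Cmd.eval_act, Act.run]
  · intro h
    rw [if_neg h]
    simp [Cmd.eval_act, Act.run]

theorem tuple_cons_eq_append (B : Bipointed L R) (x w : List R) (ws : List (List R)) :
    B.tuple x (w :: ws) = B.tuple x [w] ++ ws.flatMap (B.entry B.one) := by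
  simp [Bipointed.tuple]

/-- For a machine `M`, there is a machine that runs `M` on a tuple which has been given in parts,
and that may negate the result. -/
theorem exists_inner (B : Bipointed L R) {M : Program L} (hM : M.QueryFree)
    (hp : M.PolyTime B ∅) (q : Polynomial ℕ) (k : ℕ) (hk : k ≠ 0) (b : Prop) :
    ∃ M' : Program L, M'.QueryFree ∧ M'.PolyTime B ∅ ∧ ∀ (x w : List R) (ws : List (List R)),
      w.length = q.eval x.length → ws.length = k →
      (∀ w' ∈ ws, w'.length = q.eval (B.tuple x [w] ++ [B.zero]).length) →
      (M'.Accepts B ∅ (B.tuple (B.tuple x [w] ++ [B.zero]) ws) ↔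
        (M.Accepts B ∅ (B.tuple x (w :: ws.map fun w' =>
          slice (fun i => w'.getD i B.zero) 0 (q.eval x.length))) ↔ b)) := by
  classical
  obtain ⟨p, hp⟩ := hp.exists_accepts_iff
  -- At the length of the question, `Y` bounds the length of the rebuilt tuple. The value of `N` is
  -- the number of simulated steps of `M` and also bounds the registers used as loop bounds.
  set Y : Polynomial ℕ := .X + .C (2 * (k + 1)) * q with hY
  set N : Polynomial ℕ := Y + p.comp Y with hN
  obtain ⟨M', h1, h2, h3⟩ := exists_program_of_phased B
    (phased_inner B M N q k (if b then B.oneSym else B.zeroSym) (if b then B.zeroSym else B.oneSym))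
    (keeps_inner _ _ _ _ _ _ _)
  refine ⟨M', h1, h2, fun x w ws hw hk' hws => ?_⟩
  have hne : ws ≠ [] := by rintro rfl; exact hk hk'.symm
  set u := B.tuple x [w] ++ [B.zero] with hu
  have hlt : (B.tuple x [w]).length = 2 * (x.length + q.eval x.length) := by
    rw [length_tuple B x (by simp)]
    simp [hw]
  have hul : u.length = 2 * (x.length + q.eval x.length) + 1 := by simp [hu, hlt]
  have hq : q.eval x.length ≤ q.eval u.length := polynomial_eval_mono q (by rw [hul]; omega)
  rw [h3, inner, Cmd.eval_seqs_cons, Cmd.eval_seqs_cons, Cmd.eval_seqs_cons, Cmd.eval_seqs_cons,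
    Cmd.eval_seqs_nil]
  obtain ⟨a1, a2, a3, a4⟩ := eval_prologue B u hne
  generalize (prologue B).eval (B.start 6 (B.tuple u ws)) = s at *
  have hletter : ∀ i < u.length - 1, s.mem (1, i) = (B.tuple x [w]).getD i B.zero := by
    intro i hi
    rw [a3, List.getD_append _ _ _ _ (by omega), hu, List.getD_append _ _ _ _ (by omega)]
  obtain ⟨c2, c4, c5, c11, c13, c15⟩ := eval_innerSizes B N q (s := s) (n := x.length)
    (a := u.length) a1 (by omega) (by
      intro r hr
      simp only [List.mem_cons, List.not_mem_nil, or_false] at hr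
      rcases hr with rfl | rfl | rfl | rfl | rfl | rfl | rfl | rfl <;>
        exact a2 _ (by simp) (by simp) (by simp) (by simp) (by simp))
    (by
      intro i hi
      refine ⟨?_, by omega⟩
      rw [hletter _ (by omega), tuple_getD_flag B x (by simp) hi]
      exact B.zero_ne_one)
    (by
      -- If the witness `w` is empty, the pair has no flag `1`, and the scan stops at the end of the
      -- pair instead.
      rcases Nat.eq_zero_or_pos (q.eval x.length) with h | h
      · exact .inl (by omega)
      · right
        rw [hletter _ (by omega)]
        exact (tuple_getD_first_flag B x (by simp)).resolve_left (by omega))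
  have k1 : ∀ r : Reg, r ≠ (0, 1) → r ≠ (0, 7) → r ≠ (0, 8) → r ≠ (0, 9) → r ≠ (0, 10) →
      (innerSizes B N q).Keeps r → ((innerSizes B N q).eval s).idx r = 0 :=
    fun r e1 e7 e8 e9 e10 e => by rw [Cmd.eval_idx_of_keeps e, a2 r e1 e7 e8 e9 e10]
  have m1 : ∀ (t : Fin 6) i, t ≠ 5 → ((innerSizes B N q).eval s).mem (t, i) = s.mem (t, i) :=
    fun t i ht => Cmd.eval_mem_of_keepsTape (by simp [innerSizes, ht]) _ _
  generalize (innerSizes B N q).eval s = s₁ at *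
  have e6 : s₁.idx (0, 6) = 0 := k1 _ (by simp) (by simp) (by simp) (by simp) (by simp)
    (by simp [innerSizes, keeps_addPoly])
  rw [eval_addPoly _ (by simp) (by simp) le_rfl, c13]
  have hYl : Y.eval u.length = u.length + 2 * (k + 1) * q.eval u.length := by
    simp [hY]
  have hNl : N.eval u.length = Y.eval u.length + p.eval (Y.eval u.length) := by
    simp [hN, Polynomial.eval_comp]
  set X := B.tuple x (w :: ws.map fun w' =>
          slice (fun i => w'.getD i B.zero) 0 (q.eval x.length)) with hX
  have hXl : X.length ≤ Y.eval u.length := by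
    rw [hYl, hX, length_tuple B x (by simp)]
    have e : ((ws.map fun w' => slice (fun i => w'.getD i B.zero) 0 (q.eval x.length)).flatten).length
        = k * q.eval x.length := by
      rw [List.length_flatten, List.map_map]
      simp [Function.comp_def, hk']
    have e' := Nat.mul_le_mul_left k hq
    rw [List.flatten_cons, List.length_append, e, hw, hul]
    rw [hul] at e'
    nlinarith
  have hXeq : X = slice (fun i => s.mem (1, i)) 0 (u.length - 1) ++ (List.range k).flatMap fun i =>
      B.entry B.one (slice (fun i => s.mem (1, i)) (u.length + i * q.eval u.length)
        (q.eval x.length)) := by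
    rw [hX, tuple_cons_eq_append]
    congr 1
    · have : u.length - 1 = (B.tuple x [w]).length := by omega
      rw [this]
      refine ((slice_eq_iff B.zero).2 fun i hi => ?_).symm
      rw [Nat.zero_add, hletter i (by omega)]
    · rw [List.flatMap_map, ← hk', List.flatMap_def, List.flatMap_def]
      rw [← map_range_getD (fun w' => B.entry B.one
        (slice (fun i => w'.getD i B.zero) 0 (q.eval x.length))) [] ws]
      congr 1
      refine List.map_congr_left fun i hi => ?_
      rw [← slice_flatten hws B.zero u (List.mem_range.1 hi) (by omega)]
      simp only [a3, Nat.add_zero]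
  obtain ⟨r1, r2⟩ := eval_innerMain B hM k (if b then B.oneSym else B.zeroSym)
    (if b then B.zeroSym else B.oneSym) (s := s₁.add (0, 6) (q.eval x.length))
    (n := N.eval u.length) (a := u.length) (P := q.eval u.length) (l := q.eval x.length)
    (by
      refine Config.mk_congr ?_ ?_ ?_
      · rw [St.add_idx_of_ne _ (by simp)]
        exact k1 _ (by simp) (by simp) (by simp) (by simp) (by simp)
          (by simp [innerSizes, keeps_addPoly])
      · funext j
        rw [St.add_idx_of_ne _ (by simp), k1 _ (by simp) (by simp) (by simp) (by simp) (by simp)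
          (by simp [innerSizes, keeps_addPoly])]
        simp
      · funext i
        rw [St.add_mem, m1 _ _ (by simp), a4 _ _ (by simp) (by simp) (by simp)]
        simp)
    (by
      rw [St.add_idx_of_ne _ (by simp)]
      exact k1 _ (by simp) (by simp) (by simp) (by simp) (by simp)
        (by simp [innerSizes, keeps_addPoly]))
    (by rw [St.add_idx_of_ne _ (by simp), c2])
    (by
      rw [St.add_idx_of_ne _ (by simp)]
      exact k1 _ (by simp) (by simp) (by simp) (by simp) (by simp)
        (by simp [innerSizes, keeps_addPoly]))
    (by rw [St.add_idx_of_ne _ (by simp), c4]) (by rw [St.add_idx_of_ne _ (by simp), c5])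
    (by rw [St.add_idx_self, e6, Nat.zero_add]) (by rw [St.add_idx_of_ne _ (by simp), c11])
    (by
      rw [St.add_idx_of_ne _ (by simp)]
      exact k1 _ (by simp) (by simp) (by simp) (by simp) (by simp)
        (by simp [innerSizes, keeps_addPoly]))
    (by rw [St.add_idx_of_ne _ (by simp), c15])
    (by rw [hNl, hYl]; nlinarith) rfl
  simp only [St.add_mem, m1 1 _ (show (1 : Fin 6) ≠ 5 by simp), ← hXeq] at r1 r2
  have hacc := hp X (N.eval u.length) (by
    rw [hNl]
    exact (polynomial_eval_mono p hXl).trans (Nat.le_add_left _ _))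
  rw [hacc]
  have z1 : (B.zeroSym : R) ≠ B.one := B.zero_ne_one
  have z2 : (B.oneSym : R) = B.one := rfl
  by_cases hA : ((M.step ∅)^[N.eval u.length] (B.init X)).idx 0 = 1 ∧
      ((M.step ∅)^[N.eval u.length] (B.init X)).mem 0 = B.one
  · rw [r1 hA]
    by_cases hb : b <;> simp [hA, hb, z1, z2]
  · rw [r2 hA]
    by_cases hb : b <;> simp only [hA, hb, if_true, if_false, z1, z2, iff_self, iff_true]

end Inner

/-! ### From the hierarchy to oracle machines. -/

section Query

variable {L : FirstOrder.Language.{u, v}} {R : Type w} [L.Structure R]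

/-- Asks the oracle about the input followed by `0`, and outputs `c` or `d` according to the
answer. -/
def ask (c d : L.Constants) : Program L :=
  [.query 1 3, .const 0 c, .ifIdxEq 0 0 4 4, .const 0 d, .ifIdxEq 0 1 7 5, .dec 0,
    .ifIdxEq 0 0 4 4, .inc 0]

/-- The loop at the label `4` decreases `I[0]` to the content `0` of `I[1]`. The final increment
makes the output a single letter. -/
theorem ask_stepsTo_loop (c d : L.Constants) (Q : Set (List R)) (n : ℕ) (f : ℕ → R) :
    (ask c d).StepsTo Q (3 * n + 2) ⟨4, fun j => if j = 0 then n else 0, f⟩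
      ⟨8, fun j => if j = 0 then 1 else 0, f⟩ := by
  induction n with
  | zero =>
    refine ⟨_, rfl, _, rfl, ?_⟩
    refine Config.mk_congr (by simp [Instr.exec]) ?_ rfl
    funext j
    simp [Instr.exec, Function.update_apply]
  | succ n ih =>
    rw [show 3 * (n + 1) + 2 = (3 * n + 2) + 1 + 1 + 1 by ring]
    refine ⟨⟨5, fun j => if j = 0 then n + 1 else 0, f⟩, by simp [Program.next, ask, Instr.exec],
      ⟨6, fun j => if j = 0 then n else 0, f⟩, ?_, ⟨4, fun j => if j = 0 then n else 0, f⟩,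
      by simp [Program.next, ask, Instr.exec], ih⟩
    simp only [Program.next, ask, List.getElem?_cons_succ, List.getElem?_cons_zero, Option.map_some,
      Option.some_inj]
    refine Config.mk_congr rfl ?_ rfl
    funext j
    by_cases h : j = 0 <;> simp [h]

/-- A query includes the cell `Z[I[0]]`, which is blank in an initial configuration. This is where
the trailing `0` of the questions comes from. -/
theorem string_init_succ (B : Bipointed L R) (x : List R) :
    (B.init x).string (x.length + 1) = x ++ [B.zero] := by
  have := slice_succ (fun i => x.getD i B.zero) 0 x.length
  rw [slice_getD, Nat.zero_add] at this
  rw [List.getD_eq_default _ _ le_rfl] at this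
  rw [← this]
  simp [slice, Config.string, Bipointed.init]

open Classical in
theorem ask_stepsTo (B : Bipointed L R) (c d : L.Constants) (Q : Set (List R)) (x : List R) :
    ∃ t ≤ 3 * x.length + 5, (ask c d).StepsTo Q t (B.init x)
      ⟨8, fun j => if j = 0 then 1 else 0,
        Function.update (B.init x).mem 0 (if x ++ [B.zero] ∈ Q then (c : R) else (d : R))⟩ := by
  have hl := ask_stepsTo_loop c d Q x.length
  have e0 : (B.init x).idx 0 = x.length := rfl
  by_cases h : x ++ [B.zero] ∈ Q
  · refine ⟨(3 * x.length + 2) + 1 + 1 + 1, by omega, ⟨1, (B.init x).idx, (B.init x).mem⟩, ?_,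
      ⟨2, (B.init x).idx, Function.update (B.init x).mem 0 (c : R)⟩, rfl,
      ⟨4, (B.init x).idx, Function.update (B.init x).mem 0 (c : R)⟩,
      by simp [Program.next, ask, Instr.exec], by rw [if_pos h]; exact hl _⟩
    have : (ask c d).next Q (B.init x) = some ((Instr.query 1 3).exec Q (B.init x)) := rfl
    rw [this, Instr.exec, e0, string_init_succ, if_pos h]
  · refine ⟨(3 * x.length + 2) + 1 + 1, by omega, ⟨3, (B.init x).idx, (B.init x).mem⟩, ?_,
      ⟨4, (B.init x).idx, Function.update (B.init x).mem 0 (d : R)⟩, rfl,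
      by rw [if_neg h]; exact hl _⟩
    have : (ask c d).next Q (B.init x) = some ((Instr.query 1 3).exec Q (B.init x)) := rfl
    rw [this, Instr.exec, e0, string_init_succ, if_neg h]

theorem polyTime_ask (B : Bipointed L R) (c d : L.Constants) (Q : Set (List R)) :
    (ask c d).PolyTime B Q := by
  refine ⟨3 * .X + 5, fun x => ?_⟩
  obtain ⟨t, ht, h⟩ := ask_stepsTo B c d Q x
  exact ⟨t, by simpa using ht, _, _, (Program.run_eq_some_iff _ _ _ _ _ _).2 h, rfl, rfl⟩

open Classical in
theorem ask_accepts_iff (B : Bipointed L R) (c d : L.Constants) (Q : Set (List R)) (x : List R) :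
    (ask c d).Accepts B Q x ↔ (if x ++ [B.zero] ∈ Q then (c : R) else (d : R)) = B.one := by
  obtain ⟨t, -, h⟩ := ask_stepsTo B c d Q x
  rw [Program.accepts_iff_of_stepsTo h rfl]
  simp

theorem empty_mem_sigmaClass_zero (B : Bipointed L R) : (∅ : Set (List R)) ∈ SigmaClass B 0 := by
  obtain ⟨M, h1, h2, h3⟩ := exists_program_of_phased B
    (c := (.act (.const (0, 0) B.zeroSym) : Cmd L 1)) (.of (0, 1) trivial) trivial
  refine ⟨0, M, h1, h2, fun x => ?_⟩
  simp only [Set.mem_empty_iff_false, Alternating, false_iff, Bipointed.tuple]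
  rw [h3]
  change Function.update (B.start 1 x).mem (0, 0) (B.zeroSym : R) (0, 0) ≠ B.one
  rw [Function.update_self]
  exact B.zero_ne_one

/-- All quantifiers but the first move into the oracle, which is asked once. For `q₁ = .ex` they
start with a universal one, so the oracle decides the negation. -/
theorem level_subset_oracleLevel (B : Bipointed L R) (q₁ : Quant) (k : ℕ) :
    Level B q₁ (k + 1) ⊆ OracleLevel B q₁ 1 (SigmaClass B k) := by
  classical
  rintro S ⟨q, M, hM, hp, hS⟩
  -- For `k = 0` nothing has to be asked: the machine itself serves, with the dummy oracle `∅`.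
  rcases Nat.eq_zero_or_pos k with rfl | hk
  · exact ⟨∅, empty_mem_sigmaClass_zero B, q, M, hp, hS⟩
  obtain ⟨M', h1, h2, h3⟩ := exists_inner B hM hp q k hk.ne' (q₁ = .all)
  -- `M'` accepts if and only if acceptance by `M` is equivalent to `q₁ = .all`. The matrix is
  -- thereby negated in the existential case only, and `Q` starts with an existential quantifier in
  -- both cases.
  set Q : Set (List R) := {u | Alternating (q.eval u.length) .ex k fun ws =>
    M'.Accepts B ∅ (B.tuple u ws)} with hQ
  have key : ∀ x w : List R, w.length = q.eval x.length →
      ((B.tuple x [w] ++ [B.zero] ∈ Q ↔ q₁ = .all) ↔ Alternating (q.eval x.length) q₁.dual k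
        fun ws => M.Accepts B ∅ (B.tuple x (w :: ws))) := by
    intro x w hw
    have hq : q.eval x.length ≤ q.eval (B.tuple x [w] ++ [B.zero]).length :=
      polynomial_eval_mono q (by
        rw [List.length_append, length_tuple B x (by simp)]; omega)
    have e : B.tuple x [w] ++ [B.zero] ∈ Q ↔ Alternating (q.eval x.length) .ex k
        fun ws => (M.Accepts B ∅ (B.tuple x (w :: ws)) ↔ q₁ = .all) := by
      refine (Alternating.congr fun ws hws hws' => h3 x w ws hw hws hws').trans ?_
      -- Quantifying over long strings of which only a prefix matters amounts to quantifying over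
      -- the prefix. This is the exchange lemma for a single part.
      have := Alternating.forall_iff B.zero (ι := Unit)
        (P := q.eval (B.tuple x [w] ++ [B.zero]).length) (l := fun _ => q.eval x.length)
        (π := fun _ w' => slice (fun i => w'.getD i B.zero) 0 (q.eval x.length))
        (fun _ _ _ => length_slice _ _ _) (by
          intro z hz
          obtain ⟨w', hw', h, -⟩ := exists_witness B.zero
            (P := q.eval (B.tuple x [w] ++ [B.zero]).length) (m := q.eval x.length) (T := 0) (S := 0) (by rw [Nat.zero_mul]; exact hq) (z ()) (hz ())
            (fun _ => B.zero) (fun _ => []) (by simp)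
          exact ⟨w', hw', fun _ => h⟩)
        (q := .ex) (k := k)
        (A := fun _ ws => (M.Accepts B ∅ (B.tuple x (w :: ws)) ↔ q₁ = .all))
      simpa using this
    rw [e]
    cases q₁
    · simp only [reduceCtorEq, iff_false]
      rw [Alternating.not_iff]
      simp [Quant.dual]
    · simp [Quant.dual]
  have hacc : ∀ x w : List R, w.length = q.eval x.length →
      ((ask (if q₁ = .all then B.oneSym else B.zeroSym)
        (if q₁ = .all then B.zeroSym else B.oneSym)).Accepts B Q (B.tuple x [w]) ↔
      Alternating (q.eval x.length) q₁.dual k fun ws => M.Accepts B ∅ (B.tuple x (w :: ws))) := by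
    intro x w hw
    rw [← key x w hw, ask_accepts_iff]
    have z1 : (B.zeroSym : R) ≠ B.one := B.zero_ne_one
    have z2 : (B.oneSym : R) = B.one := rfl
    by_cases hm : B.tuple x [w] ++ [B.zero] ∈ Q <;> by_cases ha : q₁ = .all <;>
      simp [hm, ha, z1, z2]
  refine ⟨Q, ⟨q, M', h1, h2, fun u => Iff.rfl⟩, q, ask (if q₁ = .all then B.oneSym else B.zeroSym)
    (if q₁ = .all then B.zeroSym else B.oneSym), polyTime_ask B _ _ Q, fun x => ?_⟩
  rw [hS]
  cases q₁
  · exact exists_congr fun w => and_congr_right fun hw => (hacc x w hw).symm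
  · exact forall_congr' fun w => imp_congr_right fun hw => (hacc x w hw).symm

end Query

/-! ### Checking a guessed answer. -/

section Handler

variable {L : FirstOrder.Language.{u, v}} {R : Type w} [L.Structure R]

/-- Computes the lengths of the question and of the witnesses for its answer, and where the
witnesses are found. -/
def checkSizes (B : Bipointed L R) (q : Polynomial ℕ) : Cmd L 6 := .seqs
  [setReg L 6 (0, 18) (2, 1) (0, 2), .inc (0, 18), clearReg L 6 (0, 6) (0, 2),
   addPoly L 6 q (0, 6) (0, 18) (0, 2), setReg L 6 (0, 4) (0, 16) (0, 2),
   .act (.const (5, 1) B.oneSym), .act (.copy 5 (0, 0) 1 (0, 17) (by simp)),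
   -- For a negative answer the witnesses start with the second guessed string, at a distance of
   -- `I[5]`.
   .ite (.eq (5, 0) (5, 1)) .skip (addReg L 6 (0, 4) (0, 5) (0, 2))]

/-- Writes the first component of the tuple that consists of a question and of `k` witnesses. -/
def checkFirst (B : Bipointed L R) (k : ℕ) : Cmd L 6 :=
  -- A tuple without further components carries no flags.
  if k = 0 then copyOut L 3 3 2 (0, 3) (0, 18) (0, 2) (by simp) else
    emit B B.zeroSym 3 3 (by simp) 2 (0, 3) (0, 18) (0, 2) (by simp)

/-- Runs the machine `N` on the question of the oracle machine on the tape `2` and on guessed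
witnesses, and increases the register `(0, 19)` if the result differs from the guessed answer. -/
def check (B : Bipointed L R) (N : Program L) (q : Polynomial ℕ) (k J : ℕ) : Cmd L 6 := .seqs
  [clearMachine B 3 3 J, checkSizes B q, checkFirst B k, emitAll B 3 3 (by simp) k,
   .loop (0, 20) (0, 2) (N.sim 3 3 .skip (5, 0) (5, 1)),
   testOne B 3 3 (.ite (.eq (5, 0) (5, 1)) .skip (.inc (0, 19)))
     (.ite (.eq (5, 0) (5, 1)) (.inc (0, 19)) .skip)]

theorem keeps_checkFirst {B : Bipointed L R} {k : ℕ} {r : Reg} (h : r ≠ (3, 1)) (h3 : r ≠ (0, 3)) :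
    (checkFirst B k).Keeps r := by
  rw [checkFirst]
  split_ifs <;> simp [h, h3]

theorem keepsTape_checkFirst {B : Bipointed L R} {k : ℕ} {t : Fin 6} (h : t ≠ 3) (h4 : t ≠ 4) :
    (checkFirst B k).KeepsTape t := by
  rw [checkFirst]
  split_ifs <;> simp [h, h4]

theorem loopsOver_checkFirst {B : Bipointed L R} {k : ℕ} :
    (checkFirst B k).LoopsOver (0, 2) := by
  rw [checkFirst]
  split_ifs <;> simp

theorem keeps_check {B : Bipointed L R} {N : Program L} {q : Polynomial ℕ} {k J : ℕ} {r : Reg}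
    (h : r.1 ≠ 3) (h3 : r ≠ (0, 3)) (h4 : r ≠ (0, 4)) (h6 : r ≠ (0, 6)) (h18 : r ≠ (0, 18))
    (h19 : r ≠ (0, 19)) : (check B N q k J).Keeps r := by
  have h31 : r ≠ (3, 1) := by rintro rfl; exact h rfl
  have h2 := N.keeps_sim (a := (3 : Fin 6)) (b := 3) (h := .skip) (r := r) (5, 0) (5, 1)
      h trivial
  simp [check, checkSizes, keeps_clearMachine h h3, keeps_checkFirst h31 h3,
    keeps_emitAll h31 h3 h4, h2, keeps_addPoly, h4, h6, h18, h19]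

theorem keepsTape_check {B : Bipointed L R} {N : Program L} {q : Polynomial ℕ} {k J : ℕ}
    {t : Fin 6} (h : t ≠ 3) (h4 : t ≠ 4) (h5 : t ≠ 5) : (check B N q k J).KeepsTape t := by
  have h2 := N.keepsTape_sim (a := (3 : Fin 6)) (b := 3) (h := .skip) (5, 0) (5, 1)
      h trivial
  simp [check, checkSizes, keepsTape_clearMachine h h4, keepsTape_checkFirst h h4,
    keepsTape_emitAll h h4, h2, h5]

theorem loopsOver_check {B : Bipointed L R} {N : Program L} {q : Polynomial ℕ} {k J : ℕ} :
    (check B N q k J).LoopsOver (0, 2) := by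
  have h1 := N.loopsOver_sim (a := (3 : Fin 6)) (b := 3) (h := .skip) (r := (0, 2)) (5, 0) (5, 1)
      (by simp) trivial
  have h2 := N.keeps_sim (a := (3 : Fin 6)) (b := 3) (h := .skip) (r := (0, 20)) (5, 0) (5, 1)
      (by simp) trivial
  simp [check, checkSizes, loopsOver_clearMachine, loopsOver_checkFirst, loopsOver_emitAll,
    loopsOver_addPoly, h1, h2]

/-- The state is as `check` needs it, with the bound `n`, intervals of the length `P`, runs of the
length `E`, and a machine on tape `3` that occupies only `c` cells. -/
structure Ready (B : Bipointed L R) (J n P E c : ℕ) (s : St 6 R) : Prop where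
  r0 : s.idx (0, 0) = 0
  r2 : s.idx (0, 2) = n
  r3 : s.idx (0, 3) ≤ n
  r4 : s.idx (0, 4) ≤ n
  r5 : s.idx (0, 5) = P
  r6 : s.idx (0, 6) ≤ n
  r15 : s.idx (0, 15) = 1
  r18 : s.idx (0, 18) ≤ n
  r20 : s.idx (0, 20) = E
  within : (s.config 3 3).Within J B.zero c

theorem Ready.congr {B : Bipointed L R} {J n P E c : ℕ} {s s' : St 6 R} (h : Ready B J n P E c s)
    (hi : ∀ r ∈ ([(0, 0), (0, 2), (0, 3), (0, 4), (0, 5), (0, 6), (0, 15), (0, 18), (0, 20)] :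
      List Reg), s'.idx r = s.idx r) (hc : s'.config 3 3 = s.config 3 3) :
    Ready B J n P E c s' := by
  simp only [List.mem_cons, List.not_mem_nil, or_false, forall_eq_or_imp, forall_eq] at hi
  obtain ⟨e0, e2, e3, e4, e5, e6, e15, e18, e20⟩ := hi
  obtain ⟨r0, r2, r3, r4, r5, r6, r15, r18, r20, hw⟩ := h
  exact ⟨by rw [e0, r0], by rw [e2, r2], by rwa [e3], by rwa [e4], by rw [e5, r5], by rwa [e6],
    by rw [e15, r15], by rwa [e18], by rw [e20, r20], by rwa [hc]⟩

open Classical in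
theorem eval_checkSizes (B : Bipointed L R) (q : Polynomial ℕ) {s : St 6 R} {J n P E c : ℕ}
    (hs : Ready B J n P E c s) (hz : s.idx (2, 1) + 1 ≤ n) (hp : s.idx (0, 16) ≤ n) (hP : P ≤ n) :
    ((checkSizes B q).eval s).idx (0, 18) = s.idx (2, 1) + 1 ∧
    ((checkSizes B q).eval s).idx (0, 6) = q.eval (s.idx (2, 1) + 1) ∧
    ((checkSizes B q).eval s).idx (0, 4) = s.idx (0, 16) +
      (if s.mem (1, s.idx (0, 17)) = B.one then 0 else P) ∧
    ((checkSizes B q).eval s).mem (5, 0) = s.mem (1, s.idx (0, 17)) ∧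
    ((checkSizes B q).eval s).mem (5, 1) = B.one := by
  obtain ⟨r0, r2, r3, r4, r5, r6, r15, r18, r20, -⟩ := hs
  simp only [checkSizes, Cmd.eval_seqs_cons, Cmd.eval_seqs_nil]
  rw [eval_setReg (s := s) (by simp) (by simp) (by omega) (by omega)]
  generalize hs₁ : (Cmd.inc (0, 18) : Cmd L 6).eval
    ⟨Function.update s.idx (0, 18) (s.idx (2, 1)), s.mem⟩ = s₁
  have e1 : ∀ r, s₁.idx r = if r = (0, 18) then s.idx (2, 1) + 1 else s.idx r := by
    intro r
    simp only [← hs₁, eval_inc, St.add, Function.update_apply, if_true]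
    split_ifs <;> rfl
  have m1 : s₁.mem = s.mem := by rw [← hs₁]; rfl
  rw [eval_clearReg (s := s₁) (by simp [e1, r2, r6]), eval_addPoly (s := ⟨_, s₁.mem⟩) q (by simp) (by simp)
    (by simp [e1, r2, hz])]
  generalize hs₂ : (St.add (⟨Function.update s₁.idx (0, 6) 0, s₁.mem⟩ : St 6 R) (0, 6) _) = s₂
  have e2 : ∀ r, s₂.idx r = if r = (0, 6) then q.eval (s.idx (2, 1) + 1) else s₁.idx r := by
    intro r
    simp only [← hs₂, St.add, Function.update_apply, if_true, Nat.zero_add]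
    split_ifs <;> simp_all
  have m2 : s₂.mem = s.mem := by rw [← hs₂]; exact m1
  rw [eval_setReg (s := s₂) (by simp) (by simp) (by simp [e1, e2, r2, r4]) (by simp [e1, e2, r2, hp])]
  by_cases ha : s.mem (1, s.idx (0, 17)) = B.one
  · have ha' : s.mem (1, s.idx (0, 17)) = (B.oneSym : R) := ha
    simp [Cmd.eval_act, Act.run, Cmd.eval_ite, Test.Holds, e1, e2, m2, r0, ha', Cmd.eval_skip,
      Bipointed.one]
  · have ha' : ¬ s.mem (1, s.idx (0, 17)) = (B.oneSym : R) := ha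
    simp only [Cmd.eval_act, Act.run, Cmd.eval_ite, Test.Holds]
    rw [if_neg (by simpa [e1, e2, m2, r0, Bipointed.one] using ha'),
      eval_addReg (by simpa [e1, e2, r2, r5] using hP)]
    simp [e1, e2, m2, r0, ha', St.add, r5, Bipointed.one]

theorem eval_checkFirst (B : Bipointed L R) (k : ℕ) {s : St 6 R} (hs : s.config 3 3 = B.init [])
    (h0 : s.idx (0, 0) = 0) (h3 : s.idx (0, 3) = 0) (hl : s.idx (0, 18) ≤ s.idx (0, 2)) :
    ((checkFirst B k).eval s).config 3 3 = B.init
      (if k = 0 then slice (fun i => s.mem (2, i)) 0 (s.idx (0, 18)) else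
        B.entry B.zero (slice (fun i => s.mem (2, i)) 0 (s.idx (0, 18)))) ∧
    ((checkFirst B k).eval s).idx (0, 3) = s.idx (0, 18) := by
  rw [checkFirst]
  by_cases hk : k = 0
  · rw [if_pos hk, if_pos hk]
    have := eval_copyOut B (a := 3) (t := 2) (p := (0, 3)) (l := (0, 18)) (n := (0, 2))
      (h := by simp) (by simp) (by simp) hs hl
    rw [h3, Nat.zero_add, List.nil_append] at this
    exact this
  · rw [if_neg hk, if_neg hk]
    have := eval_emit B (c := B.zeroSym) (a := 3) (b := 3) (hb := by simp) (t := 2) (p := (0, 3))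
      (l := (0, 18)) (n := (0, 2)) (h := by simp) (by simp) (by simp) (by simp) (by simp) (by simp)
      hs hl h0
    rw [h3, Nat.zero_add, List.nil_append] at this
    exact this

/-- The check can be repeated: it begins with clearing what the previous run of `N` has left, and
`Ready` bounds these remains by `c` before and after. The cells `(5, 0)` and `(5, 1)` end up with
the guessed answer and `1`, and their comparison decides how the simulated query branches. -/
theorem eval_check (B : Bipointed L R) {N : Program L} (hN : N.QueryFree) (q : Polynomial ℕ)
    (k : ℕ) {J : ℕ} (hJ : 0 < J) (hNJ : ∀ i ∈ N, i.BoundedBy J) {s : St 6 R} {n P E c : ℕ}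
    (hs : Ready B J n P E c s) {z : List R}
    (hz : z = slice (fun i => s.mem (2, i)) 0 (s.idx (2, 1) + 1))
    (hn : s.idx (0, 16) + P + k * P + q.eval z.length ≤ n) (hP : P ≤ n) (hcn : c < n)
    (hc : 2 * (z.length + k * q.eval z.length) + J + E ≤ c) {a : R}
    (ha : a = s.mem (1, s.idx (0, 17))) {C : Config R}
    (hC : open Classical in C = (N.step ∅)^[E] (B.init (B.tuple z ((List.range k).map fun i =>
      slice (fun i => s.mem (1, i)) (s.idx (0, 16) + (if a = B.one then i else i + 1) * P)
        (q.eval z.length))))) :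
    Ready B J n P E c ((check B N q k J).eval s) ∧
    ((check B N q k J).eval s).mem (5, 0) = a ∧ ((check B N q k J).eval s).mem (5, 1) = B.one ∧
    ((a = B.one ↔ C.idx 0 = 1 ∧ C.mem 0 = B.one) →
      ((check B N q k J).eval s).idx (0, 19) = s.idx (0, 19)) ∧
    (¬ (a = B.one ↔ C.idx 0 = 1 ∧ C.mem 0 = B.one) →
      ((check B N q k J).eval s).idx (0, 19) = s.idx (0, 19) + 1) := by
  classical
  have hzl : z.length = s.idx (2, 1) + 1 := by simp [hz]
  simp only [check, Cmd.eval_seqs_cons, Cmd.eval_seqs_nil]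
  obtain ⟨c1, c3⟩ := eval_clearMachine B (a := 3) (b := 3) (by simp) (by simp) hs.r0 hs.within
    (by rw [hs.r2]; exact hcn) (by rw [hs.r2]; exact hs.r3)
  have k1 : ∀ r : Reg, r.1 ≠ 3 → r ≠ (0, 3) → ((clearMachine B 3 3 J).eval s).idx r = s.idx r :=
    fun r h h' => Cmd.eval_idx_of_keeps (keeps_clearMachine h h') _
  have m1 : ∀ (t : Fin 6) i, t ≠ 3 → t ≠ 4 → ((clearMachine B 3 3 J).eval s).mem (t, i) =
      s.mem (t, i) := fun t i h h' => Cmd.eval_mem_of_keepsTape (keepsTape_clearMachine h h') _ _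
  generalize (clearMachine B 3 3 J).eval s = s₁ at *
  have hs₁ : Ready B J n P E c s₁ := ⟨by rw [k1 _ (by simp) (by simp), hs.r0],
    by rw [k1 _ (by simp) (by simp), hs.r2], by omega,
    by rw [k1 _ (by simp) (by simp)]; exact hs.r4, by rw [k1 _ (by simp) (by simp), hs.r5],
    by rw [k1 _ (by simp) (by simp)]; exact hs.r6, by rw [k1 _ (by simp) (by simp), hs.r15],
    by rw [k1 _ (by simp) (by simp)]; exact hs.r18, by rw [k1 _ (by simp) (by simp), hs.r20],
    by rw [c1]; exact (B.within_init J hJ []).mono (by simp)⟩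
  obtain ⟨f18, f6, f4, f50, f51⟩ := eval_checkSizes B q hs₁
    (by rw [k1 _ (by simp) (by simp)]; omega) (by rw [k1 _ (by simp) (by simp)]; omega) hP
  have k2 : ∀ r : Reg, r ≠ (0, 18) → r ≠ (0, 6) → r ≠ (0, 4) →
      ((checkSizes B q).eval s₁).idx r = s₁.idx r := fun r h h' h'' =>
    Cmd.eval_idx_of_keeps (by simp [checkSizes, keeps_addPoly, h, h', h'']) _
  have m2 : ∀ (t : Fin 6) i, t ≠ 5 → ((checkSizes B q).eval s₁).mem (t, i) = s₁.mem (t, i) :=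
    fun t i h => Cmd.eval_mem_of_keepsTape (by simp [checkSizes, h]) _ _
  generalize (checkSizes B q).eval s₁ = s₂ at *
  rw [k1 _ (by simp) (by simp), ← hzl] at f18 f6
  rw [k1 _ (by simp) (by simp), k1 _ (by simp) (by simp), m1 _ _ (by simp) (by simp), ← ha] at f4
  rw [k1 _ (by simp) (by simp), m1 _ _ (by simp) (by simp), ← ha] at f50
  have c2 : s₂.config 3 3 = B.init [] := by
    rw [← c1]
    exact St.config_congr (fun j => k2 _ (by simp) (by simp) (by simp)) fun i => m2 _ _ (by simp)
  obtain ⟨g1, g3⟩ := eval_checkFirst B k c2 (by rw [k2 _ (by simp) (by simp) (by simp), hs₁.r0])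
    (by rw [k2 _ (by simp) (by simp) (by simp), c3])
    (by rw [f18, k2 _ (by simp) (by simp) (by simp), hs₁.r2]; omega)
  have k3 : ∀ r : Reg, r ≠ (3, 1) → r ≠ (0, 3) → ((checkFirst B k).eval s₂).idx r = s₂.idx r :=
    fun r h h' => Cmd.eval_idx_of_keeps (keeps_checkFirst h h') _
  have m3 : ∀ (t : Fin 6) i, t ≠ 3 → t ≠ 4 → ((checkFirst B k).eval s₂).mem (t, i) =
      s₂.mem (t, i) := fun t i h h' => Cmd.eval_mem_of_keepsTape (keepsTape_checkFirst h h') _ _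
  generalize (checkFirst B k).eval s₂ = s₃ at *
  have hz2 : slice (fun i => s₂.mem (2, i)) 0 (s₂.idx (0, 18)) = z := by
    rw [hz, f18, hzl]
    exact slice_congr fun i _ => by rw [m2 _ _ (by simp), m1 _ _ (by simp) (by simp)]
  rw [hz2] at g1
  set base := s.idx (0, 16) + (if a = B.one then 0 else P) with hbase
  have hbase' : base ≤ s.idx (0, 16) + P := by rw [hbase]; split_ifs <;> omega
  obtain ⟨j1, j3, j4⟩ := eval_emitAll B (a := 3) (b := 3) (hb := by simp) (by simp) (by simp) g1
    (k := k) (n := n) (p := base) (d := P) (l := q.eval z.length)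
    (by rw [k3 _ (by simp) (by simp), k2 _ (by simp) (by simp) (by simp), hs₁.r0])
    (by rw [k3 _ (by simp) (by simp), k2 _ (by simp) (by simp) (by simp), hs₁.r2])
    (by rw [g3, f18]; omega) (by rw [k3 _ (by simp) (by simp), f4])
    (by rw [k3 _ (by simp) (by simp), k2 _ (by simp) (by simp) (by simp), hs₁.r5])
    (by rw [k3 _ (by simp) (by simp), f6]) (by omega) hP
  have k4 : ∀ r : Reg, r ≠ (3, 1) → r ≠ (0, 3) → r ≠ (0, 4) →
      ((emitAll B 3 3 (by simp) k).eval s₃).idx r = s₃.idx r := fun r h h' h'' =>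
    Cmd.eval_idx_of_keeps (keeps_emitAll h h' h'') _
  have m4 : ∀ (t : Fin 6) i, t ≠ 3 → t ≠ 4 → ((emitAll B 3 3 (by simp) k).eval s₃).mem (t, i) =
      s₃.mem (t, i) := fun t i h h' => Cmd.eval_mem_of_keepsTape (keepsTape_emitAll h h') _ _
  generalize (emitAll B 3 3 (by simp) k).eval s₃ = s₄ at *
  set X := B.tuple z ((List.range k).map fun i =>
      slice (fun i => s.mem (1, i)) (s.idx (0, 16) + (if a = B.one then i else i + 1) * P)
        (q.eval z.length)) with hX
  have hX' : (if k = 0 then z else B.entry B.zero z) ++ ((List.range k).flatMap fun i =>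
      B.entry B.one (slice (fun j => s₃.mem (1, j)) (base + i * P) (q.eval z.length))) = X := by
    have e : ∀ i, slice (fun j => s₃.mem (1, j)) (base + i * P) (q.eval z.length) =
        slice (fun i => s.mem (1, i)) (s.idx (0, 16) + (if a = B.one then i else i + 1) * P)
        (q.eval z.length) := by
      intro i
      have : s.idx (0, 16) + (if a = B.one then i else i + 1) * P = base + i * P := by
        rw [hbase]; split_ifs <;> ring
      rw [this]
      exact slice_congr fun j _ => by
        rw [m3 _ _ (by simp) (by simp), m2 _ _ (by simp), m1 _ _ (by simp) (by simp)]
    simp only [e]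
    rw [hX]
    cases k with
    | zero => simp [Bipointed.tuple]
    | succ k =>
      rw [if_neg (by simp), List.range_succ_eq_map, List.map_cons, Bipointed.tuple]
      simp [List.flatMap_map]
  rw [hX'] at j1
  have hXl : X.length ≤ 2 * (z.length + k * q.eval z.length) := by
    rcases Nat.eq_zero_or_pos k with rfl | hk
    · simp [hX, Bipointed.tuple]; omega
    · rw [hX, length_tuple B z (by simp; omega), List.length_flatten, List.map_map]
      simp [Function.comp_def]
  have r0 : s₄.idx (0, 0) = 0 := by
    rw [k4 _ (by simp) (by simp) (by simp), k3 _ (by simp) (by simp),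
      k2 _ (by simp) (by simp) (by simp), hs₁.r0]
  have r2 : s₄.idx (0, 2) = n := by
    rw [k4 _ (by simp) (by simp) (by simp), k3 _ (by simp) (by simp),
      k2 _ (by simp) (by simp) (by simp), hs₁.r2]
  have r20 : s₄.idx (0, 20) = E := by
    rw [k4 _ (by simp) (by simp) (by simp), k3 _ (by simp) (by simp),
      k2 _ (by simp) (by simp) (by simp), hs₁.r20]
  rw [Cmd.eval_loop, r20, r2, Nat.min_eq_left (by omega)]
  have j5 := hN.config_iterate_eval_sim (a := (3 : Fin 6)) (b := 3) (by simp) (5, 0) (5, 1) ∅ s₄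
    r0 E
  have k5 : ∀ r : Reg, r.1 ≠ 3 → ((N.sim (3 : Fin 6) 3 .skip (5, 0) (5, 1)).eval^[E] s₄).idx r =
      s₄.idx r := fun r h => Cmd.iterate_eval_idx_of_keeps (N.keeps_sim (h := .skip) (5, 0) (5, 1) h trivial) _ _
  have m5 : ∀ (t : Fin 6) i, t ≠ 3 →
      ((N.sim (3 : Fin 6) 3 .skip (5, 0) (5, 1)).eval^[E] s₄).mem (t, i) = s₄.mem (t, i) :=
    fun t i h => Cmd.iterate_eval_mem_of_keepsTape (N.keepsTape_sim (h := .skip) (5, 0) (5, 1) h trivial) _ _ _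
  generalize (N.sim (3 : Fin 6) 3 .skip (5, 0) (5, 1)).eval^[E] s₄ = s₅ at *
  rw [j1, ← hC] at j5
  have kk : ∀ r : Reg, r.1 ≠ 3 → r ≠ (0, 3) → r ≠ (0, 4) → r ≠ (0, 6) → r ≠ (0, 18) →
      s₅.idx r = s.idx r := by
    intro r h h3 h4 h6 h18
    have h31 : r ≠ (3, 1) := by rintro rfl; exact h rfl
    rw [k5 r h, k4 r h31 h3 h4, k3 r h31 h3, k2 r h18 h6 h4, k1 r h h3]
  have q50 : s₅.mem (5, 0) = a := by
    rw [m5 _ _ (by simp), m4 _ _ (by simp) (by simp), m3 _ _ (by simp) (by simp), f50]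
  have hw : C.Within J B.zero c := by
    have := N.within_iterate_step hNJ (b := X.length + J) (by omega)
      ((B.within_init J hJ X).mono (Nat.le_add_right _ _)) (fun _ => ∅) E
      (f := fun t => (N.step ∅)^[t] (B.init X)) rfl
      fun t => Function.iterate_succ_apply' _ _ _
    rw [hC]
    exact this.mono (by omega)
  have hs₅ : Ready B J n P E c s₅ := ⟨by rw [k5 _ (by simp), r0], by rw [k5 _ (by simp), r2],
    by rw [k5 _ (by simp)]; exact j3, by rw [k5 _ (by simp), j4]; omega,
    by rw [kk _ (by simp) (by simp) (by simp) (by simp) (by simp), hs.r5],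
    by rw [k5 _ (by simp), k4 _ (by simp) (by simp) (by simp), k3 _ (by simp) (by simp), f6]; omega,
    by rw [kk _ (by simp) (by simp) (by simp) (by simp) (by simp), hs.r15],
    by rw [k5 _ (by simp), k4 _ (by simp) (by simp) (by simp), k3 _ (by simp) (by simp), f18]; omega,
    by rw [k5 _ (by simp), r20], by rwa [j5]⟩
  rw [← kk (0, 19) (by simp) (by simp) (by simp) (by simp) (by simp)]
  clear hC
  rw [eval_testOne B (by simp) hs₅.r15 j5]
  have ready_add : ∀ (m : Fin 6 × ℕ → R), (∀ i, m (3, i) = s₅.mem (3, i)) → ∀ j,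
      Ready B J n P E c (St.add ⟨s₅.idx, m⟩ (0, 19) j) := fun m hm j => hs₅.congr
    (fun r hr => St.add_idx_of_ne _ (by rintro rfl; simp at hr) _)
    (St.config_congr (fun j => St.add_idx_of_ne _ (by simp) _) hm)
  have r' := ready_add (Function.update s₅.mem (5, 1) B.one) (by simp)
  have r'' := r' 0
  rw [St.add_zero] at r''
  by_cases h1 : C.idx 0 = 1 ∧ C.mem 0 = B.one
  · rw [if_pos h1, Cmd.eval_ite]
    by_cases h2 : a = B.one
    · rw [if_pos (by simpa [Test.Holds, q50] using h2)]
      simp [Cmd.eval_skip, q50, r'', h1, h2]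
    · rw [if_neg (by simpa [Test.Holds, q50] using h2)]
      simp [eval_inc, q50, r' 1, h1, h2]
  · rw [if_neg h1, Cmd.eval_ite]
    by_cases h2 : a = B.one
    · rw [if_pos (by simpa [Test.Holds, q50] using h2)]
      simp only [eval_inc, St.add_mem, St.add_idx_self, h1, h2, r' 1]
      simp [q50, h2]
    · rw [if_neg (by simpa [Test.Holds, q50] using h2)]
      simp only [Cmd.eval_skip, h1, h2, r'']
      simp [q50]

end Handler

/-! ### Simulating an oracle machine with guessed answers. -/

section Outer

variable {L : FirstOrder.Language.{u, v}} {R : Type w} [L.Structure R]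

/-- Only queries reach the handler. For other steps it may be replaced by `skip`, so that nothing
outside the bank and the tape of `M` is written. -/
theorem Program.eval_sim_of_not_query (M : Program L) {K : ℕ} {a : Fin K} {b : ℕ} (hb : b ≠ 0)
    (h h' : Cmd L K) (y y' : Fin K × ℕ) (s : St K R) (hs : s.idx (0, 0) = 0)
    (hq : ∀ l₁ l₂, M[s.idx (b, 0)]? ≠ some (.query l₁ l₂)) :
    (M.sim a b h y y').eval s = (M.sim a b h' y y').eval s := by
  rw [Program.sim, Program.sim, eval_dispatch hb _ _ _ hs, eval_dispatch hb _ _ _ hs]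
  rcases hi : M[s.idx (b, 0)]? with _ | i
  · rfl
  · cases i with
    | query l₁ l₂ => exact absurd hi (hq l₁ l₂)
    | _ => rfl

/-- Simulates a step of the oracle machine `M` on the tape `2`. If it is a query, the guessed answer
is checked. -/
def guessStep (B : Bipointed L R) (M N : Program L) (q : Polynomial ℕ) (k J : ℕ) : Cmd L 6 := .seqs
  [M.sim 2 2 (check B N q k J) (5, 0) (5, 1), .inc (0, 17), addReg L 6 (0, 16) (0, 13) (0, 2)]

theorem keeps_guessStep {B : Bipointed L R} {M N : Program L} {q : Polynomial ℕ} {k J : ℕ} {r : Reg}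
    (h2 : r.1 ≠ 2) (h : (check B N q k J).Keeps r) (h17 : r ≠ (0, 17)) (h16 : r ≠ (0, 16)) :
    (guessStep B M N q k J).Keeps r := by
  simp [guessStep, M.keeps_sim (a := (2 : Fin 6)) (5, 0) (5, 1) h2 h, h17, h16]

theorem keepsTape_guessStep {B : Bipointed L R} {M N : Program L} {q : Polynomial ℕ} {k J : ℕ}
    {t : Fin 6} (h2 : t ≠ 2) (h : t ≠ 3) (h4 : t ≠ 4) (h5 : t ≠ 5) :
    (guessStep B M N q k J).KeepsTape t := by
  simp [guessStep, M.keepsTape_sim (b := 2) (5, 0) (5, 1) h2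
    (keepsTape_check (B := B) (N := N) (q := q) (k := k) (J := J) h h4 h5)]

theorem loopsOver_guessStep {B : Bipointed L R} {M N : Program L} {q : Polynomial ℕ} {k J : ℕ} :
    (guessStep B M N q k J).LoopsOver (0, 2) := by
  simp [guessStep, M.loopsOver_sim (a := (2 : Fin 6)) (b := 2) (r := (0, 2)) (5, 0) (5, 1) (by simp)
    (loopsOver_check (B := B) (N := N) (q := q) (k := k) (J := J))]

open Classical in
/-- The machine `N` agrees with the answer that the letter `a` stands for, as to the question of the
configuration `C`, if the witnesses are the words of the length `l` that are found in `f` at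
intervals of the length `P`. -/
def Agrees (B : Bipointed L R) (N : Program L) (q : Polynomial ℕ) (k P E p : ℕ) (f : ℕ → R) (a : R)
    (C : Config R) : Prop :=
  a = B.one ↔ ((N.step ∅)^[E] (B.init (B.tuple C.question ((List.range k).map fun i =>
      slice f (p + (if a = B.one then i else i + 1) * P) (q.eval C.question.length))))).idx 0 = 1 ∧
    ((N.step ∅)^[E] (B.init (B.tuple C.question ((List.range k).map fun i =>
      slice f (p + (if a = B.one then i else i + 1) * P)
        (q.eval C.question.length))))).mem 0 = B.one

/-- The register `(0, 17)` points to the answer for the current step and `(0, 16)` to its block in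
the first string. Both advance in every step, be it a query or not, so answers and blocks are
numbered by the steps. -/
theorem eval_guessStep (B : Bipointed L R) (M : Program L) {N : Program L} (hN : N.QueryFree)
    (q : Polynomial ℕ) (k : ℕ) {J : ℕ} (hJ : 0 < J) (hNJ : ∀ i ∈ N, i.BoundedBy J) {s : St 6 R}
    {n P E c S p : ℕ} (hs : Ready B J n P E c s) {C : Config R} (hC : s.config 2 2 = C)
    (h13 : s.idx (0, 13) = S) (hS : S ≤ n) (h16 : s.idx (0, 16) = p)
    (hn : p + P + k * P + q.eval C.question.length ≤ n) (hP : P ≤ n) (hcn : c < n)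
    (hc : 2 * (C.question.length + k * q.eval C.question.length) + J + E ≤ c) {a : R}
    (ha : a = s.mem (1, s.idx (0, 17))) :
    Ready B J n P E c ((guessStep B M N q k J).eval s) ∧
    ((guessStep B M N q k J).eval s).config 2 2 = M.step {_y | a = B.one} C ∧
    ((guessStep B M N q k J).eval s).idx (0, 16) = p + S ∧
    ((guessStep B M N q k J).eval s).idx (0, 17) = s.idx (0, 17) + 1 ∧
    (((guessStep B M N q k J).eval s).idx (0, 19) = 0 ↔ s.idx (0, 19) = 0 ∧
      (M.AtQuery C → Agrees B N q k P E p (fun i => s.mem (1, i)) a C)) := by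
  have key : ∃ s₁, (M.sim 2 2 (check B N q k J) (5, 0) (5, 1)).eval s = s₁ ∧ Ready B J n P E c s₁ ∧
      s₁.config 2 2 = M.step {_y | a = B.one} C ∧ (s₁.idx (0, 19) = 0 ↔ s.idx (0, 19) = 0 ∧
      (M.AtQuery C → Agrees B N q k P E p (fun i => s.mem (1, i)) a C)) := by
    refine ⟨_, rfl, ?_⟩
    by_cases hq : M.AtQuery C
    · obtain ⟨l₁, l₂, hl⟩ := hq
      have hl' : M[s.idx (2, 0)]? = some (.query l₁ l₂) := by rw [← hC] at hl; exact hl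
      set s₀ : St 6 R := ⟨Function.update s.idx (2, 0) 0, s.mem⟩ with hs₀
      have hz : C.question = slice (fun i => s₀.mem (2, i)) 0 (s₀.idx (2, 1) + 1) := by
        rw [← hC]
        simp [Config.question, Config.string, slice, hs₀, St.config]
      obtain ⟨r1, r2, r3, r4, r5⟩ := eval_check B hN q k hJ hNJ (s := s₀) (n := n) (P := P) (E := E)
        (c := c) (hs.congr (fun r hr => Function.update_of_ne (by rintro rfl; simp at hr) _ _)
          (St.config_congr (fun j => by simp [hs₀]) fun i => rfl)) hz
        (by simpa [hs₀, h16] using hn) hP hcn hc (a := a) (by simpa [hs₀] using ha) rfl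
      obtain ⟨e1, e2⟩ := M.eval_sim_of_query (a := (2 : Fin 6)) (b := 2) (by simp)
        (h := check B N q k J)
        (keeps_check (by simp) (by simp) (by simp) (by simp) (by simp) (by simp)) (5, 0) (5, 1) s
        hs.r0 hl' (s' := (check B N q k J).eval s₀) rfl
      have k1 : ∀ j, ((check B N q k J).eval s₀).idx (2, j) = s₀.idx (2, j) := fun j =>
        Cmd.eval_idx_of_keeps (keeps_check (by simp) (by simp) (by simp) (by simp) (by simp)
          (by simp)) _
      have m1 : ∀ i, ((check B N q k J).eval s₀).mem (2, i) = s₀.mem (2, i) := fun j =>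
        Cmd.eval_mem_of_keepsTape (keepsTape_check (by simp) (by simp) (by simp)) _ _
      have h19 : s₀.idx (0, 19) = s.idx (0, 19) := by simp [hs₀]
      have h16' : s₀.idx (0, 16) = p := by simp [hs₀, h16]
      generalize (check B N q k J).eval s₀ = s₁ at *
      have hag : s₁.idx (0, 19) = 0 ↔ s.idx (0, 19) = 0 ∧
          (M.AtQuery C → Agrees B N q k P E p (fun i => s.mem (1, i)) a C) := by
        have hq : M.AtQuery C := ⟨l₁, l₂, hl⟩
        simp only [hq, true_implies, Agrees]
        simp only [h16'] at r4 r5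
        rw [h19] at r4 r5
        have aux : ∀ {A : Prop} {u v : ℕ}, (A → u = v) → (¬ A → u = v + 1) →
            (u = 0 ↔ v = 0 ∧ A) := by
          intro A u v h h'
          by_cases hA : A
          · simp [h hA, hA]
          · simp [h' hA, hA]
        exact aux r4 r5
      have ready_update : ∀ l, Ready B J n P E c ⟨Function.update s₁.idx (2, 0) l, s₁.mem⟩ :=
        fun l => r1.congr (fun r hr => Function.update_of_ne (by rintro rfl; simp at hr) _ _)
          (St.config_congr (fun j => by simp) fun i => rfl)
      have conf_update : ∀ l, (⟨Function.update s₁.idx (2, 0) l, s₁.mem⟩ : St 6 R).config 2 2 =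
          ⟨l, C.idx, C.mem⟩ := by
        intro l
        rw [← hC]
        refine Config.mk_congr (by simp) (funext fun j => ?_) (funext fun i => m1 i)
        simp [k1, hs₀, St.config]
      have hstep : M.step {_y | a = B.one} C =
          (Instr.query l₁ l₂ : Instr L).exec {_y | a = B.one} C := by
        simp [Program.step, Program.next, hl]
      rw [hstep]
      by_cases ha1 : a = B.one
      · rw [e1 (by rw [r2, r3, ha1])]
        refine ⟨ready_update _, ?_, ?_⟩
        · rw [conf_update]
          simp [Instr.exec, ha1]
        · simpa using hag
      · rw [e2 (by rw [r2, r3]; exact ha1)]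
        refine ⟨ready_update _, ?_, ?_⟩
        · rw [conf_update]
          simp [Instr.exec, ha1]
        · simpa using hag
    · have hq' : ∀ l₁ l₂, M[s.idx (2, 0)]? ≠ some (.query l₁ l₂) := by
        intro l₁ l₂ h
        rw [← hC] at hq
        exact hq ⟨l₁, l₂, h⟩
      rw [M.eval_sim_of_not_query (by simp) _ .skip _ _ _ hs.r0 hq']
      have k1 : ∀ r : Reg, r.1 ≠ 2 → ((M.sim (2 : Fin 6) 2 .skip (5, 0) (5, 1)).eval s).idx r =
          s.idx r := fun r h =>
        Cmd.eval_idx_of_keeps (M.keeps_sim (h := .skip) (5, 0) (5, 1) h trivial) _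
      refine ⟨hs.congr (fun r hr => k1 r (by
          simp only [List.mem_cons, List.not_mem_nil, or_false] at hr
          rcases hr with rfl | rfl | rfl | rfl | rfl | rfl | rfl | rfl | rfl <;> simp))
        (St.config_congr (fun j => k1 _ (by simp)) fun i =>
        Cmd.eval_mem_of_keepsTape (M.keepsTape_sim (h := .skip) (5, 0) (5, 1) (by simp) trivial)
          _ _), ?_, ?_⟩
      · rw [M.config_eval_sim (by simp) .skip _ _ {_y | a = B.one} s hs.r0 hq', hC]
      · rw [k1 _ (by simp)]
        simp [hq]
  obtain ⟨s₁, e, h1, h2, h3⟩ := key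
  have k1 : ∀ r : Reg, r.1 ≠ 2 → (check B N q k J).Keeps r → s₁.idx r = s.idx r := fun r h h' => by
    rw [← e, Cmd.eval_idx_of_keeps (M.keeps_sim (5, 0) (5, 1) h h')]
  have e13 := k1 (0, 13) (by simp)
    (keeps_check (by simp) (by simp) (by simp) (by simp) (by simp) (by simp))
  have e16 := k1 (0, 16) (by simp)
    (keeps_check (by simp) (by simp) (by simp) (by simp) (by simp) (by simp))
  have e17 := k1 (0, 17) (by simp)
    (keeps_check (by simp) (by simp) (by simp) (by simp) (by simp) (by simp))
  simp only [guessStep, Cmd.eval_seqs_cons, Cmd.eval_seqs_nil, e, eval_inc]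
  rw [eval_addReg (by simpa [St.add, e13, h13, h1.r2] using hS)]
  refine ⟨h1.congr (fun r hr => ?_) (St.config_congr (fun j => by simp [St.add]) fun i => rfl),
    ?_, ?_, ?_, ?_⟩
  · rw [St.add_idx_of_ne _ (by rintro rfl; simp at hr), St.add_idx_of_ne _ (by rintro rfl; simp at hr)]
  · rw [← h2]
    exact St.config_congr (fun j => by simp [St.add]) fun i => rfl
  · simp [St.add, e16, e13, h16, h13]
  · simp [St.add, e17]
  · rw [← h3]
    simp [St.add]

/-- A wrong answer does not stop the simulation, which goes on with the guess. The register `(0,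
19)` counts the wrong answers, and the bounds `hn` and `hc` refer to the guessed run, whether its
answers are right or wrong. -/
theorem iterate_eval_guessStep (B : Bipointed L R) (M : Program L) {N : Program L}
    (hN : N.QueryFree) (q : Polynomial ℕ) (k : ℕ) {J : ℕ} (hJ : 0 < J)
    (hNJ : ∀ i ∈ N, i.BoundedBy J) {s : St 6 R} {n P E c S T p a : ℕ} (hs : Ready B J n P E c s)
    (h13 : s.idx (0, 13) = S) (hS : S ≤ n) (h16 : s.idx (0, 16) = p) (h17 : s.idx (0, 17) = a)
    (h19 : s.idx (0, 19) = 0) {f : ℕ → R} (hf : ∀ i, s.mem (1, i) = f i) {g : ℕ → Config R}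
    (hg : g = M.guess (s.config 2 2) fun t => f (a + t) = B.one)
    (hP : P ≤ n) (hcn : c < n)
    (hn : ∀ t < T, p + t * S + P + k * P + q.eval (g t).question.length ≤ n)
    (hc : ∀ t < T, 2 * ((g t).question.length + k * q.eval (g t).question.length) + J + E ≤ c) :
    ∀ t ≤ T, Ready B J n P E c ((guessStep B M N q k J).eval^[t] s) ∧
      ((guessStep B M N q k J).eval^[t] s).config 2 2 = g t ∧
      ((guessStep B M N q k J).eval^[t] s).idx (0, 16) = p + t * S ∧
      ((guessStep B M N q k J).eval^[t] s).idx (0, 17) = a + t ∧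
      (((guessStep B M N q k J).eval^[t] s).idx (0, 19) = 0 ↔
        ∀ j < t, M.AtQuery (g j) → Agrees B N q k P E (p + j * S) f (f (a + j)) (g j)) := by
  intro t
  induction t with
  | zero =>
    intro _
    exact ⟨hs, by rw [hg]; rfl, by simp [h16], by simp [h17], by simp [h19]⟩
  | succ t ih =>
    intro ht
    obtain ⟨i1, i2, i3, i4, i5⟩ := ih (by omega)
    have e13 : ((guessStep B M N q k J).eval^[t] s).idx (0, 13) = S := by
      rw [Cmd.iterate_eval_idx_of_keeps (keeps_guessStep (by simp) (keeps_check (by simp) (by simp)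
        (by simp) (by simp) (by simp) (by simp)) (by simp) (by simp)), h13]
    have ef : ∀ i, ((guessStep B M N q k J).eval^[t] s).mem (1, i) = f i := fun i => by
      rw [Cmd.iterate_eval_mem_of_keepsTape (keepsTape_guessStep (by simp) (by simp) (by simp)
        (by simp)), hf]
    rw [Function.iterate_succ_apply']
    generalize (guessStep B M N q k J).eval^[t] s = s₁ at *
    obtain ⟨j1, j2, j3, j4, j5⟩ := eval_guessStep B M hN q k hJ hNJ i1 i2 e13 hS i3 (hn t (by omega))
      hP hcn (hc t (by omega)) (a := f (a + t)) (by rw [i4, ef])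
    refine ⟨j1, ?_, ?_, ?_, ?_⟩
    · rw [j2, hg]; rfl
    · rw [j3]; ring
    · rw [j4, i4, Nat.add_assoc]
    · rw [j5, i5, funext ef]
      constructor
      · rintro ⟨h, h'⟩ j hj
        rcases Nat.lt_succ_iff_lt_or_eq.1 hj with hj | rfl
        exacts [h j hj, h']
      · exact fun h => ⟨fun j hj => h j (by omega), h t (by omega)⟩

end Outer

/-! ### The simulation from the decoded input to the output. -/

section Unrelativized

variable {L : FirstOrder.Language.{u, v}} {R : Type w} [L.Structure R]

/-- Computes the lengths that `outerMain` needs. -/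
noncomputable def outerSizes (L : FirstOrder.Language.{u, v}) (N P m T S E : Polynomial ℕ) : Cmd L 6 := .seqs
  [addPoly L 6 N (0, 2) (0, 10) (0, 10), addPoly L 6 P (0, 5) (0, 10) (0, 10),
   addPoly L 6 m (0, 11) (0, 10) (0, 10), addPoly L 6 T (0, 12) (0, 10) (0, 10),
   addPoly L 6 S (0, 13) (0, 10) (0, 10), addPoly L 6 E (0, 20) (0, 10) (0, 10),
   addPoly L 6 (.X + (m + T)) (0, 16) (0, 10) (0, 10), addPoly L 6 (.X + m) (0, 17) (0, 10) (0, 10),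
   .inc (0, 15)]

/-- Simulates the oracle machine `M` with guessed answers to its queries, which are checked by means
of the machine `N`. The letter `c` is the output if there is a wrong answer. -/
def outerMain (B : Bipointed L R) (M N : Program L) (q : Polynomial ℕ) (k J : ℕ)
    (c : L.Constants) : Cmd L 6 := .seqs
  [emit B B.zeroSym 2 2 (by simp) 1 (0, 14) (0, 10) (0, 2) (by simp),
   emit B B.oneSym 2 2 (by simp) 1 (0, 14) (0, 11) (0, 2) (by simp),
   .loop (0, 12) (0, 2) (guessStep B M N q k J),
   testOne B 2 2
     (.ite (.idxEq (0, 19) (0, 0)) (.act (.const (0, 0) B.oneSym)) (.act (.const (0, 0) c)))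
     (.ite (.idxEq (0, 19) (0, 0)) (.act (.const (0, 0) B.zeroSym)) (.act (.const (0, 0) c)))]

theorem loopsOver_outerMain {B : Bipointed L R} {M N : Program L} {q : Polynomial ℕ} {k J : ℕ}
    {c : L.Constants} : (outerMain B M N q k J c).LoopsOver (0, 2) := by
  simp [outerMain, loopsOver_guessStep, keeps_guessStep, keeps_check]

theorem keeps_outerMain {B : Bipointed L R} {M N : Program L} {q : Polynomial ℕ} {k J : ℕ}
    {c : L.Constants} : (outerMain B M N q k J c).Keeps (0, 0) := by
  simp [outerMain, keeps_guessStep, keeps_check]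

theorem loopsOver_outerSizes {N P m T S E : Polynomial ℕ} :
    (outerSizes L N P m T S E).LoopsOver (0, 10) := by
  simp [outerSizes, loopsOver_addPoly]

theorem eval_outerSizes {N P m T S E : Polynomial ℕ} {s : St 6 R} {n : ℕ} (h10 : s.idx (0, 10) = n)
    (h : ∀ r ∈ ([(0, 2), (0, 5), (0, 11), (0, 12), (0, 13), (0, 15), (0, 16), (0, 17), (0, 20)] :
      List Reg), s.idx r = 0) :
    ((outerSizes L N P m T S E).eval s).idx (0, 2) = N.eval n ∧
    ((outerSizes L N P m T S E).eval s).idx (0, 5) = P.eval n ∧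
    ((outerSizes L N P m T S E).eval s).idx (0, 11) = m.eval n ∧
    ((outerSizes L N P m T S E).eval s).idx (0, 12) = T.eval n ∧
    ((outerSizes L N P m T S E).eval s).idx (0, 13) = S.eval n ∧
    ((outerSizes L N P m T S E).eval s).idx (0, 15) = 1 ∧
    ((outerSizes L N P m T S E).eval s).idx (0, 16) = n + (m.eval n + T.eval n) ∧
    ((outerSizes L N P m T S E).eval s).idx (0, 17) = n + m.eval n ∧
    ((outerSizes L N P m T S E).eval s).idx (0, 20) = E.eval n ∧
    ((outerSizes L N P m T S E).eval s).mem = s.mem ∧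
    ∀ r ∉ ([(0, 2), (0, 5), (0, 11), (0, 12), (0, 13), (0, 15), (0, 16), (0, 17), (0, 20)] :
      List Reg), ((outerSizes L N P m T S E).eval s).idx r = s.idx r := by
  simp only [List.mem_cons, List.not_mem_nil, or_false, forall_eq_or_imp, forall_eq] at h
  obtain ⟨z2, z5, z11, z12, z13, z15, z16, z17, z20⟩ := h
  simp only [outerSizes, Cmd.eval_seqs_cons, Cmd.eval_seqs_nil]
  repeat rw [eval_addPoly _ (by simp) (by simp) le_rfl]
  rw [eval_inc]
  simp only [St.add]
  refine ⟨?_, ?_, ?_, ?_, ?_, ?_, ?_, ?_, ?_, trivial, fun r hr => ?_⟩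
  on_goal 10 =>
    simp only [List.mem_cons, List.not_mem_nil, or_false, not_or] at hr
    simp [hr]
  all_goals simp [h10, z2, z5, z11, z12, z13, z15, z16, z17, z20]

open Classical in
theorem eval_outerMain (B : Bipointed L R) (M : Program L) {N : Program L} (hN : N.QueryFree)
    (q : Polynomial ℕ) (k : ℕ) {J : ℕ} (hJ : 0 < J) (hNJ : ∀ i ∈ N, i.BoundedBy J)
    (d : L.Constants) {s : St 6 R} {n P E c S T p a l m : ℕ} (hs : Ready B J n P E c s)
    (hs2 : s.config 2 2 = B.init []) (h14 : s.idx (0, 14) = 0)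
    (h10 : s.idx (0, 10) = l) (h11 : s.idx (0, 11) = m) (h12 : s.idx (0, 12) = T)
    (h13 : s.idx (0, 13) = S) (h16 : s.idx (0, 16) = p) (h17 : s.idx (0, 17) = a)
    (h19 : s.idx (0, 19) = 0) (hl : l ≤ n) (hm : m ≤ n) (hT : T ≤ n) (hS : S ≤ n) (hP : P ≤ n)
    (hcn : c < n) {f : ℕ → R} (hf : ∀ i, s.mem (1, i) = f i)
    {g : ℕ → Config R} (hg : g = M.guess (B.init (B.tuple (slice f 0 l) [slice f l m]))
      fun t => f (a + t) = B.one)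
    (hn : ∀ t < T, p + t * S + P + k * P + q.eval (g t).question.length ≤ n)
    (hc : ∀ t < T, 2 * ((g t).question.length + k * q.eval (g t).question.length) + J + E ≤ c) :
    ((outerMain B M N q k J d).eval s).mem (0, 0) =
      if ∀ j < T, M.AtQuery (g j) → Agrees B N q k P E (p + j * S) f (f (a + j)) (g j) then
        if (g T).idx 0 = 1 ∧ (g T).mem 0 = B.one then B.one else B.zero
      else (d : R) := by
  simp only [outerMain, Cmd.eval_seqs_cons, Cmd.eval_seqs_nil]
  obtain ⟨e1, e14⟩ := eval_emit B (c := B.zeroSym) (a := 2) (b := 2) (hb := by simp) (t := 1)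
    (p := (0, 14)) (l := (0, 10)) (n := (0, 2)) (h := by simp) (by simp) (by simp) (by simp)
    (by simp) (by simp) hs2 (by rw [h10, hs.r2]; exact hl) hs.r0
  have k1 : ∀ r : Reg, r ≠ (2, 1) ∧ r ≠ (0, 14) → ((emit B B.zeroSym 2 2 (by simp) 1 (0, 14) (0, 10)
      (0, 2) (by simp)).eval s).idx r = s.idx r := fun r h => Cmd.eval_idx_of_keeps (keeps_emit.2 h) _
  have m1 : ∀ (t : Fin 6) i, t ≠ 4 ∧ t ≠ 2 → ((emit B B.zeroSym 2 2 (by simp) 1 (0, 14) (0, 10)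
      (0, 2) (by simp)).eval s).mem (t, i) = s.mem (t, i) := fun t i h =>
    Cmd.eval_mem_of_keepsTape (keepsTape_emit.2 h) _ _
  generalize (emit B B.zeroSym 2 2 (by simp) 1 (0, 14) (0, 10) (0, 2) (by simp)).eval s = s₁ at *
  obtain ⟨e2, -⟩ := eval_emit B (c := B.oneSym) (a := 2) (b := 2) (hb := by simp) (t := 1)
    (p := (0, 14)) (l := (0, 11)) (n := (0, 2)) (h := by simp) (by simp) (by simp) (by simp)
    (by simp) (by simp) e1 (by rw [k1 _ (by simp), k1 _ (by simp), h11, hs.r2]; exact hm)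
    (by rw [k1 _ (by simp), hs.r0])
  have k2 : ∀ r : Reg, r ≠ (2, 1) ∧ r ≠ (0, 14) → ((emit B B.oneSym 2 2 (by simp) 1 (0, 14) (0, 11)
      (0, 2) (by simp)).eval s₁).idx r = s.idx r := fun r h => by
    rw [Cmd.eval_idx_of_keeps (keeps_emit.2 h), k1 r h]
  have m2 : ∀ (t : Fin 6) i, t ≠ 4 ∧ t ≠ 2 → ((emit B B.oneSym 2 2 (by simp) 1 (0, 14) (0, 11)
      (0, 2) (by simp)).eval s₁).mem (t, i) = s.mem (t, i) := fun t i h => by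
    rw [Cmd.eval_mem_of_keepsTape (keepsTape_emit.2 h), m1 t i h]
  generalize (emit B B.oneSym 2 2 (by simp) 1 (0, 14) (0, 11) (0, 2) (by simp)).eval s₁ = s₂ at *
  have hs₂ : Ready B J n P E c s₂ := hs.congr (fun r hr => k2 r (by
      simp only [List.mem_cons, List.not_mem_nil, or_false] at hr
      rcases hr with rfl | rfl | rfl | rfl | rfl | rfl | rfl | rfl | rfl <;> simp))
    (St.config_congr (fun j => k2 _ (by simp)) fun i => m2 _ _ (by simp))
  have hconf : s₂.config 2 2 = B.init (B.tuple (slice f 0 l) [slice f l m]) := by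
    rw [e2, e14, h14, h10, k1 _ (by simp), h11]
    simp only [m1 1 _ (by simp), hf, List.nil_append, Nat.zero_add]
    simp [Bipointed.tuple, Bipointed.zero, Bipointed.one]
  rw [Cmd.eval_loop, k2 _ (by simp), h12, hs₂.r2, Nat.min_eq_left hT]
  obtain ⟨i1, i2, -, -, i5⟩ := iterate_eval_guessStep B M hN q k hJ hNJ hs₂
    (by rw [k2 _ (by simp), h13]) hS (by rw [k2 _ (by simp), h16]) (by rw [k2 _ (by simp), h17])
    (by rw [k2 _ (by simp), h19]) (f := f) (fun i => by rw [m2 _ _ (by simp), hf])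
    (by rw [hconf]; exact hg) hP hcn hn hc T le_rfl
  generalize (guessStep B M N q k J).eval^[T] s₂ = s₃ at *
  rw [eval_testOne B (by simp) i1.r15 i2]
  simp only [← i5]
  by_cases h : (g T).idx 0 = 1 ∧ (g T).mem 0 = B.one
  · rw [if_pos h, if_pos h, Cmd.eval_ite]
    by_cases h' : s₃.idx (0, 19) = 0
    · rw [if_pos h', if_pos (by simp [Test.Holds, i1.r0, h'])]
      simp [Cmd.eval_act, Act.run, Bipointed.one]
    · rw [if_neg h', if_neg (by simp [Test.Holds, i1.r0, h'])]
      simp [Cmd.eval_act, Act.run]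
  · rw [if_neg h, if_neg h, Cmd.eval_ite]
    by_cases h' : s₃.idx (0, 19) = 0
    · rw [if_pos h', if_pos (by simp [Test.Holds, i1.r0, h'])]
      simp [Cmd.eval_act, Act.run, Bipointed.zero]
    · rw [if_neg h', if_neg (by simp [Test.Holds, i1.r0, h'])]
      simp [Cmd.eval_act, Act.run]

theorem Program.guess_congr {M : Program L} {c : Config R} {ans ans' : ℕ → Prop} {T : ℕ}
    (h : ∀ t < T, ans t ↔ ans' t) : ∀ t ≤ T, M.guess c ans t = M.guess c ans' t := by
  intro t
  induction t with
  | zero => intro _; rfl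
  | succ t ih =>
    intro ht
    rw [Program.guess, Program.guess, ih (by omega)]
    exact M.step_congr fun _ => h t (by omega)

end Unrelativized

/-! ### From oracle machines to the hierarchy. -/

section Hierarchy

variable {L : FirstOrder.Language.{u, v}} {R : Type w} [L.Structure R]

/-- Simulates the oracle machine `M` on a pair, with guessed answers. -/
noncomputable def outer (B : Bipointed L R) (M N : Program L) (Nb P m T S E q : Polynomial ℕ)
    (k J : ℕ) (c : L.Constants) : Cmd L 6 := .seqs
  [prologue B, outerSizes L Nb P m T S E, outerMain B M N q k J c]

theorem phased_outer (B : Bipointed L R) (M N : Program L) (Nb P m T S E q : Polynomial ℕ)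
    (k J : ℕ) (c : L.Constants) : (outer B M N Nb P m T S E q k J c).Phased := by
  refine .seqs fun x hx => ?_
  simp only [List.mem_cons, List.not_mem_nil, or_false] at hx
  rcases hx with rfl | rfl | rfl
  · exact .of (0, 1) loopsOver_prologue
  · exact .of (0, 10) loopsOver_outerSizes
  · exact .of (0, 2) loopsOver_outerMain

theorem keeps_outer (B : Bipointed L R) (M N : Program L) (Nb P m T S E q : Polynomial ℕ)
    (k J : ℕ) (c : L.Constants) : (outer B M N Nb P m T S E q k J c).Keeps (0, 0) := by
  simp [outer, outerSizes, keeps_addPoly, keeps_outerMain]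

theorem ite_eq_one_iff (B : Bipointed L R) {A F b : Prop} [Decidable A] [Decidable F]
    [Decidable b] :
    (if A then if F then B.one else B.zero else
      ((if b then B.zeroSym else B.oneSym : L.Constants) : R)) = B.one ↔ if A then F else ¬ b := by
  have z1 : B.zero ≠ B.one := B.zero_ne_one
  have z2 : (B.zeroSym : R) ≠ B.one := B.zero_ne_one
  have z3 : (B.oneSym : R) = B.one := rfl
  by_cases hA : A <;> by_cases hF : F <;> by_cases hb : b <;> simp [hA, hF, hb, z1, z2, z3]

set_option maxHeartbeats 1000000 in
open Classical in
/-- For an oracle machine `M` and a machine `N`, there is a machine that simulates `M` with guessed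
answers, for which witnesses in the sense of `N` have been guessed as well. It outputs the result of
`M` if all answers are correct, and otherwise accepts if and only if `b` is false. -/
theorem exists_outer (B : Bipointed L R) (M : Program L) {N : Program L} (hN : N.QueryFree)
    (hp : N.PolyTime B ∅) (m T q : Polynomial ℕ) (k : ℕ) (b : Prop) :
    ∃ (M' : Program L) (S P : Polynomial ℕ), M'.QueryFree ∧ M'.PolyTime B ∅ ∧
      (∀ n, m.eval n + T.eval n + T.eval n * S.eval n ≤ P.eval n) ∧
      (∀ n, q.eval (2 * (n + m.eval n) + T.eval n) ≤ S.eval n) ∧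
      ∀ (x : List R) (Ws : List (List R)), Ws.length = k + 1 →
      (∀ W ∈ Ws, W.length = P.eval x.length) →
      ∀ (g : ℕ → Config R), g = M.guess (B.init (B.tuple x
          [slice (fun j => (Ws.getD 0 []).getD j B.zero) 0 (m.eval x.length)]))
          (fun t => (Ws.getD 0 []).getD (m.eval x.length + t) B.zero = B.one) →
      (M'.Accepts B ∅ (B.tuple x Ws) ↔
        if ∀ t < T.eval x.length, M.AtQuery (g t) →
          ((Ws.getD 0 []).getD (m.eval x.length + t) B.zero = B.one ↔
            N.Accepts B ∅ (B.tuple (g t).question ((List.range k).map fun i =>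
              slice (fun j => (Ws.getD
                (if (Ws.getD 0 []).getD (m.eval x.length + t) B.zero = B.one then i else i + 1)
                []).getD j B.zero) (m.eval x.length + T.eval x.length + t * S.eval x.length)
                (q.eval (g t).question.length)))) then
          (g (T.eval x.length)).idx 0 = 1 ∧ (g (T.eval x.length)).mem 0 = B.one
        else ¬ b) := by
  obtain ⟨pN, hpN⟩ := hp.exists_accepts_iff
  obtain ⟨J, hJ⟩ := N.exists_boundedBy
  have hJ' : ∀ i ∈ N, i.BoundedBy (J + 1) := fun i hi => (hJ i hi).mono (Nat.le_succ J)
  -- In terms of the length of `x`, `Z` bounds the questions, `S` their witnesses, `Y` the inputs of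
  -- `N`, `E` its running time and `c` the cells that it touches. `P` is the length of the guessed
  -- strings, and `Nb` exceeds all that is needed as a loop bound.
  set Z : Polynomial ℕ := .C 2 * (.X + m) + T with hZ
  set S : Polynomial ℕ := q.comp Z with hS
  set Y : Polynomial ℕ := .C 2 * (Z + .C k * S) with hY
  set E : Polynomial ℕ := pN.comp Y with hE
  set P : Polynomial ℕ := m + T + T * S with hP
  set c : Polynomial ℕ := Y + .C (J + 1) + E with hc
  set Nb : Polynomial ℕ := .X + .C (k + 2) * P + c + S + T + 1 with hNb
  obtain ⟨M', h1, h2, h3⟩ := exists_program_of_phased B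
    (phased_outer B M N Nb P m T S E q k (J + 1) (if b then B.zeroSym else B.oneSym))
    (keeps_outer B M N Nb P m T S E q k (J + 1) (if b then B.zeroSym else B.oneSym))
  refine ⟨M', S, P, h1, h2, fun n => by simp [hP], fun n => by simp [hS, hZ],
    fun x Ws hWs hlen g hg => ?_⟩
  have hne : Ws ≠ [] := by rintro rfl; simp at hWs
  set l := x.length with hl
  have eZ : Z.eval l = 2 * (l + m.eval l) + T.eval l := by simp [hZ]
  have eS : S.eval l = q.eval (Z.eval l) := by simp [hS, Polynomial.eval_comp]
  have eY : Y.eval l = 2 * (Z.eval l + k * S.eval l) := by simp [hY]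
  have eE : E.eval l = pN.eval (Y.eval l) := by simp [hE, Polynomial.eval_comp]
  have eP : P.eval l = m.eval l + T.eval l + T.eval l * S.eval l := by simp [hP]
  have ec : c.eval l = Y.eval l + (J + 1) + E.eval l := by simp [hc]
  have eN : Nb.eval l = l + (k + 2) * P.eval l + c.eval l + S.eval l + T.eval l + 1 := by
    simp [hNb]
  rw [h3, outer, Cmd.eval_seqs_cons, Cmd.eval_seqs_cons, Cmd.eval_seqs_cons, Cmd.eval_seqs_nil]
  obtain ⟨a1, a2, a3, a4⟩ := eval_prologue B x hne
  generalize (prologue B).eval (B.start 6 (B.tuple x Ws)) = s at *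
  obtain ⟨b2, b5, b11, b12, b13, b15, b16, b17, b20, bm, bk⟩ := eval_outerSizes (L := L) (N := Nb)
    (P := P) (m := m) (T := T) (S := S) (E := E) a1 (by
      intro r hr
      simp only [List.mem_cons, List.not_mem_nil, or_false] at hr
      rcases hr with rfl | rfl | rfl | rfl | rfl | rfl | rfl | rfl | rfl <;>
        exact a2 _ (by simp) (by simp) (by simp) (by simp) (by simp))
  generalize (outerSizes L Nb P m T S E).eval s = s₁ at *
  rw [← hl] at b2 b5 b11 b12 b13 b16 b17 b20
  set f : ℕ → R := fun i => (x ++ Ws.flatten).getD i B.zero with hf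
  have hW0 : ∀ j < P.eval l, f (l + j) = (Ws.getD 0 []).getD j B.zero := by
    intro j hj
    rw [hf]
    simp only
    rw [List.getD_append_right _ _ _ _ (by omega), ← hl, Nat.add_sub_cancel_left,
      ← flatten_getD hlen B.zero (i := 0) (by omega) hj, Nat.zero_mul, Nat.zero_add]
  have hx : slice f 0 l = x := by
    refine (slice_eq_iff B.zero).2 fun i hi => ?_
    rw [hf]
    simp only
    rw [Nat.zero_add, List.getD_append _ _ _ _ hi]
  have hy : slice f l (m.eval l) =
      slice (fun j => (Ws.getD 0 []).getD j B.zero) 0 (m.eval l) :=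
    slice_congr fun i hi => by rw [hW0 i (by omega), Nat.zero_add]
  have hylen : (slice (fun j => (Ws.getD 0 []).getD j B.zero) 0 (m.eval l)).length = m.eval l :=
    length_slice _ _ _
  have hans : ∀ t < T.eval l, f (l + m.eval l + t) = (Ws.getD 0 []).getD (m.eval l + t) B.zero := by
    intro t ht
    have : (t + 1) * S.eval l ≤ T.eval l * S.eval l := Nat.mul_le_mul_right _ ht
    rw [Nat.add_assoc, hW0 _ (by omega)]
  set g' := M.guess (B.init (B.tuple (slice f 0 l) [slice f l (m.eval l)]))
      (fun t => f (l + m.eval l + t) = B.one) with hg'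
  -- After the first `T` steps the two sequences of answers may differ, since `f` runs on beyond the
  -- first guessed string.
  have hgg : ∀ t ≤ T.eval l, g' t = g t := by
    intro t ht
    rw [hg', hg, hx, hy]
    exact M.guess_congr (fun t ht => by rw [hans t ht]) t ht
  have hquest : ∀ t < T.eval l, (g t).question.length ≤ Z.eval l := by
    intro t ht
    rw [Config.length_question, hg, eZ]
    refine (Nat.succ_le_succ (M.guess_idx_le _ _ _ _)).trans ?_
    have : (B.init (B.tuple x [slice (fun j => (Ws.getD 0 []).getD j B.zero) 0 (m.eval l)])).idx 0 =
        2 * (l + m.eval l) := by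
      change (B.tuple x _).length = _
      rw [length_tuple B x (by simp), List.flatten_singleton, hylen]
    rw [this]
    omega
  have hq : ∀ t < T.eval l, q.eval (g t).question.length ≤ S.eval l := fun t ht => by
    rw [eS]; exact polynomial_eval_mono q (hquest t ht)
  have hreg : ∀ r, r ≠ (0, 1) → r ≠ (0, 7) → r ≠ (0, 8) → r ≠ (0, 9) → r ≠ (0, 10) →
      r ∉ ([(0, 2), (0, 5), (0, 11), (0, 12), (0, 13), (0, 15), (0, 16), (0, 17), (0, 20)] :
      List Reg) → s₁.idx r = 0 := fun r e1 e7 e8 e9 e10 hr => by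
    rw [bk r hr, a2 r e1 e7 e8 e9 e10]
  have hinit : ∀ (a : Fin 6) (b : ℕ), b ≠ 0 → a ≠ 0 → a ≠ 1 → a ≠ 5 →
      s₁.config a b = B.init [] := by
    intro a b hb h0 h1 h5
    have hb' := hb.symm
    refine Config.mk_congr (hreg _ (by simp [hb]) (by simp [hb]) (by simp [hb]) (by simp [hb])
      (by simp [hb]) (by simp [hb])) (funext fun j => ?_) (funext fun i => ?_)
    · rw [hreg _ (by simp [hb]) (by simp [hb]) (by simp [hb]) (by simp [hb])
        (by simp [hb]) (by simp [hb])]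
      simp
    · rw [bm, a4 _ _ h0 h1 h5]
      simp
  have h0P : P.eval l ≤ (k + 2) * P.eval l := Nat.le_mul_of_pos_left _ (by omega)
  have hready : Ready B (J + 1) (Nb.eval l) (P.eval l) (E.eval l) (c.eval l) s₁ :=
    ⟨hreg _ (by simp) (by simp) (by simp) (by simp) (by simp) (by simp), b2,
      by rw [hreg _ (by simp) (by simp) (by simp) (by simp) (by simp) (by simp)]; omega,
      by rw [hreg _ (by simp) (by simp) (by simp) (by simp) (by simp) (by simp)]; omega, b5,
      by rw [hreg _ (by simp) (by simp) (by simp) (by simp) (by simp) (by simp)]; omega, b15,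
      by rw [hreg _ (by simp) (by simp) (by simp) (by simp) (by simp) (by simp)]; omega, b20,
      by
        rw [hinit _ _ (by simp) (by simp) (by simp) (by simp)]
        exact (B.within_init (J + 1) (by omega) []).mono (by simp)⟩
  rw [eval_outerMain B M hN q k (J := J + 1) (by omega) hJ' (if b then B.zeroSym else B.oneSym)
    hready (hinit _ _ (by simp) (by simp) (by simp) (by simp))
    (hreg _ (by simp) (by simp) (by simp) (by simp) (by simp) (by simp)) (l := l)
    (by rw [bk _ (by simp), a1]) b11 b12 b13 b16 b17
    (hreg _ (by simp) (by simp) (by simp) (by simp) (by simp) (by simp)) (by omega) (by omega)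
    (by omega) (by omega) (by omega) (by omega) (f := f) (fun i => by rw [bm, a3]) hg'
    (by
      intro t ht
      have h1 := hq t ht
      have h2 : (t + 1) * S.eval l ≤ T.eval l * S.eval l := Nat.mul_le_mul_right _ ht
      rw [Nat.add_one_mul] at h2
      rw [hgg t ht.le, eN, show (k + 2) * P.eval l = P.eval l + P.eval l + k * P.eval l by ring]
      omega)
    (by
      intro t ht
      have h1 := Nat.mul_le_mul_left k (hq t ht)
      have h2 := hquest t ht
      rw [hgg t ht.le, ec, eY]
      omega)]
  have hagree : (∀ j < T.eval l, M.AtQuery (g' j) → Agrees B N q k (P.eval l) (E.eval l)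
        (l + (m.eval l + T.eval l) + j * S.eval l) f (f (l + m.eval l + j)) (g' j)) ↔
      ∀ t < T.eval l, M.AtQuery (g t) →
          ((Ws.getD 0 []).getD (m.eval l + t) B.zero = B.one ↔
            N.Accepts B ∅ (B.tuple (g t).question ((List.range k).map fun i =>
              slice (fun j => (Ws.getD
                (if (Ws.getD 0 []).getD (m.eval l + t) B.zero = B.one then i else i + 1)
                []).getD j B.zero) (m.eval l + T.eval l + t * S.eval l)
                (q.eval (g t).question.length)))) := by
    refine forall_congr' fun t => forall_congr' fun ht => ?_
    rw [hgg t ht.le, hans t ht]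
    refine imp_congr_right fun _ => ?_
    have e : (List.range k).map (fun i => slice f (l + (m.eval l + T.eval l) + t * S.eval l +
        (if (Ws.getD 0 []).getD (m.eval l + t) B.zero = B.one then i else i + 1) * P.eval l)
        (q.eval (g t).question.length)) =
      (List.range k).map fun i => slice (fun j => (Ws.getD
                (if (Ws.getD 0 []).getD (m.eval l + t) B.zero = B.one then i else i + 1)
                []).getD j B.zero) (m.eval l + T.eval l + t * S.eval l)
                (q.eval (g t).question.length) := by
      refine List.map_congr_left fun i hi => ?_
      rw [List.mem_range] at hi
      have h1 := hq t ht
      have h2 : (t + 1) * S.eval l ≤ T.eval l * S.eval l := Nat.mul_le_mul_right _ ht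
      rw [Nat.add_one_mul] at h2
      rw [← slice_flatten hlen B.zero x (by split_ifs <;> omega) (by omega), Nat.add_assoc l]
    rw [Agrees, e, ← hpN]
    rw [eE]
    refine polynomial_eval_mono pN ?_
    rw [eY]
    have h1 := Nat.mul_le_mul_left k (hq t ht)
    have h2 := hquest t ht
    rcases Nat.eq_zero_or_pos k with rfl | hk
    · simp only [List.range_zero, List.map_nil, Bipointed.tuple]; omega
    · rw [length_tuple B _ (by simp; omega), List.length_flatten, List.map_map]
      simp only [Function.comp_def, length_slice, List.map_const', List.length_range,
        List.sum_replicate, smul_eq_mul]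
      omega
  simp only [hagree, hgg _ le_rfl]
  exact ite_eq_one_iff B

/-- In the existential case a wrong guess leads to rejection. In the universal case, acceptance for
all `y` is the negation of the existence of a `y` that is rejected with right answers. The dual
alternation calls for a machine that accepts if a guess is wrong or `M` accepts. -/
theorem oracleLevel_subset_level (B : Bipointed L R) (q₁ : Quant) (k : ℕ) :
    OracleLevel B q₁ 1 (SigmaClass B k) ⊆ Level B q₁ (k + 1) := by
  classical
  rintro S₀ ⟨Q, ⟨q, N, hN, hNp, hQ⟩, m, M, hM, hS₀⟩
  obtain ⟨pM, hpM⟩ := hM.exists_accepts_iff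
  -- The time bound of `M` on a pair, the encoding of which has twice as many symbols as the pair
  -- has letters.
  set T : Polynomial ℕ := pM.comp (.C 2 * (.X + m)) with hT
  obtain ⟨M', S, P, h1, h2, hP, hS, h3⟩ := exists_outer B M hN hNp m T q k (q₁ = .ex)
  refine ⟨P, M', h1, h2, fun x => ?_⟩
  rw [hS₀]
  have hacc : ∀ y : List R, y.length = m.eval x.length → (M.Accepts B Q (B.tuple x [y]) ↔
      ((M.step Q)^[T.eval x.length] (B.init (B.tuple x [y]))).idx 0 = 1 ∧
      ((M.step Q)^[T.eval x.length] (B.init (B.tuple x [y]))).mem 0 = B.one) := by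
    intro y hy
    refine hpM _ _ (le_of_eq ?_)
    rw [length_tuple B x (by simp), List.flatten_singleton, hy]
    simp [hT, Polynomial.eval_comp]
  cases q₁ with
  | ex =>
    rw [Alternating]
    have := alternating_guess_iff B M N hQ (fun c => c.idx 0 = 1 ∧ c.mem 0 = B.one) x
      (hP x.length) (hS x.length)
    refine Iff.trans (exists_congr fun y => and_congr_right fun hy => hacc y hy) (this.symm.trans ?_)
    refine Alternating.congr fun Ws hWs hlen => ?_
    rw [h3 x Ws hWs hlen _ rfl]
    simp
  | all =>
    rw [Alternating]
    have := alternating_guess_iff B M N hQ (fun c => ¬ (c.idx 0 = 1 ∧ c.mem 0 = B.one)) x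
      (hP x.length) (hS x.length)
    rw [← not_iff_not] at this
    rw [Alternating.not_iff] at this
    refine Iff.trans ?_ (this.symm.trans ?_)
    · exact ⟨fun h ⟨y, hy, hn⟩ => hn ((hacc y hy).1 (h y hy)),
        fun h y hy => (hacc y hy).2 (by_contra fun hn => h ⟨y, hy, hn⟩)⟩
    · refine Alternating.congr fun Ws hWs hlen => ?_
      rw [h3 x Ws hWs hlen _ rfl]
      simp

end Hierarchy

end RMachine

theorem mainTheorem8 {L : FirstOrder.Language.{u, v}} {R : Type w} [L.Structure R]
    (B : RMachine.Bipointed L R) (k : ℕ) :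
    RMachine.SigmaClass B (k + 1) = RMachine.NPOracle B (RMachine.SigmaClass B k) ∧
      RMachine.PiClass B (k + 1) = RMachine.CoNPOracle B (RMachine.SigmaClass B k) :=
  ⟨(RMachine.level_subset_oracleLevel B .ex k).antisymm (RMachine.oracleLevel_subset_level B .ex k),
    (RMachine.level_subset_oracleLevel B .all k).antisymm
      (RMachine.oracleLevel_subset_level B .all k)⟩
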